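/- **Theorem.** Let $P\ge 0$, $a\ge 0$ and $b_1\ge b_2\ge 0$. Consider the memoryless channel with real input $X$ and outputs $$Y=\sqrt{a}\,X+N_1,\qquad Z_1=\sqrt{b_1}\,X+N_2,\qquad Z_2=\sqrt{b_2}\,X+N_3,$$ where $N_1,N_2,N_3$ are Gaussian with zero mean and unit variance (with any joint law), the noise triples of different channel uses are i.i.d., and the noise is independent of the input. A code of block length $n$ consists of two nonempty finite message sets $\mathcal M_1,\mathcal M_2$, a stochastic encoder mapping each message pair to a random input block $X^n$ with $\frac1n\sum_{i=1}^n X[i]^2\le P$ almost surely, and a decoder that estimates both messages from $Y^n$. The high-security message $M_1$ and the low-security message $M_2$ are independent and uniformly distributed on $\mathcal M_1$ and $\mathcal M_2$. A rate pair $(R_1,R_2)$ is achievable if there is a sequence of codes, one for each block length $n$, such that, as $n\to\infty$, $\frac1n\log_2|\mathcal M_k|\to R_k$ for $k=1,2$, the probability that the decoder fails to recover $(M_1,M_2)$ tends to $0$, and $$\tfrac1n I(M_1,M_2;Z_2^n)\to 0,\qquad \tfrac1n I(M_1;Z_1^n)\to 0 .$$ The secrecy capacity region, i.e. the set of all achievable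 rate pairs, is exactly the set of all pairs $(R_1,R_2)$ with $R_1,R_2\ge 0$ such that $$R_1\le C_s(P,a,b_1)\qquad\text{and}\qquad R_1+R_2\le C_s(P,a,b_2),$$ where $C_s(P,a,b)=\left[\tfrac12\log_2(1+aP)-\tfrac12\log_2(1+bP)\right]^+$ and $[x]^+=\max(0,x)$. -/

import Mathlib

open MeasureTheory ProbabilityTheory Filter Topology

namespace TwoLevelWiretap

/-- Mutual information `I(U; V)` (in nats) of two random variables on `(Ω, μ)`: the relative entropy
of their joint law with respect to the product of their laws. -/
noncomputable def mutualInfo {Ω α β : Type*} [MeasurableSpace Ω] [MeasurableSpace α]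
    [MeasurableSpace β] (μ : Measure Ω) (U : Ω → α) (V : Ω → β) : ENNReal :=
  InformationTheory.klDiv (μ.map fun ω => (U ω, V ω)) ((μ.map U).prod (μ.map V))

/-- `ν` is a possible law of the noise triple `(N₁, N₂, N₃)` of one channel use: each component is
Gaussian with zero mean and unit variance. The correlation between components is arbitrary. -/
structure IsUnitGaussianNoise (ν : Measure (ℝ × ℝ × ℝ)) : Prop where
  law_fst : ν.map (fun t => t.1) = gaussianReal 0 1
  law_snd : ν.map (fun t => t.2.1) = gaussianReal 0 1
  law_thd : ν.map (fun t => t.2.2) = gaussianReal 0 1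

/-- A code of block length `n` under the average power constraint `P`: two nonempty finite message
sets, a stochastic encoder (the law of the channel input block given the message pair) all of whose
codewords satisfy the power constraint almost surely, and a decoder for the legitimate receiver. -/
structure Code (n : ℕ) (P : ℝ) where
  card₁ : ℕ
  card₂ : ℕ
  card₁_pos : 0 < card₁
  card₂_pos : 0 < card₂
  enc : Kernel (Fin card₁ × Fin card₂) (Fin n → ℝ)
  isMarkov_enc : IsMarkovKernel enc
  power_le : ∀ m, ∀ᵐ x ∂(enc m), (1 / (n : ℝ)) * ∑ i, (x i) ^ 2 ≤ P
  dec : (Fin n → ℝ) → Fin card₁ × Fin card₂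
  measurable_dec : Measurable dec

namespace Code

variable {n : ℕ} {P : ℝ} (c : Code n P)

/-- Outcomes of one use of the code: the message pair, the input block and the noise block. -/
abbrev Outcome : Type :=
  ((Fin c.card₁ × Fin c.card₂) × (Fin n → ℝ)) × (Fin n → ℝ × ℝ × ℝ)

/-- The law of `((M₁, M₂), Xⁿ, noise)`: the messages are independent and uniform, the input block
is drawn by the encoder, and the noise triples are i.i.d. in time with law `ν` and independent of
messages and input. -/
noncomputable def law (ν : Measure (ℝ × ℝ × ℝ)) : Measure c.Outcome :=
  (((uniformOn (Set.univ : Set (Fin c.card₁))).prod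
      (uniformOn (Set.univ : Set (Fin c.card₂)))).compProd c.enc).prod
    (Measure.pi fun _ : Fin n => ν)

/-- The message pair `(M₁, M₂)`. -/
def messages (ω : c.Outcome) : Fin c.card₁ × Fin c.card₂ := ω.1.1

/-- The high-security message `M₁`. -/
def message₁ (ω : c.Outcome) : Fin c.card₁ := ω.1.1.1

/-- The output block `Yⁿ` of the legitimate receiver, `Y = √a X + N₁`. -/
noncomputable def outputY (a : ℝ) (ω : c.Outcome) : Fin n → ℝ :=
  fun i => √a * ω.1.2 i + (ω.2 i).1

/-- The output block `Z₁ⁿ` of the strong eavesdropper, `Z₁ = √b₁ X + N₂`. -/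
noncomputable def outputZ₁ (b₁ : ℝ) (ω : c.Outcome) : Fin n → ℝ :=
  fun i => √b₁ * ω.1.2 i + (ω.2 i).2.1

/-- The output block `Z₂ⁿ` of the weak eavesdropper, `Z₂ = √b₂ X + N₃`. -/
noncomputable def outputZ₂ (b₂ : ℝ) (ω : c.Outcome) : Fin n → ℝ :=
  fun i => √b₂ * ω.1.2 i + (ω.2 i).2.2

/-- The probability that the legitimate receiver does not recover both messages. -/
noncomputable def errorProb (a : ℝ) (ν : Measure (ℝ × ℝ × ℝ)) : ENNReal :=
  c.law ν {ω | c.dec (c.outputY a ω) ≠ c.messages ω}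

/-- The rate of the high-security message, in bits per channel use. -/
noncomputable def rate₁ : ℝ := Real.logb 2 c.card₁ / n

/-- The rate of the low-security message, in bits per channel use. -/
noncomputable def rate₂ : ℝ := Real.logb 2 c.card₂ / n

end Code

/-- The rate pair `R = (R₁, R₂)` is achievable: there is a sequence of codes, one for each block
length, whose rate pairs tend to `(R₁, R₂)`, whose error probabilities tend to zero, and for which
`(1/n) I(M₁, M₂; Z₂ⁿ) → 0` and `(1/n) I(M₁; Z₁ⁿ) → 0`. -/
def Achievable (P a b₁ b₂ : ℝ) (ν : Measure (ℝ × ℝ × ℝ)) (R : ℝ × ℝ) : Prop :=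
  ∃ c : ∀ n : ℕ, Code n P,
    Tendsto (fun n => (c n).rate₁) atTop (𝓝 R.1) ∧
    Tendsto (fun n => (c n).rate₂) atTop (𝓝 R.2) ∧
    Tendsto (fun n => (c n).errorProb a ν) atTop (𝓝 0) ∧
    Tendsto (fun n : ℕ =>
      mutualInfo ((c n).law ν) (c n).messages ((c n).outputZ₂ b₂) / (n : ENNReal))
      atTop (𝓝 0) ∧
    Tendsto (fun n : ℕ =>
      mutualInfo ((c n).law ν) (c n).message₁ ((c n).outputZ₁ b₁) / (n : ENNReal))
      atTop (𝓝 0)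

/-- The secrecy capacity region: the set of all achievable rate pairs. -/
def secrecyCapacityRegion (P a b₁ b₂ : ℝ) (ν : Measure (ℝ × ℝ × ℝ)) : Set (ℝ × ℝ) :=
  {R | Achievable P a b₁ b₂ ν R}

/-- `C_s(P, a, b) = [½ log₂(1 + aP) - ½ log₂(1 + bP)]⁺`. -/
noncomputable def Cs (P a b : ℝ) : ℝ :=
  max 0 (1 / 2 * Real.logb 2 (1 + a * P) - 1 / 2 * Real.logb 2 (1 + b * P))

end TwoLevelWiretap

/-! Error probability and leakages each involve a single noise component, so only the three Gaussian
marginals matter and the noises may be coupled at will.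

Converse. A uniform message is decoded from `Y`; let `Z` be the eavesdropper's output with gain `b`.
If `a ≤ b`, couple the noises so that `Y` is a noisy version of `Z`; nothing decoded from `Y` can
then escape `Z`. If `b < a`, couple them so that `Z` is a degraded version of `Y`, and compare the
conditional law of `Y` with the Gaussian law centred at the best linear estimate of `Y` from `Z` for
inputs of power `P`. The expected log-density is at most `n` times the difference of the two
capacities. A change of measure (`log_card_mul_le_mutualInfo_add`), playing the role of Fano's
inequality and the chain rule, gives `log |𝓜| · P(success) ≤ I(M; Z) + E[log-density] + 1`. Applied
to `M₁` with `b₁` and to `(M₁, M₂)` with `b₂`, then divided by `n`, this yields both bounds.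

Achievability. Codewords are indexed by `(m₁, m₂, l)` with `l` a uniform dummy index, and are drawn
independently from a Gaussian law of variance `r² < P` conditioned on the power constraint.
Conditioning costs a factor 2 at most (`cond_le_two_smul`). The receiver decodes all three indices
by thresholding the information density, so the total rate may approach `½ log(1 + aP)`. The leakage
is small when the randomization rate exhausts the eavesdropper's capacity: the output law given the
message is then close in divergence to the output law of Gaussian input
(`IsInfoDensity.mutualInfo_le`, `IsInfoDensity.lintegral_leakage_le`). Against `Z₂` only `l`
randomizes; against `Z₁` the low-security message `m₂` randomizes as well. With total rate `A = ½
log(1 + aP)`, these conditions read `A - (R₁ + R₂) ≥ ½ log(1 + b₂P)` and `A - R₁ ≥ ½ log(1 + b₁P)`,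
which is the region up to truncation at zero. Only `o(n)` leakage is needed, so Chebyshev bounds of
order `√n` suffice. -/

namespace TwoLevelWiretap

/-! ### Gaussian blocks and their densities. -/

/-- The law of a block of `n` independent standard Gaussian variables. -/
noncomputable abbrev iidGaussian (n : ℕ) : Measure (Fin n → ℝ) :=
  Measure.pi fun _ => gaussianReal 0 1

/-- The law of a block of independent Gaussian variables with means `c i` and common standard
deviation `s`. -/
noncomputable def gaussianBlock {n : ℕ} (c : Fin n → ℝ) (s : ℝ) : Measure (Fin n → ℝ) :=
  (iidGaussian n).map fun N i => c i + s * N i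

/-- The logarithm of the density of `gaussianBlock c s` with respect to `gaussianBlock c' s'`. -/
noncomputable def gaussianLogRatio {n : ℕ} (c : Fin n → ℝ) (s : ℝ) (c' : Fin n → ℝ) (s' : ℝ)
    (y : Fin n → ℝ) : ℝ :=
  ∑ i, (Real.log (s' / s) + (y i - c' i) ^ 2 / (2 * s' ^ 2) - (y i - c i) ^ 2 / (2 * s ^ 2))

theorem lintegral_pi_prod {ι : Type*} [Fintype ι] {α : ι → Type*} [∀ i, MeasurableSpace (α i)]
    (μ : ∀ i, Measure (α i)) [∀ i, IsProbabilityMeasure (μ i)] {f : ∀ i, α i → ENNReal}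
    (hf : ∀ i, Measurable (f i)) :
    ∫⁻ x, ∏ i, f i (x i) ∂Measure.pi μ = ∏ i, ∫⁻ x, f i x ∂μ i := by
  have h := lintegral_prod_eq_prod_lintegral_of_indepFun (μ := Measure.pi μ) Finset.univ
    (fun i x => f i (x i)) (iIndepFun_pi fun i => (hf i).aemeasurable)
    (fun i => (hf i).comp (measurable_pi_apply i))
  rw [h]
  refine Finset.prod_congr rfl fun i _ => ?_
  exact (measurePreserving_eval μ i).lintegral_comp (hf i)

theorem pi_withDensity {ι : Type*} [Fintype ι] {α : ι → Type*} [∀ i, MeasurableSpace (α i)]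
    (μ : ∀ i, Measure (α i)) [∀ i, IsProbabilityMeasure (μ i)] {f : ∀ i, α i → ENNReal}
    (hf : ∀ i, Measurable (f i)) [∀ i, SigmaFinite ((μ i).withDensity (f i))] :
    Measure.pi (fun i => (μ i).withDensity (f i)) =
      (Measure.pi μ).withDensity (fun x => ∏ i, f i (x i)) := by
  refine Measure.pi_eq fun s hs => ?_
  rw [withDensity_apply _ (MeasurableSet.univ_pi hs), ← lintegral_indicator
    (MeasurableSet.univ_pi hs)]
  have : ∀ x : ∀ i, α i, (Set.univ.pi s).indicator (fun x => ∏ i, f i (x i)) x =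
      ∏ i, (s i).indicator (f i) (x i) := by
    intro x
    by_cases hx : x ∈ Set.univ.pi s
    · rw [Set.indicator_of_mem hx]
      exact Finset.prod_congr rfl fun i _ => (Set.indicator_of_mem (hx i trivial) _).symm
    · rw [Set.indicator_of_notMem hx]
      simp only [Set.mem_univ_pi, not_forall] at hx
      obtain ⟨i, hi⟩ := hx
      exact (Finset.prod_eq_zero (Finset.mem_univ i) (Set.indicator_of_notMem hi _)).symm
  simp_rw [this]
  rw [lintegral_pi_prod μ fun i => (hf i).indicator (hs i)]
  refine Finset.prod_congr rfl fun i _ => ?_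
  rw [lintegral_indicator (hs i), withDensity_apply _ (hs i)]

theorem gaussianReal_map_affine (c s : ℝ) :
    (gaussianReal 0 1).map (fun x => c + s * x) = gaussianReal c (NNReal.mk (s ^ 2) (sq_nonneg s)) := by
  have : (fun x : ℝ => c + s * x) = (fun x => c + x) ∘ (fun x => s * x) := rfl
  rw [this, ← Measure.map_map (by fun_prop) (by fun_prop), gaussianReal_map_const_mul,
    gaussianReal_map_const_add]
  simp

instance {n : ℕ} (c : Fin n → ℝ) (s : ℝ) : IsProbabilityMeasure (gaussianBlock c s) :=
  Measure.isProbabilityMeasure_map (Measurable.aemeasurable (by fun_prop))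

theorem gaussianBlock_eq_pi {n : ℕ} (c : Fin n → ℝ) (s : ℝ) :
    gaussianBlock c s = Measure.pi fun i => gaussianReal (c i) (NNReal.mk (s ^ 2) (sq_nonneg s)) := by
  have : ∀ i, IsProbabilityMeasure ((gaussianReal 0 1).map fun x => c i + s * x) :=
    fun i => Measure.isProbabilityMeasure_map (by fun_prop)
  unfold gaussianBlock iidGaussian
  rw [Measure.pi_map_pi (f := fun i x => c i + s * x) (fun i => by fun_prop)]
  simp_rw [gaussianReal_map_affine]

theorem gaussianReal_eq_withDensity (c c' : ℝ) {s s' : ℝ} (hs : 0 < s) (hs' : 0 < s') :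
    gaussianReal c (NNReal.mk (s ^ 2) (sq_nonneg s)) =
      (gaussianReal c' (NNReal.mk (s' ^ 2) (sq_nonneg s'))).withDensity fun y => ENNReal.ofReal (Real.exp
        (Real.log (s' / s) + (y - c') ^ 2 / (2 * s' ^ 2) - (y - c) ^ 2 / (2 * s ^ 2))) := by
  have hv : ((NNReal.mk (s ^ 2) (sq_nonneg s))) ≠ 0 := by
    intro h; have := congrArg NNReal.toReal h; simp at this; exact hs.ne' this
  have hv' : ((NNReal.mk (s' ^ 2) (sq_nonneg s'))) ≠ 0 := by
    intro h; have := congrArg NNReal.toReal h; simp at this; exact hs'.ne' this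
  rw [gaussianReal_of_var_ne_zero _ hv, gaussianReal_of_var_ne_zero _ hv',
    ← withDensity_mul _ (measurable_gaussianPDF _ _) (by fun_prop)]
  congr 1
  ext y
  simp only [gaussianPDF, Pi.mul_apply]
  rw [← ENNReal.ofReal_mul (gaussianPDFReal_nonneg _ _ _)]
  congr 1
  simp only [gaussianPDFReal, NNReal.coe_mk]
  rw [add_sub_assoc, Real.exp_add, Real.exp_log (by positivity), Real.exp_sub,
    Real.sqrt_mul' _ (sq_nonneg s), Real.sqrt_mul' _ (sq_nonneg s'), Real.sqrt_sq hs.le,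
    Real.sqrt_sq hs'.le, neg_div, neg_div, Real.exp_neg, Real.exp_neg]
  have h₁ := (Real.exp_pos ((y - c') ^ 2 / (2 * s' ^ 2))).ne'
  have h₂ := (Real.exp_pos ((y - c) ^ 2 / (2 * s ^ 2))).ne'
  generalize Real.exp ((y - c') ^ 2 / (2 * s' ^ 2)) = u at *
  generalize Real.exp ((y - c) ^ 2 / (2 * s ^ 2)) = w at *
  have : (0 : ℝ) < √(2 * Real.pi) := by positivity
  field_simp

theorem gaussianBlock_eq_withDensity {n : ℕ} (c c' : Fin n → ℝ) {s s' : ℝ} (hs : 0 < s)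
    (hs' : 0 < s') :
    gaussianBlock c s = (gaussianBlock c' s').withDensity fun y =>
      ENNReal.ofReal (Real.exp (gaussianLogRatio c s c' s' y)) := by
  have h := fun i => gaussianReal_eq_withDensity (c i) (c' i) hs hs'
  have : ∀ i, SigmaFinite ((gaussianReal (c' i) (NNReal.mk (s' ^ 2) (sq_nonneg s'))).withDensity fun y =>
      ENNReal.ofReal (Real.exp (Real.log (s' / s) + (y - c' i) ^ 2 / (2 * s' ^ 2) -
        (y - c i) ^ 2 / (2 * s ^ 2)))) := fun i => by rw [← h i]; infer_instance
  rw [gaussianBlock_eq_pi, gaussianBlock_eq_pi]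
  simp_rw [h]
  rw [pi_withDensity _ fun i => by fun_prop]
  congr 1
  ext y
  rw [gaussianLogRatio, Real.exp_sum, ENNReal.ofReal_prod_of_nonneg fun i _ => (Real.exp_pos _).le]

theorem lintegral_uniformOn_univ {ι : Type*} [Fintype ι] [MeasurableSpace ι]
    [MeasurableSingletonClass ι] (f : ι → ENNReal) :
    ∫⁻ i, f i ∂(uniformOn (Set.univ : Set ι)) = (Fintype.card ι : ENNReal)⁻¹ * ∑ i, f i := by
  rw [uniformOn, ProbabilityTheory.cond, lintegral_smul_measure, Measure.restrict_univ,
    lintegral_count, tsum_fintype, Measure.count_univ]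
  simp

/-! ### Change of measure and the general converse inequality. -/

/-- Dividing by the density turns `μ` back into `ν`. Equality may fail because `ν` can charge the
set where the density vanishes. -/
theorem lintegral_exp_neg_llr_mul_le {α : Type*} [MeasurableSpace α] {μ ν : Measure α}
    [IsProbabilityMeasure μ] [IsProbabilityMeasure ν] (h : μ ≪ ν) {f : α → ENNReal}
    (hf : Measurable f) :
    ∫⁻ x, ENNReal.ofReal (Real.exp (-llr μ ν x)) * f x ∂μ ≤ ∫⁻ x, f x ∂ν := by
  have hmeas : Measurable fun x => (μ.rnDeriv ν x)⁻¹ * f x := by fun_prop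
  calc ∫⁻ x, ENNReal.ofReal (Real.exp (-llr μ ν x)) * f x ∂μ
      = ∫⁻ x, (μ.rnDeriv ν x)⁻¹ * f x ∂μ := by
        refine lintegral_congr_ae ?_
        filter_upwards [Measure.rnDeriv_pos h, h.ae_le (Measure.rnDeriv_lt_top μ ν)] with x h0 h1
        have := ENNReal.toReal_pos h0.ne' h1.ne
        rw [llr, Real.exp_neg, Real.exp_log this, ENNReal.ofReal_inv_of_pos this,
          ENNReal.ofReal_toReal h1.ne]
    _ = ∫⁻ x, μ.rnDeriv ν x * ((μ.rnDeriv ν x)⁻¹ * f x) ∂ν := by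
        conv_lhs => rw [← Measure.withDensity_rnDeriv_eq μ ν h]
        rw [lintegral_withDensity_eq_lintegral_mul _ (Measure.measurable_rnDeriv _ _)
          (by rw [Measure.withDensity_rnDeriv_eq μ ν h]; exact hmeas)]
        rw [Measure.withDensity_rnDeriv_eq μ ν h]
        rfl
    _ ≤ ∫⁻ x, f x ∂ν := by
        refine lintegral_mono fun x => ?_
        rw [← mul_assoc]
        calc _ ≤ 1 * f x := by gcongr; exact ENNReal.mul_inv_le_one _
          _ = f x := one_mul _

/-- If the output `k t N` given the state `t` has log-density `l t` with respect to the law of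
`q (z t) N`, then a uniform message `m t` that is decoded from this output has to be paid for by
the information in `z` and by the expected log-density. -/
theorem log_card_mul_le_mutualInfo_add {T 𝓜 Z Y S : Type*} [MeasurableSpace T] [MeasurableSpace 𝓜]
    [MeasurableSpace Z] [MeasurableSpace Y] [MeasurableSpace S] [Fintype 𝓜] [Nonempty 𝓜]
    [MeasurableSingletonClass 𝓜] (σ : Measure T) [IsProbabilityMeasure σ] {m : T → 𝓜} {z : T → Z}
    (hm : Measurable m) (hz : Measurable z) (hunif : σ.map m = uniformOn Set.univ)
    (η : Measure S) [IsProbabilityMeasure η] {k : T → S → Y} (hk : Measurable (Function.uncurry k))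
    {q : Z → S → Y} (hq : Measurable (Function.uncurry q)) {l : T → Y → ℝ}
    (hl : Measurable (Function.uncurry l))
    (hdens : ∀ t, η.map (k t) =
      (η.map (q (z t))).withDensity fun y => ENNReal.ofReal (Real.exp (l t y)))
    (hint : Integrable (fun p : T × S => l p.1 (k p.1 p.2)) (σ.prod η))
    {dec : Y → 𝓜} (hdec : Measurable dec) (hI : mutualInfo σ m z ≠ ⊤) :
    Real.log (Fintype.card 𝓜) * (σ.prod η).real {p | dec (k p.1 p.2) = m p.1} ≤
      (mutualInfo σ m z).toReal + ∫ p, l p.1 (k p.1 p.2) ∂(σ.prod η) + 1 := by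
  classical
  set R := (σ.map m).prod (σ.map z) with hR
  set J := σ.map fun t => (m t, z t) with hJ
  have hmz : Measurable fun t => (m t, z t) := hm.prodMk hz
  have : IsProbabilityMeasure (σ.map m) := Measure.isProbabilityMeasure_map hm.aemeasurable
  have : IsProbabilityMeasure (σ.map z) := Measure.isProbabilityMeasure_map hz.aemeasurable
  have : IsProbabilityMeasure J := Measure.isProbabilityMeasure_map hmz.aemeasurable
  have hIJ : mutualInfo σ m z = InformationTheory.klDiv J R := rfl
  obtain ⟨hac, hllr⟩ := InformationTheory.klDiv_ne_top_iff.1 (hIJ ▸ hI)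
  have hItoReal : (mutualInfo σ m z).toReal = ∫ w, llr J R w ∂J := by
    rw [hIJ, InformationTheory.toReal_klDiv_of_measure_eq hac (by simp)]
  have hpres : MeasurePreserving (fun p : T × S => (m p.1, z p.1)) (σ.prod η) J :=
    (hmz.measurePreserving σ).comp measurePreserving_fst
  have hllr' : Integrable (fun p : T × S => llr J R (m p.1, z p.1)) (σ.prod η) :=
    hpres.integrable_comp_of_integrable hllr
  have hIint : ∫ w, llr J R w ∂J = ∫ p, llr J R (m p.1, z p.1) ∂(σ.prod η) := by
    have h := integral_map (μ := σ.prod η) hpres.measurable.aemeasurable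
      (stronglyMeasurable_llr J R).aestronglyMeasurable
    rwa [hpres.map_eq] at h
  set K : ℝ := (Fintype.card 𝓜 : ℝ) with hK
  have hK1 : 1 ≤ K := by rw [hK]; exact_mod_cast Fintype.card_pos (α := 𝓜)
  set E : Set (T × S) := {p | dec (k p.1 p.2) = m p.1} with hE
  have hEm : MeasurableSet E :=
    measurableSet_eq_fun (hdec.comp hk) (hm.comp measurable_fst)
  -- The exponential of `f` is `K` on correct decoding and 1 otherwise: a reward whose mean stays
  -- bounded when the message is guessed blindly.
  set f : 𝓜 → Y → ℝ := fun μ y => if dec y = μ then Real.log K else 0 with hf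
  have hfm : Measurable (Function.uncurry f) := by
    refine Measurable.ite ?_ measurable_const measurable_const
    exact measurableSet_eq_fun (hdec.comp measurable_snd) measurable_fst
  set G : T × S → ℝ := fun p => f (m p.1) (k p.1 p.2) - llr J R (m p.1, z p.1) -
    l p.1 (k p.1 p.2) with hG
  have hfE : ∀ p : T × S, f (m p.1) (k p.1 p.2) = E.indicator (fun _ => Real.log K) p := by
    intro p
    simp only [hf, hE, Set.indicator_apply, Set.mem_ofPred_eq]
  have hfint : Integrable (fun p : T × S => f (m p.1) (k p.1 p.2)) (σ.prod η) := by
    simp_rw [hfE]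
    exact (integrable_const _).indicator hEm
  have hfval : ∫ p : T × S, f (m p.1) (k p.1 p.2) ∂(σ.prod η) =
      Real.log K * (σ.prod η).real E := by
    simp_rw [hfE]
    rw [integral_indicator hEm, integral_const, smul_eq_mul, mul_comm, measureReal_restrict_apply
      MeasurableSet.univ, Set.univ_inter]
  have hGint : Integrable G (σ.prod η) := (hfint.sub hllr').sub hint
  have hGval : ∫ p, G p ∂(σ.prod η) = Real.log K * (σ.prod η).real E - (mutualInfo σ m z).toReal -
      ∫ p, l p.1 (k p.1 p.2) ∂(σ.prod η) := by
    rw [hItoReal, hIint, ← hfval, ← integral_sub hfint hllr', ← integral_sub _ hint]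
    exact hfint.sub hllr'
  have hllrm : Measurable (llr J R) := (stronglyMeasurable_llr J R).measurable
  -- The factor `exp (-l)` replaces the output by `q (z t)`, a function of `z` and fresh noise; the
  -- factor `exp (-llr)` then makes message and `z` independent. What remains is the mean reward of
  -- a blind guess.
  have hkey : ∫⁻ p, ENNReal.ofReal (Real.exp (G p)) ∂(σ.prod η) ≤ 2 := by
    set A : 𝓜 × Z → ENNReal := fun w => ∫⁻ s, ENNReal.ofReal (Real.exp (f w.1 (q w.2 s))) ∂η
      with hA
    have hAm : Measurable A := by
      refine Measurable.lintegral_prod_right' (f := fun p : (𝓜 × Z) × S =>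
        ENNReal.ofReal (Real.exp (f p.1.1 (q p.1.2 p.2)))) ?_
      have : Measurable fun p : (𝓜 × Z) × S => f p.1.1 (q p.1.2 p.2) :=
        hfm.comp ((measurable_fst.comp measurable_fst).prodMk
          (hq.comp ((measurable_snd.comp measurable_fst).prodMk measurable_snd)))
      fun_prop
    have hstep : ∀ t, ∫⁻ s, ENNReal.ofReal (Real.exp (G (t, s))) ∂η =
        ENNReal.ofReal (Real.exp (-llr J R (m t, z t))) * A (m t, z t) := by
      intro t
      have hkt : Measurable (k t) := hk.comp measurable_prodMk_left
      have hqt : Measurable (q (z t)) := hq.comp measurable_prodMk_left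
      have hlt : Measurable (l t) := hl.comp measurable_prodMk_left
      have hft : Measurable (f (m t)) := hfm.comp measurable_prodMk_left
      have h1 : ∫⁻ s, ENNReal.ofReal (Real.exp (G (t, s))) ∂η = ∫⁻ y, ENNReal.ofReal
          (Real.exp (f (m t) y - llr J R (m t, z t) - l t y)) ∂(η.map (k t)) := by
        rw [lintegral_map (by fun_prop) hkt]
      rw [h1, hdens t, lintegral_withDensity_eq_lintegral_mul _ (by fun_prop) (by fun_prop),
        lintegral_map (by fun_prop) hqt, hA, ← lintegral_const_mul _ (by fun_prop)]
      refine lintegral_congr fun s => ?_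
      simp only [Pi.mul_apply]
      rw [← ENNReal.ofReal_mul (Real.exp_pos _).le, ← ENNReal.ofReal_mul (Real.exp_pos _).le,
        ← Real.exp_add, ← Real.exp_add]
      congr 2
      ring
    have hGm : Measurable fun p => ENNReal.ofReal (Real.exp (G p)) := by
      have h1 : Measurable fun p : T × S => f (m p.1) (k p.1 p.2) :=
        hfm.comp ((hm.comp measurable_fst).prodMk hk)
      have h2 : Measurable fun p : T × S => l p.1 (k p.1 p.2) :=
        hl.comp (measurable_fst.prodMk hk)
      have h3 : Measurable fun p : T × S => llr J R (m p.1, z p.1) :=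
        hllrm.comp hpres.measurable
      exact ((h1.sub h3).sub h2).exp.ennreal_ofReal
    rw [lintegral_prod _ hGm.aemeasurable]
    simp_rw [hstep]
    have h2 : ∫⁻ t, ENNReal.ofReal (Real.exp (-llr J R (m t, z t))) * A (m t, z t) ∂σ =
        ∫⁻ w, ENNReal.ofReal (Real.exp (-llr J R w)) * A w ∂J := by
      rw [hJ, lintegral_map _ hmz]
      exact (hllrm.neg.exp.ennreal_ofReal).mul hAm
    rw [h2]
    refine (lintegral_exp_neg_llr_mul_le hac hAm).trans ?_
    rw [hR, lintegral_prod_symm _ hAm.aemeasurable]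
    -- The guess does not depend on the uniform message, so it is right with probability `1 / K`,
    -- and the mean reward is at most `1 + K * (1 / K)`.
    have h3 : ∀ ζ, ∫⁻ μ, A (μ, ζ) ∂(σ.map m) ≤ 2 := by
      intro ζ
      have hqt : Measurable (q ζ) := hq.comp measurable_prodMk_left
      have hD : ∀ μ, MeasurableSet {s | dec (q ζ s) = μ} := fun μ =>
        (hdec.comp hqt) (measurableSet_singleton μ)
      have hAle : ∀ μ, A (μ, ζ) ≤ 1 + Fintype.card 𝓜 * η {s | dec (q ζ s) = μ} := by
        intro μ
        calc A (μ, ζ) ≤ ∫⁻ s, (1 + Fintype.card 𝓜 * ({s | dec (q ζ s) = μ}).indicator 1 s) ∂η := by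
              refine lintegral_mono fun s => ?_
              by_cases hs : dec (q ζ s) = μ
              · simp only [hf, hs, if_true]
                rw [Real.exp_log (by linarith), hK, ENNReal.ofReal_natCast,
                  Set.indicator_of_mem (by exact hs)]
                simp
              · simp [hf, hs]
          _ = _ := by
              rw [lintegral_add_left measurable_const, lintegral_const_mul _
                (measurable_one.indicator (hD μ)), lintegral_indicator_one (hD μ)]
              simp
      have hsum : ∑ μ, η {s | dec (q ζ s) = μ} = 1 := by
        have := sum_measure_preimage_singleton (μ := η) (f := fun s => dec (q ζ s)) Finset.univ
          (fun μ _ => hD μ)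
        simp only [Finset.coe_univ, Set.preimage_univ, measure_univ] at this
        exact this
      rw [hunif, lintegral_uniformOn_univ]
      have hc0 : (Fintype.card 𝓜 : ENNReal) ≠ 0 := by simp
      calc _ ≤ (Fintype.card 𝓜 : ENNReal)⁻¹ *
            ∑ μ, (1 + Fintype.card 𝓜 * η {s | dec (q ζ s) = μ}) := by
            gcongr with μ; exact hAle μ
        _ = 2 := by
            rw [Finset.sum_add_distrib, ← Finset.mul_sum, hsum]
            simp only [Finset.sum_const, Finset.card_univ, nsmul_eq_mul, mul_one]
            rw [← two_mul, mul_comm 2, ← mul_assoc, ENNReal.inv_mul_cancel hc0 (by simp), one_mul]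
    calc _ ≤ ∫⁻ _, 2 ∂(σ.map z) := lintegral_mono h3
      _ = 2 := by simp
  have hGexp : Integrable (fun p => Real.exp (G p)) (σ.prod η) := by
    refine ⟨Real.continuous_exp.comp_aestronglyMeasurable hGint.1, ?_⟩
    rw [hasFiniteIntegral_iff_ofReal (ae_of_all _ fun p => (Real.exp_pos _).le)]
    exact hkey.trans_lt (by simp)
  have hexpint : ∫ p, Real.exp (G p) ∂(σ.prod η) ≤ 2 := by
    rw [integral_eq_lintegral_of_nonneg_ae (ae_of_all _ fun p => (Real.exp_pos _).le) hGexp.1]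
    exact ENNReal.toReal_le_of_le_ofReal (by norm_num) (by simpa using hkey)
  -- The inequality `x ≤ exp x - 1` replaces Jensen and produces the additive constant `2 - 1 = 1`.
  have hle : ∫ p, G p ∂(σ.prod η) ≤ ∫ p, (Real.exp (G p) - 1) ∂(σ.prod η) := by
    refine integral_mono hGint (hGexp.sub (integrable_const _)) fun p => ?_
    have := Real.add_one_le_exp (G p)
    simp only
    linarith
  rw [integral_sub hGexp (integrable_const _)] at hle
  simp only [integral_const, probReal_univ, smul_eq_mul, mul_one] at hle
  linarith

/-! ### Linear combinations and moments of Gaussian blocks. -/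

theorem gaussianReal_prod_map_linear (ρ s τ : ℝ) (hτ : τ ^ 2 = ρ ^ 2 + s ^ 2) :
    ((gaussianReal 0 1).prod (gaussianReal 0 1)).map (fun p => ρ * p.1 + s * p.2) =
      gaussianReal 0 (NNReal.mk (τ ^ 2) (sq_nonneg τ)) := by
  have hind := indepFun_prod (μ := gaussianReal 0 1) (ν := gaussianReal 0 1)
    (X := fun x : ℝ => ρ * x) (Y := fun x : ℝ => s * x) (by fun_prop) (by fun_prop)
  have h1 : ((gaussianReal 0 1).prod (gaussianReal 0 1)).map (fun p : ℝ × ℝ => ρ * p.1) =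
      gaussianReal 0 (NNReal.mk (ρ ^ 2) (sq_nonneg ρ)) := by
    have := gaussianReal_map_affine 0 ρ
    simp only [zero_add] at this
    rw [← this]
    exact (((measurable_const_mul ρ).measurePreserving _).comp measurePreserving_fst).map_eq
  have h2 : ((gaussianReal 0 1).prod (gaussianReal 0 1)).map (fun p : ℝ × ℝ => s * p.2) =
      gaussianReal 0 (NNReal.mk (s ^ 2) (sq_nonneg s)) := by
    have := gaussianReal_map_affine 0 s
    simp only [zero_add] at this
    rw [← this]
    exact (((measurable_const_mul s).measurePreserving _).comp measurePreserving_snd).map_eq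
  have h := gaussianReal_add_gaussianReal_of_indepFun hind h1 h2
  have e : (NNReal.mk (ρ ^ 2) (sq_nonneg ρ)) + (NNReal.mk (s ^ 2) (sq_nonneg s)) =
      NNReal.mk (τ ^ 2) (sq_nonneg τ) := by
    ext; simp [hτ]
  rw [zero_add, e] at h
  exact h

theorem iidGaussian_prod_map_linear {n : ℕ} (ρ s τ : ℝ) (hτ : τ ^ 2 = ρ ^ 2 + s ^ 2) :
    ((iidGaussian n).prod (iidGaussian n)).map (fun p i => ρ * p.1 i + s * p.2 i) =
      gaussianBlock 0 τ := by
  rw [← (measurePreserving_arrowProdEquivProdArrow ℝ ℝ (Fin n) (fun _ => gaussianReal 0 1)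
    (fun _ => gaussianReal 0 1)).map_eq, Measure.map_map (by fun_prop) (by fun_prop),
    gaussianBlock_eq_pi]
  have : ∀ i : Fin n, IsProbabilityMeasure (((gaussianReal 0 1).prod (gaussianReal 0 1)).map
      (fun p => ρ * p.1 + s * p.2)) :=
    fun i => Measure.isProbabilityMeasure_map (by fun_prop)
  have h := Measure.pi_map_pi (ι := Fin n) (μ := fun _ => (gaussianReal 0 1).prod (gaussianReal 0 1))
    (f := fun _ p => ρ * p.1 + s * p.2) (fun i => by fun_prop)
  simp_rw [gaussianReal_prod_map_linear ρ s τ hτ] at h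
  exact h

theorem gaussianBlock_zero_one {n : ℕ} : gaussianBlock (0 : Fin n → ℝ) 1 = iidGaussian n := by
  simp [gaussianBlock]

theorem memLp_eval_iidGaussian {n : ℕ} (i : Fin n) (p : NNReal) :
    MemLp (fun N : Fin n → ℝ => N i) p (iidGaussian n) :=
  (memLp_id_gaussianReal p).comp_measurePreserving
    (measurePreserving_eval (fun _ : Fin n => gaussianReal 0 1) i)

theorem integral_eval_iidGaussian {n : ℕ} (i : Fin n) :
    ∫ N : Fin n → ℝ, N i ∂iidGaussian n = 0 := by
  have h := integral_map (μ := iidGaussian n) (φ := fun N => N i) (f := fun x : ℝ => x)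
    (measurable_pi_apply i).aemeasurable (by fun_prop)
  rw [(measurePreserving_eval (fun _ : Fin n => gaussianReal 0 1) i).map_eq,
    integral_id_gaussianReal] at h
  exact h.symm

theorem integral_eval_sq_iidGaussian {n : ℕ} (i : Fin n) :
    ∫ N : Fin n → ℝ, N i ^ 2 ∂iidGaussian n = 1 := by
  have h := integral_map (μ := iidGaussian n) (φ := fun N => N i) (f := fun x : ℝ => x ^ 2)
    (measurable_pi_apply i).aemeasurable (by fun_prop)
  rw [(measurePreserving_eval (fun _ : Fin n => gaussianReal 0 1) i).map_eq] at h
  have hv := variance_eq_sub (memLp_id_gaussianReal (μ := 0) (v := 1) 2)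
  simp only [variance_id_gaussianReal, id, integral_id_gaussianReal] at hv
  rw [← h]
  simpa using hv.symm

theorem integral_add_mul_eval_sq {n : ℕ} (i : Fin n) (u s : ℝ) :
    ∫ N : Fin n → ℝ, (u + s * N i) ^ 2 ∂iidGaussian n = u ^ 2 + s ^ 2 := by
  have h1 : Integrable (fun N : Fin n → ℝ => N i) (iidGaussian n) :=
    (memLp_eval_iidGaussian i 1).integrable le_rfl
  have h2 : Integrable (fun N : Fin n → ℝ => N i ^ 2) (iidGaussian n) :=
    (memLp_eval_iidGaussian i 2).integrable_sq
  have h3 : Integrable (fun N : Fin n → ℝ => 2 * u * s * N i + s ^ 2 * N i ^ 2) (iidGaussian n) :=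
    (h1.const_mul _).add (h2.const_mul _)
  have : ∀ N : Fin n → ℝ, (u + s * N i) ^ 2 = u ^ 2 + (2 * u * s * N i + s ^ 2 * N i ^ 2) := by
    intro N; ring
  simp_rw [this]
  rw [integral_add (integrable_const _) h3,
    integral_add (h1.const_mul _) (h2.const_mul _), integral_const_mul, integral_const_mul,
    integral_eval_iidGaussian, integral_eval_sq_iidGaussian]
  simp

/-! ### Reduction to the marginal channels. -/

/-- Mutual information sees only joint laws. This allows the two noise components irrelevant to a
given receiver to be discarded. -/
theorem mutualInfo_comp {Ω Ω' α β : Type*} [MeasurableSpace Ω] [MeasurableSpace Ω']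
    [MeasurableSpace α] [MeasurableSpace β] {μ : Measure Ω} {μ' : Measure Ω'} {T : Ω → Ω'}
    (hT : MeasurePreserving T μ μ') {U : Ω' → α} {V : Ω' → β} (hU : Measurable U)
    (hV : Measurable V) :
    mutualInfo μ (fun ω => U (T ω)) (fun ω => V (T ω)) = mutualInfo μ' U V := by
  unfold mutualInfo
  rw [← hT.map_eq, Measure.map_map hU hT.measurable, Measure.map_map hV hT.measurable,
    Measure.map_map (hU.prodMk hV) hT.measurable]
  rfl

theorem IsUnitGaussianNoise.isProbabilityMeasure {ν : Measure (ℝ × ℝ × ℝ)}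
    (h : IsUnitGaussianNoise ν) : IsProbabilityMeasure ν := by
  have : IsProbabilityMeasure (ν.map fun t => t.1) := by rw [h.law_fst]; infer_instance
  exact Measure.isProbabilityMeasure_of_map (fun t : ℝ × ℝ × ℝ => t.1)

namespace Code

variable {n : ℕ} {P : ℝ} (c : Code n P)

/-- The joint law of the messages and the input block. -/
noncomputable def inputLaw : Measure ((Fin c.card₁ × Fin c.card₂) × (Fin n → ℝ)) :=
  ((uniformOn (Set.univ : Set (Fin c.card₁))).prod
      (uniformOn (Set.univ : Set (Fin c.card₂)))).compProd c.enc

instance nonempty_fin_card₁ : Nonempty (Fin c.card₁) := ⟨⟨0, c.card₁_pos⟩⟩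

instance nonempty_fin_card₂ : Nonempty (Fin c.card₂) := ⟨⟨0, c.card₂_pos⟩⟩

instance isProbabilityMeasure_uniformOn₁ :
    IsProbabilityMeasure (uniformOn (Set.univ : Set (Fin c.card₁))) :=
  isProbabilityMeasure_uniformOn Set.finite_univ Set.univ_nonempty

instance isProbabilityMeasure_uniformOn₂ :
    IsProbabilityMeasure (uniformOn (Set.univ : Set (Fin c.card₂))) :=
  isProbabilityMeasure_uniformOn Set.finite_univ Set.univ_nonempty

instance isProbabilityMeasure_inputLaw : IsProbabilityMeasure c.inputLaw := by
  have := c.isMarkov_enc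
  unfold inputLaw
  infer_instance

theorem inputLaw_map_fst : c.inputLaw.map Prod.fst =
    (uniformOn (Set.univ : Set (Fin c.card₁))).prod (uniformOn (Set.univ : Set (Fin c.card₂))) := by
  have := c.isMarkov_enc
  exact Measure.fst_compProd _ _

theorem ae_power_le : ∀ᵐ w ∂c.inputLaw, (1 / (n : ℝ)) * ∑ i, (w.2 i) ^ 2 ≤ P := by
  have := c.isMarkov_enc
  refine Measure.ae_compProd_of_ae_ae ?_ (ae_of_all _ c.power_le)
  exact measurableSet_le (by fun_prop) measurable_const

/-- The single-user channel with gain `b`, seen through one component of the noise. -/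
theorem measurePreserving_law {ν : Measure (ℝ × ℝ × ℝ)} [IsProbabilityMeasure ν]
    {φ : ℝ × ℝ × ℝ → ℝ} (hφ : Measurable φ) (h : ν.map φ = gaussianReal 0 1) :
    MeasurePreserving (fun ω : c.Outcome => (ω.1, fun i => φ (ω.2 i))) (c.law ν)
      (c.inputLaw.prod (iidGaussian n)) := by
  have h2 : MeasurePreserving (fun w : Fin n → ℝ × ℝ × ℝ => fun i => φ (w i))
      (Measure.pi fun _ => ν) (iidGaussian n) := by
    refine ⟨by fun_prop, ?_⟩
    have : ∀ i : Fin n, IsProbabilityMeasure (ν.map φ) := fun i => by rw [h]; infer_instance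
    rw [Measure.pi_map_pi (f := fun _ => φ) (fun i => hφ.aemeasurable), h]
  exact (MeasurePreserving.id c.inputLaw).prod h2

/-- Output block of the channel with gain `b`. -/
noncomputable def channelOutput (b : ℝ)
    (p : ((Fin c.card₁ × Fin c.card₂) × (Fin n → ℝ)) × (Fin n → ℝ)) : Fin n → ℝ :=
  fun i => √b * p.1.2 i + p.2 i

theorem measurable_channelOutput (b : ℝ) : Measurable (c.channelOutput b) := by
  unfold channelOutput
  fun_prop

theorem errorProb_eq {a : ℝ} {ν : Measure (ℝ × ℝ × ℝ)} (hν : IsUnitGaussianNoise ν) :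
    c.errorProb a ν =
      (c.inputLaw.prod (iidGaussian n)) {p | c.dec (c.channelOutput a p) ≠ p.1.1} := by
  have := hν.isProbabilityMeasure
  rw [← (c.measurePreserving_law (by fun_prop) hν.law_fst).measure_preimage]
  · rfl
  · exact (measurableSet_eq_fun (c.measurable_dec.comp (c.measurable_channelOutput a))
      (by fun_prop)).compl.nullMeasurableSet

theorem mutualInfo_messages_outputZ₂ {b : ℝ} {ν : Measure (ℝ × ℝ × ℝ)}
    (hν : IsUnitGaussianNoise ν) :
    mutualInfo (c.law ν) c.messages (c.outputZ₂ b) =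
      mutualInfo (c.inputLaw.prod (iidGaussian n)) (fun p => p.1.1) (c.channelOutput b) := by
  have := hν.isProbabilityMeasure
  exact mutualInfo_comp (c.measurePreserving_law (φ := fun t => t.2.2) (by fun_prop) hν.law_thd)
    (U := fun p => p.1.1) (by fun_prop) (c.measurable_channelOutput b)

theorem mutualInfo_message₁_outputZ₁ {b : ℝ} {ν : Measure (ℝ × ℝ × ℝ)}
    (hν : IsUnitGaussianNoise ν) :
    mutualInfo (c.law ν) c.message₁ (c.outputZ₁ b) =
      mutualInfo (c.inputLaw.prod (iidGaussian n)) (fun p => p.1.1.1) (c.channelOutput b) := by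
  have := hν.isProbabilityMeasure
  exact mutualInfo_comp (c.measurePreserving_law (φ := fun t => t.2.1) (by fun_prop) hν.law_snd)
    (U := fun p => p.1.1.1) (by fun_prop) (c.measurable_channelOutput b)

end Code

/-! ### The converse for a single code. -/

/-- `[½ log(1 + aP) - ½ log(1 + bP)]⁺` in nats. -/
noncomputable def CsNat (P a b : ℝ) : ℝ :=
  max 0 (1 / 2 * Real.log (1 + a * P) - 1 / 2 * Real.log (1 + b * P))

theorem CsNat_eq (P a b : ℝ) : CsNat P a b = Cs P a b * Real.log 2 := by
  have h2 : 0 < Real.log 2 := Real.log_pos one_lt_two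
  rw [CsNat, Cs, max_mul_of_nonneg _ _ h2.le, zero_mul, sub_mul, mul_assoc, mul_assoc]
  simp only [Real.logb]
  rw [div_mul_cancel₀ _ h2.ne', div_mul_cancel₀ _ h2.ne']

/-- A combination of two independent standard noises with `ρ² + s² = 1` is again standard. This
builds the noise of one receiver from that of the other plus fresh noise. -/
theorem measurePreserving_add_noise {W : Type*} [MeasurableSpace W] (β : Measure W) [SFinite β]
    {n : ℕ} {ρ s : ℝ} (h : ρ ^ 2 + s ^ 2 = 1) :
    MeasurePreserving (fun p : (W × (Fin n → ℝ)) × (Fin n → ℝ) =>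
      (p.1.1, fun i => ρ * p.1.2 i + s * p.2 i)) ((β.prod (iidGaussian n)).prod (iidGaussian n))
      (β.prod (iidGaussian n)) := by
  have h2 : MeasurePreserving (fun p : (Fin n → ℝ) × (Fin n → ℝ) => fun i => ρ * p.1 i + s * p.2 i)
      ((iidGaussian n).prod (iidGaussian n)) (iidGaussian n) := by
    refine ⟨by fun_prop, ?_⟩
    rw [iidGaussian_prod_map_linear ρ s 1 (by rw [h]; ring), gaussianBlock_zero_one]
  exact ((MeasurePreserving.id β).prod h2).comp (measurePreserving_prodAssoc _ _ _)

namespace Code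

variable {n : ℕ} {P : ℝ} (c : Code n P)

/-- Transfers decoding to the coupled model, where the first noise block is the eavesdropper's. Only
an inequality, since `g` may be right although the pair is wrong. -/
theorem one_sub_error_le {a ρ s : ℝ} (h : ρ ^ 2 + s ^ 2 = 1) {𝓜 : Type*}
    (g : Fin c.card₁ × Fin c.card₂ → 𝓜) :
    1 - (c.inputLaw.prod (iidGaussian n)).real {p | c.dec (c.channelOutput a p) ≠ p.1.1} ≤
      ((c.inputLaw.prod (iidGaussian n)).prod (iidGaussian n)).real
        {p | g (c.dec fun i => √a * p.1.1.2 i + ρ * p.1.2 i + s * p.2 i) = g p.1.1.1} := by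
  have hpres := measurePreserving_add_noise c.inputLaw (n := n) h
  have hm : MeasurableSet {p | c.dec (c.channelOutput a p) = p.1.1} :=
    measurableSet_eq_fun (c.measurable_dec.comp (c.measurable_channelOutput a)) (by fun_prop)
  have h1 := hpres.measureReal_preimage hm.nullMeasurableSet
  have h2 := probReal_compl_eq_one_sub (μ := c.inputLaw.prod (iidGaussian n)) hm
  have h3 : {p | c.dec (c.channelOutput a p) = p.1.1}ᶜ =
      {p | c.dec (c.channelOutput a p) ≠ p.1.1} := rfl
  rw [h3] at h2
  rw [h2, sub_sub_cancel, ← h1]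
  refine measureReal_mono fun p hp => ?_
  have hp' : c.dec (fun i => √a * p.1.1.2 i + (ρ * p.1.2 i + s * p.2 i)) = p.1.1.1 := hp
  simp only [← add_assoc] at hp'
  exact congrArg g hp'

theorem memLp_input (hn : 0 < n) (i : Fin n) :
    MemLp (fun w : (Fin c.card₁ × Fin c.card₂) × (Fin n → ℝ) => w.2 i) 2 c.inputLaw := by
  refine MemLp.of_bound (by fun_prop) (√(n * P)) ?_
  filter_upwards [c.ae_power_le] with w hw
  rw [one_div, inv_mul_le_iff₀ (by exact_mod_cast hn)] at hw
  refine Real.abs_le_sqrt ((Finset.single_le_sum (f := fun i => w.2 i ^ 2)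
    (fun j _ => sq_nonneg _) (Finset.mem_univ i)).trans hw)

theorem sum_integral_input_sq_le (hn : 0 < n) :
    ∑ i, ∫ w, w.2 i ^ 2 ∂c.inputLaw ≤ n * P := by
  rw [← integral_finsetSum _ fun i _ => (c.memLp_input hn i).integrable_sq]
  have : ∫ w, ∑ i, w.2 i ^ 2 ∂c.inputLaw ≤ ∫ _, n * P ∂c.inputLaw := by
    refine integral_mono_ae (integrable_finsetSum _ fun i _ => (c.memLp_input hn i).integrable_sq)
      (integrable_const _) ?_
    filter_upwards [c.ae_power_le] with w hw
    rwa [one_div, inv_mul_le_iff₀ (by exact_mod_cast hn)] at hw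
  simpa using this

theorem integrable_linear_sq (hn : 0 < n) (i : Fin n) (α β s : ℝ) :
    Integrable (fun p : (((Fin c.card₁ × Fin c.card₂) × (Fin n → ℝ)) × (Fin n → ℝ)) ×
      (Fin n → ℝ) => (α * p.1.1.2 i + β * p.1.2 i + s * p.2 i) ^ 2)
      ((c.inputLaw.prod (iidGaussian n)).prod (iidGaussian n)) := by
  have h1 := (((c.memLp_input hn i).comp_fst (iidGaussian n)).comp_fst
    (iidGaussian n)).const_mul α
  have h2 := (((memLp_eval_iidGaussian i 2).comp_snd c.inputLaw).comp_fst
    (iidGaussian n)).const_mul β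
  have h3 := ((memLp_eval_iidGaussian i 2).comp_snd
    (c.inputLaw.prod (iidGaussian n))).const_mul s
  exact ((h1.add h2).add h3).integrable_sq

theorem integral_linear_sq (hn : 0 < n) (i : Fin n) (α β s : ℝ) :
    ∫ p, (α * p.1.1.2 i + β * p.1.2 i + s * p.2 i) ^ 2
      ∂((c.inputLaw.prod (iidGaussian n)).prod (iidGaussian n)) =
      α ^ 2 * ∫ w, w.2 i ^ 2 ∂c.inputLaw + β ^ 2 + s ^ 2 := by
  have hx := (c.memLp_input hn i).integrable_sq
  rw [integral_prod _ (c.integrable_linear_sq hn i α β s)]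
  simp_rw [integral_add_mul_eval_sq]
  have hint : Integrable (fun p : ((Fin c.card₁ × Fin c.card₂) × (Fin n → ℝ)) × (Fin n → ℝ) =>
      (α * p.1.2 i + β * p.2 i) ^ 2) (c.inputLaw.prod (iidGaussian n)) :=
    ((((c.memLp_input hn i).comp_fst (iidGaussian n)).const_mul α).add
      (((memLp_eval_iidGaussian i 2).comp_snd c.inputLaw).const_mul β)).integrable_sq
  rw [integral_add hint (integrable_const _), integral_prod _ hint]
  simp_rw [integral_add_mul_eval_sq, mul_pow]
  rw [integral_add (hx.const_mul _) (integrable_const _), integral_const_mul]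
  simp

end Code

theorem measurable_gaussianLogRatio {n : ℕ} {α : Type*} [MeasurableSpace α] {c c' y : α → Fin n → ℝ}
    (hc : Measurable c) (hc' : Measurable c') (hy : Measurable y) (s s' : ℝ) :
    Measurable fun t => gaussianLogRatio (c t) s (c' t) s' (y t) := by
  unfold gaussianLogRatio
  fun_prop

namespace Code

variable {n : ℕ} {P : ℝ} (c : Code n P)

/-- When the eavesdropper is at least as strong, the legitimate output is `√(a / b)` times the
eavesdropper's plus independent noise. The output law is then already a function of `z`, and the
log-density is zero. -/
theorem log_card_mul_le_of_le {a b : ℝ} (ha : 0 ≤ a) (hab : a ≤ b)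
    {𝓜 : Type*} [Fintype 𝓜] [Nonempty 𝓜] [MeasurableSpace 𝓜] [MeasurableSingletonClass 𝓜]
    (g : Fin c.card₁ × Fin c.card₂ → 𝓜)
    (hg : ((uniformOn (Set.univ : Set (Fin c.card₁))).prod
      (uniformOn (Set.univ : Set (Fin c.card₂)))).map g = uniformOn Set.univ)
    (hI : mutualInfo (c.inputLaw.prod (iidGaussian n)) (fun p => g p.1.1) (c.channelOutput b) ≠ ⊤) :
    Real.log (Fintype.card 𝓜) * (1 - (c.inputLaw.prod (iidGaussian n)).real
        {p | c.dec (c.channelOutput a p) ≠ p.1.1}) ≤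
      (mutualInfo (c.inputLaw.prod (iidGaussian n)) (fun p => g p.1.1)
        (c.channelOutput b)).toReal + 1 := by
  set ρ := √(a / b)
  set s := √(1 - a / b)
  have hab1 : a / b ≤ 1 := div_le_one_of_le₀ hab (ha.trans hab)
  have hρs : ρ ^ 2 + s ^ 2 = 1 := by
    rw [Real.sq_sqrt (by have := ha.trans hab; positivity), Real.sq_sqrt (by linarith)]
    ring
  have hρb : ρ * √b = √a := by
    rw [← Real.sqrt_mul (by have := ha.trans hab; positivity)]
    -- If `b = 0` then `a = 0` too; the convention `a / b = 0` gives `ρ = 0`, which is consistent.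
    rcases (ha.trans hab).eq_or_lt with h | h
    · rw [← h, mul_zero, le_antisymm (hab.trans h.ge) ha]
    · rw [div_mul_cancel₀ _ h.ne']
  have hgm : Measurable g := Measurable.of_discrete
  have hunif : (c.inputLaw.prod (iidGaussian n)).map (fun p => g p.1.1) = uniformOn Set.univ := by
    rw [← hg, ← c.inputLaw_map_fst, Measure.map_map hgm measurable_fst]
    exact ((hgm.comp measurable_fst).measurePreserving _ |>.comp measurePreserving_fst).map_eq
  have h := log_card_mul_le_mutualInfo_add (c.inputLaw.prod (iidGaussian n))
    (m := fun p => g p.1.1) (z := c.channelOutput b) (by fun_prop) (c.measurable_channelOutput b)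
    hunif (iidGaussian n)
    (k := fun t N i => √a * t.1.2 i + ρ * t.2 i + s * N i)
    (by unfold Function.uncurry; fun_prop)
    (q := fun z N i => ρ * z i + s * N i) (by unfold Function.uncurry; fun_prop)
    (l := fun _ _ => 0) measurable_const
    (by
      intro t
      simp only [Real.exp_zero, ENNReal.ofReal_one]
      rw [← Pi.one_def, withDensity_one]
      congr 1
      ext N i
      rw [channelOutput, ← hρb]
      ring)
    (integrable_const _) (dec := fun y => g (c.dec y)) (hgm.comp c.measurable_dec) hI
  have h2 := c.one_sub_error_le (a := a) hρs g
  have h3 : 0 ≤ Real.log (Fintype.card 𝓜) := Real.log_natCast_nonneg _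
  rw [integral_zero, add_zero] at h
  exact (mul_le_mul_of_nonneg_left h2 h3).trans h

/-- With `Z` a degraded version of `Y`, the cost of replacing the true law of `Y` given input and
`Z` by a Gaussian law depending on `Z` alone bounds `I(X; Y | Z)`. The Gaussian law is the
conditional law of `Y` given `Z` for Gaussian input of variance `P`. -/
theorem log_card_mul_le_of_lt (hn : 0 < n) (hP : 0 ≤ P) {a b : ℝ} (hb : 0 ≤ b) (hab : b < a)
    {𝓜 : Type*} [Fintype 𝓜] [Nonempty 𝓜] [MeasurableSpace 𝓜] [MeasurableSingletonClass 𝓜]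
    (g : Fin c.card₁ × Fin c.card₂ → 𝓜)
    (hg : ((uniformOn (Set.univ : Set (Fin c.card₁))).prod
      (uniformOn (Set.univ : Set (Fin c.card₂)))).map g = uniformOn Set.univ)
    (hI : mutualInfo (c.inputLaw.prod (iidGaussian n)) (fun p => g p.1.1) (c.channelOutput b) ≠ ⊤) :
    Real.log (Fintype.card 𝓜) * (1 - (c.inputLaw.prod (iidGaussian n)).real
        {p | c.dec (c.channelOutput a p) ≠ p.1.1}) ≤
      (mutualInfo (c.inputLaw.prod (iidGaussian n)) (fun p => g p.1.1)
        (c.channelOutput b)).toReal +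
        n * (1 / 2 * Real.log (1 + a * P) - 1 / 2 * Real.log (1 + b * P)) + 1 := by
  have ha : 0 < a := hb.trans_lt hab
  set ρ := √(b / a)
  set s := √(1 - b / a)
  -- For input of variance `P`, `γ = E[YZ] / E[Z²]` is the linear regression coefficient of `Y` on
  -- `Z`, and `(v * s)²` is the residual variance.
  set γ := ρ * (1 + a * P) / (1 + b * P)
  set v := √((1 + a * P) / (1 + b * P))
  have haP : 0 < 1 + a * P := by positivity
  have hbP : 0 < 1 + b * P := by positivity
  have hab1 : b / a < 1 := (div_lt_one ha).2 hab
  have hρ2 : ρ ^ 2 = b / a := Real.sq_sqrt (by positivity)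
  have hs2 : s ^ 2 = 1 - b / a := Real.sq_sqrt (by linarith)
  have hv2 : v ^ 2 = (1 + a * P) / (1 + b * P) := Real.sq_sqrt (by positivity)
  have hs : 0 < s := Real.sqrt_pos.2 (by linarith)
  have hv : 0 < v := Real.sqrt_pos.2 (by positivity)
  have hρs : ρ ^ 2 + s ^ 2 = 1 := by rw [hρ2, hs2]; ring
  have hbρ : √b = ρ * √a := by
    rw [← Real.sqrt_mul (by positivity), div_mul_cancel₀ _ ha.ne']
  have ha2 : √a ^ 2 = a := Real.sq_sqrt ha.le
  have hgm : Measurable g := Measurable.of_discrete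
  have hunif : (c.inputLaw.prod (iidGaussian n)).map (fun p => g p.1.1) = uniformOn Set.univ := by
    rw [← hg, ← c.inputLaw_map_fst, Measure.map_map hgm measurable_fst]
    exact ((hgm.comp measurable_fst).measurePreserving _ |>.comp measurePreserving_fst).map_eq
  set α := √a - γ * √b
  set δ := ρ - γ
  set l : (((Fin c.card₁ × Fin c.card₂) × (Fin n → ℝ)) × (Fin n → ℝ)) → (Fin n → ℝ) → ℝ :=
    fun t y => gaussianLogRatio (fun i => √a * t.1.2 i + ρ * t.2 i) s
      (fun i => γ * c.channelOutput b t i) (v * s) y with hl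
  have hlval : ∀ p : (((Fin c.card₁ × Fin c.card₂) × (Fin n → ℝ)) × (Fin n → ℝ)) × (Fin n → ℝ),
      l p.1 (fun i => √a * p.1.1.2 i + ρ * p.1.2 i + s * p.2 i) =
      ∑ i, (Real.log v + ((α * p.1.1.2 i + δ * p.1.2 i + s * p.2 i) ^ 2 / (2 * (v * s) ^ 2) -
        (0 * p.1.1.2 i + 0 * p.1.2 i + 1 * p.2 i) ^ 2 / 2)) := by
    intro p
    simp only [hl, gaussianLogRatio]
    refine Finset.sum_congr rfl fun i _ => ?_
    rw [mul_div_cancel_right₀ _ hs.ne', add_sub_assoc]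
    congr 1
    congr 1
    · congr 2
      simp only [channelOutput, α, δ]
      ring
    · field_simp
      ring
  have hint1 := fun i => c.integrable_linear_sq hn i α δ s
  have hint2 := fun i => c.integrable_linear_sq hn i 0 0 1
  have hint4 : ∀ i, Integrable (fun p : (((Fin c.card₁ × Fin c.card₂) × (Fin n → ℝ)) × (Fin n → ℝ)) × (Fin n → ℝ) =>
      (α * p.1.1.2 i + δ * p.1.2 i + s * p.2 i) ^ 2 / (2 * (v * s) ^ 2) -
        (0 * p.1.1.2 i + 0 * p.1.2 i + 1 * p.2 i) ^ 2 / 2)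
      ((c.inputLaw.prod (iidGaussian n)).prod (iidGaussian n)) := fun i =>
    ((hint1 i).div_const (2 * (v * s) ^ 2)).sub ((hint2 i).div_const 2)
  have hint3 : ∀ i, Integrable (fun p : (((Fin c.card₁ × Fin c.card₂) × (Fin n → ℝ)) × (Fin n → ℝ)) × (Fin n → ℝ) =>
      Real.log v + ((α * p.1.1.2 i + δ * p.1.2 i + s * p.2 i) ^ 2 / (2 * (v * s) ^ 2) -
        (0 * p.1.1.2 i + 0 * p.1.2 i + 1 * p.2 i) ^ 2 / 2))
      ((c.inputLaw.prod (iidGaussian n)).prod (iidGaussian n)) := fun i =>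
    (integrable_const _).add (hint4 i)
  have hlm : Measurable (Function.uncurry l) := by
    have := c.measurable_channelOutput b
    unfold Function.uncurry
    exact measurable_gaussianLogRatio (by fun_prop) (by fun_prop) (by fun_prop) s (v * s)
  have hlint : Integrable (fun p : (((Fin c.card₁ × Fin c.card₂) × (Fin n → ℝ)) × (Fin n → ℝ)) ×
      (Fin n → ℝ) => l p.1 (fun i => √a * p.1.1.2 i + ρ * p.1.2 i + s * p.2 i))
      ((c.inputLaw.prod (iidGaussian n)).prod (iidGaussian n)) := by
    simp_rw [hlval]
    exact integrable_finsetSum _ fun i _ => hint3 i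
  have hbound : ∫ p, l p.1 (fun i => √a * p.1.1.2 i + ρ * p.1.2 i + s * p.2 i)
      ∂((c.inputLaw.prod (iidGaussian n)).prod (iidGaussian n)) ≤
      n * (1 / 2 * Real.log (1 + a * P) - 1 / 2 * Real.log (1 + b * P)) := by
    simp_rw [hlval]
    rw [integral_finsetSum _ fun i _ => hint3 i]
    have hterm : ∀ i : Fin n, ∫ p, (Real.log v + ((α * p.1.1.2 i + δ * p.1.2 i + s * p.2 i) ^ 2 /
        (2 * (v * s) ^ 2) - (0 * p.1.1.2 i + 0 * p.1.2 i + 1 * p.2 i) ^ 2 / 2))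
        ∂((c.inputLaw.prod (iidGaussian n)).prod (iidGaussian n)) =
        Real.log v + ((α ^ 2 * ∫ w, w.2 i ^ 2 ∂c.inputLaw + δ ^ 2 + s ^ 2) / (2 * (v * s) ^ 2) -
          1 / 2) := by
      intro i
      rw [integral_add (integrable_const _) (hint4 i),
        integral_sub ((hint1 i).div_const (2 * (v * s) ^ 2)) ((hint2 i).div_const 2),
        integral_div, integral_div, c.integral_linear_sq hn, c.integral_linear_sq hn]
      simp
    simp_rw [hterm]
    have hlogv : Real.log v = 1 / 2 * Real.log (1 + a * P) - 1 / 2 * Real.log (1 + b * P) := by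
      rw [Real.log_sqrt (by positivity), Real.log_div haP.ne' hbP.ne']
      ring
    -- The residual `Y - γZ` is `α X + δ N + s N'`; at input power exactly `P` its variance is the
    -- reference variance.
    have hkey : α ^ 2 * P + δ ^ 2 + s ^ 2 = (v * s) ^ 2 := by
      have hα : α = √a * (1 - ρ * γ) := by simp only [α, hbρ]; ring
      have hργ : ρ * γ = (b / a) * (1 + a * P) / (1 + b * P) := by
        rw [← hρ2]; simp only [γ]; ring
      have hδ : δ ^ 2 = (b / a) * (1 - (1 + a * P) / (1 + b * P)) ^ 2 := by
        rw [← hρ2]; simp only [δ, γ]; ring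
      rw [mul_pow, hv2, hs2, hδ, hα, mul_pow, ha2, hργ]
      field_simp
      ring
    have hsum := c.sum_integral_input_sq_le hn
    rw [Finset.sum_add_distrib, Finset.sum_sub_distrib, ← Finset.sum_div, Finset.sum_add_distrib,
      Finset.sum_add_distrib, ← Finset.mul_sum]
    simp only [Finset.sum_const, Finset.card_univ, Fintype.card_fin, nsmul_eq_mul]
    rw [hlogv]
    -- The quadratic terms cancel at full power and are nonpositive otherwise, so only `n * log v`
    -- survives. This is where the power constraint enters.
    have hfrac : (α ^ 2 * ∑ i, ∫ w, w.2 i ^ 2 ∂c.inputLaw + n * δ ^ 2 + n * s ^ 2) /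
        (2 * (v * s) ^ 2) ≤ n * (1 / 2) := by
      rw [div_le_iff₀ (by positivity), ← hkey]
      nlinarith [mul_le_mul_of_nonneg_left hsum (sq_nonneg α)]
    linarith
  have h := log_card_mul_le_mutualInfo_add (c.inputLaw.prod (iidGaussian n))
    (m := fun p => g p.1.1) (z := c.channelOutput b) (by fun_prop) (c.measurable_channelOutput b)
    hunif (iidGaussian n)
    (k := fun t N i => √a * t.1.2 i + ρ * t.2 i + s * N i)
    (by unfold Function.uncurry; fun_prop)
    (q := fun z N i => γ * z i + v * s * N i) (by unfold Function.uncurry; fun_prop)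
    hlm (fun t => gaussianBlock_eq_withDensity _ _ hs (mul_pos hv hs)) hlint
    (dec := fun y => g (c.dec y)) (hgm.comp c.measurable_dec) hI
  have h2 := c.one_sub_error_le (a := a) hρs g
  have h3 : 0 ≤ Real.log (Fintype.card 𝓜) := Real.log_natCast_nonneg _
  have h4 := mul_le_mul_of_nonneg_left h2 h3
  have h5 := h4.trans h
  linarith

/-- The map `g` lets one bound serve both secrecy constraints: it will be the first projection for
`M₁` and the identity for `(M₁, M₂)`. -/
theorem log_card_mul_le (hn : 0 < n) (hP : 0 ≤ P) {a b : ℝ} (ha : 0 ≤ a) (hb : 0 ≤ b)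
    {𝓜 : Type*} [Fintype 𝓜] [Nonempty 𝓜] [MeasurableSpace 𝓜] [MeasurableSingletonClass 𝓜]
    (g : Fin c.card₁ × Fin c.card₂ → 𝓜)
    (hg : ((uniformOn (Set.univ : Set (Fin c.card₁))).prod
      (uniformOn (Set.univ : Set (Fin c.card₂)))).map g = uniformOn Set.univ)
    (hI : mutualInfo (c.inputLaw.prod (iidGaussian n)) (fun p => g p.1.1) (c.channelOutput b) ≠ ⊤) :
    Real.log (Fintype.card 𝓜) * (1 - (c.inputLaw.prod (iidGaussian n)).real
        {p | c.dec (c.channelOutput a p) ≠ p.1.1}) ≤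
      (mutualInfo (c.inputLaw.prod (iidGaussian n)) (fun p => g p.1.1)
        (c.channelOutput b)).toReal + n * CsNat P a b + 1 := by
  have hn' : (0 : ℝ) ≤ n := n.cast_nonneg
  rcases le_or_gt a b with hab | hab
  · have h := c.log_card_mul_le_of_le ha hab g hg hI
    have : 0 ≤ n * CsNat P a b := mul_nonneg hn' (le_max_left _ _)
    linarith
  · have h := c.log_card_mul_le_of_lt hn hP hb hab g hg hI
    have := mul_le_mul_of_nonneg_left (le_max_right 0
      (1 / 2 * Real.log (1 + a * P) - 1 / 2 * Real.log (1 + b * P))) hn'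
    rw [CsNat]
    linarith

end Code

/-! ### The converse in the limit. -/

theorem uniformOn_univ_prod {α β : Type*} [Fintype α] [Fintype β] [MeasurableSpace α]
    [MeasurableSpace β] [MeasurableSingletonClass α] [MeasurableSingletonClass β] :
    (uniformOn (Set.univ : Set α)).prod (uniformOn (Set.univ : Set β)) =
      uniformOn (Set.univ : Set (α × β)) := by
  refine Measure.ext_of_lintegral _ fun f hf => ?_
  rw [lintegral_prod _ hf.aemeasurable]
  simp_rw [lintegral_uniformOn_univ]
  rw [← Finset.mul_sum, ← mul_assoc, Fintype.sum_prod_type, Fintype.card_prod, Nat.cast_mul,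
    ENNReal.mul_inv (by simp) (by simp)]

theorem le_of_converse_bounds {C R : ℝ} {K : ℕ → ℝ} {e : ℕ → ENNReal} {I : ℕ → ENNReal}
    (hK : Tendsto (fun n : ℕ => K n / n) atTop (𝓝 R)) (he : Tendsto e atTop (𝓝 0))
    (hI : Tendsto (fun n : ℕ => I n / n) atTop (𝓝 0))
    (h : ∀ n : ℕ, 0 < n → I n ≠ ⊤ → K n * (1 - (e n).toReal) ≤ (I n).toReal + n * C + 1) :
    R ≤ C := by
  have he' : Tendsto (fun n => (e n).toReal) atTop (𝓝 0) := by
    simpa [Function.comp_def] using (ENNReal.tendsto_toReal ENNReal.zero_ne_top).comp he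
  have hI' : Tendsto (fun n : ℕ => (I n).toReal / n) atTop (𝓝 0) := by
    have := (ENNReal.tendsto_toReal ENNReal.zero_ne_top).comp hI
    refine (this.congr fun n => ?_).trans (by simp)
    simp [ENNReal.toReal_div]
  have h1 : Tendsto (fun n : ℕ => K n / n * (1 - (e n).toReal)) atTop (𝓝 (R * (1 - 0))) :=
    hK.mul (tendsto_const_nhds.sub he')
  have h2 : Tendsto (fun n : ℕ => (I n).toReal / n + C + 1 / (n : ℝ)) atTop (𝓝 (0 + C + 0)) :=
    (hI'.add_const C).add tendsto_one_div_atTop_nhds_zero_nat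
  rw [sub_zero, mul_one] at h1
  rw [zero_add, add_zero] at h2
  refine le_of_tendsto_of_tendsto h1 h2 ?_
  -- The single-code bound needs finite mutual information, which holds as soon as the normalized
  -- leakage is below 1.
  filter_upwards [hI.eventually (gt_mem_nhds zero_lt_one), eventually_gt_atTop 0] with n hn hn0
  have hne : I n ≠ ⊤ := by
    intro htop
    rw [htop, ENNReal.top_div_of_ne_top (ENNReal.natCast_ne_top n)] at hn
    exact absurd hn (by simp)
  have hn' : (0 : ℝ) < n := by exact_mod_cast hn0
  have := h n hn0 hne
  rw [div_mul_eq_mul_div, div_le_iff₀ hn']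
  field_simp
  linarith

theorem tendsto_log_div_of_tendsto_logb {K : ℕ → ℝ} {R : ℝ}
    (h : Tendsto (fun n : ℕ => Real.logb 2 (K n) / n) atTop (𝓝 R)) :
    Tendsto (fun n : ℕ => Real.log (K n) / n) atTop (𝓝 (R * Real.log 2)) := by
  refine (h.mul_const (Real.log 2)).congr fun n => ?_
  have h2 : Real.log 2 ≠ 0 := (Real.log_pos one_lt_two).ne'
  rw [Real.logb]
  field_simp

theorem Achievable.mem_region {P a b₁ b₂ : ℝ} (hP : 0 ≤ P) (ha : 0 ≤ a) (hb₁ : 0 ≤ b₁)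
    (hb₂ : 0 ≤ b₂) {ν : Measure (ℝ × ℝ × ℝ)} (hν : IsUnitGaussianNoise ν) {R : ℝ × ℝ}
    (hR : Achievable P a b₁ b₂ ν R) :
    0 ≤ R.1 ∧ 0 ≤ R.2 ∧ R.1 ≤ Cs P a b₁ ∧ R.1 + R.2 ≤ Cs P a b₂ := by
  obtain ⟨c, h1, h2, he, hI2, hI1⟩ := hR
  have hl2 : 0 < Real.log 2 := Real.log_pos one_lt_two
  have hpos : ∀ K : ℕ, 0 < K → 0 ≤ Real.logb 2 K := fun K hK =>
    Real.logb_nonneg one_lt_two (by exact_mod_cast hK)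
  refine ⟨ge_of_tendsto' h1 fun n => div_nonneg (hpos _ (c n).card₁_pos) n.cast_nonneg,
    ge_of_tendsto' h2 fun n => div_nonneg (hpos _ (c n).card₂_pos) n.cast_nonneg, ?_, ?_⟩
  · have h := le_of_converse_bounds (tendsto_log_div_of_tendsto_logb h1) he hI1
      (C := CsNat P a b₁) fun n hn hI => by
        rw [(c n).mutualInfo_message₁_outputZ₁ hν] at hI ⊢
        have := (c n).log_card_mul_le hn hP ha hb₁ (fun m => m.1) (by rw [Measure.map_fst_prod]; simp) hI
        rw [Fintype.card_fin] at this
        rwa [(c n).errorProb_eq hν]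
    rw [CsNat_eq] at h
    exact le_of_mul_le_mul_right h hl2
  · have h12 : Tendsto (fun n : ℕ => Real.log (((c n).card₁ * (c n).card₂ : ℕ) : ℝ) / n) atTop
        (𝓝 ((R.1 + R.2) * Real.log 2)) := by
      rw [add_mul]
      refine ((tendsto_log_div_of_tendsto_logb h1).add (tendsto_log_div_of_tendsto_logb h2)).congr
        fun n => ?_
      rw [Nat.cast_mul, Real.log_mul (by exact_mod_cast (c n).card₁_pos.ne')
        (by exact_mod_cast (c n).card₂_pos.ne'), add_div]
    have h := le_of_converse_bounds h12 he hI2 (C := CsNat P a b₂) fun n hn hI => by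
        rw [(c n).mutualInfo_messages_outputZ₂ hν] at hI ⊢
        have := (c n).log_card_mul_le hn hP ha hb₂ (fun m => m) (by rw [Measure.map_id']; exact uniformOn_univ_prod) hI
        rw [Fintype.card_prod, Fintype.card_fin, Fintype.card_fin] at this
        rwa [(c n).errorProb_eq hν]
    rw [CsNat_eq] at h
    exact le_of_mul_le_mul_right h hl2

/-! ### Divergence bounds and information densities. -/

/-- By the chain rule, replacing the second marginal by `Q` adds the divergence of that marginal
from `Q`. The swaps serve to disintegrate along the second coordinate. The lemma permits a fixed
reference output law in place of the unknown output law of a codebook. -/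
theorem klDiv_prod_marginals_le {α β : Type*} [MeasurableSpace α] [MeasurableSpace β]
    [StandardBorelSpace α] [Nonempty α] (J : Measure (α × β)) [IsProbabilityMeasure J]
    (Q : Measure β) [IsProbabilityMeasure Q] :
    InformationTheory.klDiv J ((J.map Prod.fst).prod (J.map Prod.snd)) ≤
      InformationTheory.klDiv J ((J.map Prod.fst).prod Q) := by
  set J' := J.map Prod.swap with hJ'
  have : IsProbabilityMeasure (J.map Prod.fst) :=
    Measure.isProbabilityMeasure_map measurable_fst.aemeasurable
  have : IsProbabilityMeasure (J.map Prod.snd) :=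
    Measure.isProbabilityMeasure_map measurable_snd.aemeasurable
  have : IsProbabilityMeasure J' := Measure.isProbabilityMeasure_map measurable_swap.aemeasurable
  have hfst : J'.fst = J.map Prod.snd := by
    rw [hJ', Measure.fst, Measure.map_map measurable_fst measurable_swap]; rfl
  have hJJ : J'.map Prod.swap = J := by
    rw [hJ', Measure.map_map measurable_swap measurable_swap]; simp
  have hdis : J'.fst ⊗ₘ J'.condKernel = J' := J'.disintegrate J'.condKernel
  calc InformationTheory.klDiv J ((J.map Prod.fst).prod (J.map Prod.snd))
      ≤ InformationTheory.klDiv J' ((J.map Prod.snd).prod (J.map Prod.fst)) := by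
        have h := InformationTheory.klDiv_map_le (μ := J')
          (ν := (J.map Prod.snd).prod (J.map Prod.fst)) measurable_swap
        rwa [hJJ, Measure.prod_swap] at h
    _ = InformationTheory.klDiv (J'.fst ⊗ₘ J'.condKernel)
          (J'.fst ⊗ₘ Kernel.const _ (J.map Prod.fst)) := by
        rw [hdis, Measure.compProd_const, hfst]
    _ ≤ InformationTheory.klDiv (J'.fst ⊗ₘ J'.condKernel)
          (Q ⊗ₘ Kernel.const _ (J.map Prod.fst)) := by
        rw [InformationTheory.klDiv_compProd_eq_add J'.fst Q]
        exact le_add_self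
    _ = InformationTheory.klDiv J' (Q.prod (J.map Prod.fst)) := by
        rw [hdis, Measure.compProd_const]
    _ ≤ InformationTheory.klDiv J ((J.map Prod.fst).prod Q) := by
        have h := InformationTheory.klDiv_map_le (μ := J)
          (ν := (J.map Prod.fst).prod Q) measurable_swap
        rwa [Measure.prod_swap] at h

/-- The integrand `f log f + 1 - f` is at most `1 + f log (1 + f)`. The logarithm of `1 + f` is
nonnegative, so everything can be handled by lower integrals; the extra 1 disappears after division
by `n`. -/
theorem klDiv_withDensity_le {α : Type*} [MeasurableSpace α] {μ ν : Measure α}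
    [IsProbabilityMeasure μ] [IsProbabilityMeasure ν] {f : α → ℝ} (hf : Measurable f)
    (hf0 : ∀ x, 0 ≤ f x) (h : μ = ν.withDensity fun x => ENNReal.ofReal (f x)) :
    InformationTheory.klDiv μ ν ≤ 1 + ∫⁻ x, ENNReal.ofReal (Real.log (1 + f x)) ∂μ := by
  have hac : μ ≪ ν := h ▸ withDensity_absolutelyContinuous _ _
  have hrn : μ.rnDeriv ν =ᵐ[ν] fun x => ENNReal.ofReal (f x) := by
    conv_lhs => rw [h]
    exact Measure.rnDeriv_withDensity ν hf.ennreal_ofReal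
  have hlog : Measurable fun x => ENNReal.ofReal (Real.log (1 + f x)) := by fun_prop
  have h1 : ∫⁻ x, ENNReal.ofReal (Real.log (1 + f x)) ∂μ =
      ∫⁻ x, ENNReal.ofReal (f x * Real.log (1 + f x)) ∂ν := by
    rw [h, lintegral_withDensity_eq_lintegral_mul _ hf.ennreal_ofReal hlog]
    refine lintegral_congr fun x => ?_
    rw [Pi.mul_apply, ENNReal.ofReal_mul (hf0 x)]
  rw [InformationTheory.klDiv_eq_lintegral_klFun_of_ac hac, h1]
  calc ∫⁻ x, ENNReal.ofReal (InformationTheory.klFun (μ.rnDeriv ν x).toReal) ∂ν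
      ≤ ∫⁻ x, (1 + ENNReal.ofReal (f x * Real.log (1 + f x))) ∂ν := by
        refine lintegral_mono_ae ?_
        filter_upwards [hrn] with x hx
        have hx0 := hf0 x
        have hlog0 : 0 ≤ Real.log (1 + f x) := Real.log_nonneg (by linarith)
        rw [hx, ENNReal.toReal_ofReal hx0, ← ENNReal.ofReal_one,
          ← ENNReal.ofReal_add zero_le_one (mul_nonneg hx0 hlog0)]
        refine ENNReal.ofReal_le_ofReal ?_
        rw [InformationTheory.klFun_apply]
        have : f x * Real.log (f x) ≤ f x * Real.log (1 + f x) := by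
          rcases hx0.eq_or_lt with h0 | h0
          · simp [← h0]
          · exact mul_le_mul_of_nonneg_left (Real.log_le_log h0 (by linarith)) hx0
        linarith
    _ = _ := by
        rw [lintegral_add_left measurable_const]
        simp

/-- `ι` is the information density of the channel `W` for an input law `μ` and a reference output
law `Q`: `Q` is the output law and `exp (ι x)` the density of `W x` with respect to it. -/
structure IsInfoDensity {X Y : Type*} [MeasurableSpace X] [MeasurableSpace Y] (μ : Measure X)
    (Q : Measure Y) (W : X → Measure Y) (ι : X → Y → ℝ) : Prop where
  measurable : Measurable (Function.uncurry ι)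
  isProbabilityMeasure : ∀ x, IsProbabilityMeasure (W x)
  eq_withDensity : ∀ x, W x = Q.withDensity fun y => ENNReal.ofReal (Real.exp (ι x y))
  lintegral_output : ∀ f : Y → ENNReal, Measurable f → ∫⁻ x, ∫⁻ y, f y ∂W x ∂μ = ∫⁻ y, f y ∂Q

/-- Upper bound, in terms of the codewords `x l` of one message, for the divergence of the law of
the output given this message from the reference output law. -/
noncomputable def leakage {X Y Λ : Type*} [MeasurableSpace Y] [Fintype Λ] (W : X → Measure Y)
    (ι : X → Y → ℝ) (x : Λ → X) : ENNReal :=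
  1 + (Fintype.card Λ : ENNReal)⁻¹ * ∑ l, ∫⁻ y, ENNReal.ofReal
    (Real.log (1 + (Fintype.card Λ : ℝ)⁻¹ * ∑ l', Real.exp (ι (x l') y))) ∂W (x l)

/-- Upper bound for the probability that threshold decoding of the information density fails when
the codeword `x k` is sent. -/
noncomputable def thresholdError {X Y I : Type*} [MeasurableSpace Y] [Fintype I] [DecidableEq I]
    (W : X → Measure Y) (ι : X → Y → ℝ) (θ : ℝ) (x : I → X) (k : I) : ENNReal :=
  W (x k) {y | ι (x k) y ≤ θ} + ∑ j ∈ Finset.univ.erase k, W (x k) {y | θ < ι (x j) y}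

section InfoDensity

variable {X Y : Type*} [MeasurableSpace X] [MeasurableSpace Y] {μ : Measure X} {Q : Measure Y}
  {W : X → Measure Y} {ι : X → Y → ℝ}

/-- `W` is not bundled as a kernel; measurability comes from writing the integral against the fixed
`Q` with the jointly measurable density. -/
theorem IsInfoDensity.measurable_lintegral [SFinite Q] (h : IsInfoDensity μ Q W ι) {α : Type*}
    [MeasurableSpace α] {u : α → X} (hu : Measurable u) {F : α → Y → ENNReal}
    (hF : Measurable (Function.uncurry F)) : Measurable fun a => ∫⁻ y, F a y ∂W (u a) := by
  have hι : Measurable fun p : α × Y => ι (u p.1) p.2 :=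
    h.measurable.comp ((hu.comp measurable_fst).prodMk measurable_snd)
  have e : (fun a => ∫⁻ y, F a y ∂W (u a)) =
      fun a => ∫⁻ y, ENNReal.ofReal (Real.exp (ι (u a) y)) * F a y ∂Q := by
    ext a
    have : Measurable fun y => ι (u a) y := hι.comp measurable_prodMk_left
    have hFa : Measurable (F a) := hF.comp measurable_prodMk_left
    rw [h.eq_withDensity, lintegral_withDensity_eq_lintegral_mul _ (by fun_prop) hFa]
    rfl
  rw [e]
  exact Measurable.lintegral_prod_right' (f := fun p : α × Y =>
    ENNReal.ofReal (Real.exp (ι (u p.1) p.2)) * F p.1 p.2) (hι.exp.ennreal_ofReal.mul hF)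

/-- Given the message `u`, the output is the uniform mixture of the `W (x u l)`, so its density
relative to `Q` is the mean of `exp (ι (x u l))` over `l`. Here `Λ` is whatever randomizes: the
dummy index alone, or together with the other message. -/
theorem IsInfoDensity.mutualInfo_le [IsProbabilityMeasure Q] (h : IsInfoDensity μ Q W ι)
    {Ω 𝓜 Λ : Type*} [MeasurableSpace Ω] [MeasurableSpace 𝓜] [Fintype 𝓜] [Nonempty 𝓜]
    [MeasurableSingletonClass 𝓜] [Fintype Λ] {τ : Measure Ω} [IsProbabilityMeasure τ] {U : Ω → 𝓜}
    {V : Ω → Y} (hU : Measurable U) (hV : Measurable V) (x : 𝓜 → Λ → X)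
    (hUV : ∀ F : 𝓜 → Y → ENNReal, (∀ u, Measurable (F u)) → ∫⁻ ω, F (U ω) (V ω) ∂τ =
      (Fintype.card 𝓜 : ENNReal)⁻¹ * ∑ u, (Fintype.card Λ : ENNReal)⁻¹ *
        ∑ l, ∫⁻ y, F u y ∂W (x u l)) (hΛ : Nonempty Λ) :
    mutualInfo τ U V ≤ (Fintype.card 𝓜 : ENNReal)⁻¹ * ∑ u, leakage W ι (x u) := by
  have hUVm : Measurable fun ω => (U ω, V ω) := hU.prodMk hV
  set J := τ.map fun ω => (U ω, V ω) with hJ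
  have : IsProbabilityMeasure J := Measure.isProbabilityMeasure_map hUVm.aemeasurable
  have hJ1 : J.map Prod.fst = τ.map U := by rw [hJ, Measure.map_map measurable_fst hUVm]; rfl
  have hJ2 : J.map Prod.snd = τ.map V := by rw [hJ, Measure.map_map measurable_snd hUVm]; rfl
  have hc : (Fintype.card 𝓜 : ENNReal)⁻¹ * Fintype.card 𝓜 = 1 :=
    ENNReal.inv_mul_cancel (by simp) (by simp)
  have hcΛ : (Fintype.card Λ : ENNReal)⁻¹ * Fintype.card Λ = 1 :=
    ENNReal.inv_mul_cancel (by simp) (by simp)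
  have hW : ∀ u l, IsProbabilityMeasure (W (x u l)) := fun u l => h.isProbabilityMeasure _
  have hunif : τ.map U = uniformOn Set.univ := by
    refine Measure.ext_of_lintegral _ fun f hf => ?_
    rw [lintegral_map hf hU, hUV (fun u _ => f u) (fun u => measurable_const),
      lintegral_uniformOn_univ]
    congr 1
    refine Finset.sum_congr rfl fun u _ => ?_
    simp only [lintegral_const, measure_univ, mul_one, Finset.sum_const, Finset.card_univ,
      nsmul_eq_mul]
    rw [← mul_assoc, hcΛ, one_mul]
  set f : 𝓜 × Y → ℝ := fun p => (Fintype.card Λ : ℝ)⁻¹ * ∑ l, Real.exp (ι (x p.1 l) p.2) with hf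
  have hιm : ∀ z : X, Measurable (ι z) := fun z => h.measurable.comp measurable_prodMk_left
  have hfm' : ∀ u, Measurable fun y => f (u, y) := fun u => by
    have := fun l => hιm (x u l)
    simp only [hf]
    fun_prop
  have hfm : Measurable f := measurable_from_prod_countable_right hfm'
  have hf0 : ∀ p, 0 ≤ f p := fun p => by simp only [hf]; positivity
  have hprob : IsProbabilityMeasure (uniformOn (Set.univ : Set 𝓜)) :=
    isProbabilityMeasure_uniformOn Set.finite_univ Set.univ_nonempty
  have hdens : J = ((uniformOn (Set.univ : Set 𝓜)).prod Q).withDensity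
      fun p => ENNReal.ofReal (f p) := by
    refine Measure.ext_of_lintegral _ fun F hF => ?_
    rw [hJ, lintegral_map hF hUVm, hUV (fun u y => F (u, y))
      (fun u => hF.comp measurable_prodMk_left), lintegral_withDensity_eq_lintegral_mul _
      hfm.ennreal_ofReal hF, lintegral_prod _ (hfm.ennreal_ofReal.mul hF).aemeasurable,
      lintegral_uniformOn_univ]
    congr 1
    refine Finset.sum_congr rfl fun u _ => ?_
    have hFu : Measurable fun y => F (u, y) := hF.comp measurable_prodMk_left
    have e : ∀ l, ∫⁻ y, F (u, y) ∂W (x u l) =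
        ∫⁻ y, ENNReal.ofReal (Real.exp (ι (x u l) y)) * F (u, y) ∂Q := by
      intro l
      rw [h.eq_withDensity, lintegral_withDensity_eq_lintegral_mul _
        (hιm _).exp.ennreal_ofReal hFu]
      rfl
    have hm : ∀ l, Measurable fun y => ENNReal.ofReal (Real.exp (ι (x u l) y)) * F (u, y) :=
      fun l => (hιm _).exp.ennreal_ofReal.mul hFu
    simp_rw [e]
    rw [← lintegral_finsetSum _ fun l _ => hm l,
      ← lintegral_const_mul _ (Finset.measurable_fun_sum _ fun l _ => hm l)]
    refine lintegral_congr fun y => ?_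
    simp only [Pi.mul_apply, hf]
    rw [ENNReal.ofReal_mul (by positivity), ENNReal.ofReal_inv_of_pos
      (by exact_mod_cast Fintype.card_pos), ENNReal.ofReal_natCast,
      ENNReal.ofReal_sum_of_nonneg fun l _ => (Real.exp_pos _).le, ← Finset.sum_mul, mul_assoc]
  have h1 : mutualInfo τ U V ≤ InformationTheory.klDiv J ((uniformOn Set.univ).prod Q) := by
    have := klDiv_prod_marginals_le J Q
    rw [hJ1, hJ2] at this
    rw [← hunif]
    exact this
  refine h1.trans ((klDiv_withDensity_le hfm hf0 hdens).trans (le_of_eq ?_))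
  have hlogm : ∀ u, Measurable fun y => ENNReal.ofReal (Real.log (1 + f (u, y))) := fun u => by
    have := hfm' u
    fun_prop
  rw [hJ, lintegral_map (by fun_prop) hUVm,
    hUV (fun u y => ENNReal.ofReal (Real.log (1 + f (u, y)))) hlogm]
  simp only [leakage]
  rw [Finset.sum_add_distrib, mul_add]
  simp only [Finset.sum_const, Finset.card_univ, nsmul_eq_mul, mul_one]
  rw [hc]

end InfoDensity

/-! ### Expected error and leakage of random codebooks. -/

section

variable {X : Type*} [MeasurableSpace X] {μ μ' : Measure X} {c : ENNReal}

theorem lintegral_le_mul_of_le_smul (hμ' : μ' ≤ c • μ) (f : X → ENNReal) :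
    ∫⁻ x, f x ∂μ' ≤ c * ∫⁻ x, f x ∂μ :=
  (lintegral_mono' hμ' le_rfl).trans (lintegral_smul_measure c f).le

theorem lintegral_codebook_eval_le {I : Type*} [Fintype I] [IsProbabilityMeasure μ']
    (hμ' : μ' ≤ c • μ) (k : I) {f : X → ENNReal} (hf : Measurable f) :
    ∫⁻ x, f (x k) ∂(Measure.pi fun _ : I => μ') ≤ c * ∫⁻ u, f u ∂μ := by
  rw [(measurePreserving_eval (fun _ : I => μ') k).lintegral_comp hf]
  exact lintegral_le_mul_of_le_smul hμ' f

/-- Distinct codewords are independent, so the domination of `μ'` by `c • μ` is paid once for each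
of the two. -/
theorem lintegral_codebook_pair_le {I : Type*} [Fintype I] [IsProbabilityMeasure μ'] [SFinite μ]
    (hμ' : μ' ≤ c • μ) {k j : I} (hkj : k ≠ j) {f : X → X → ENNReal}
    (hf : Measurable (Function.uncurry f)) :
    ∫⁻ x, f (x k) (x j) ∂(Measure.pi fun _ : I => μ') ≤ c * (c * ∫⁻ u, ∫⁻ v, f u v ∂μ ∂μ) := by
  have hind : IndepFun (fun x : I → X => x k) (fun x => x j) (Measure.pi fun _ : I => μ') :=
    (iIndepFun_pi (μ := fun _ : I => μ') (X := fun _ x => x)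
      fun i => aemeasurable_id').indepFun hkj
  have hmap := (indepFun_iff_map_prod_eq_prod_map_map (measurable_pi_apply k).aemeasurable
    (measurable_pi_apply j).aemeasurable).1 hind
  rw [(measurePreserving_eval (fun _ : I => μ') k).map_eq,
    (measurePreserving_eval (fun _ : I => μ') j).map_eq] at hmap
  have h1 : ∫⁻ x, f (x k) (x j) ∂(Measure.pi fun _ : I => μ') =
      ∫⁻ p, Function.uncurry f p ∂(μ'.prod μ') := by
    rw [← hmap, lintegral_map hf (by fun_prop)]
    rfl
  rw [h1, lintegral_prod _ hf.aemeasurable]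
  refine (lintegral_le_mul_of_le_smul hμ' _).trans ?_
  gcongr
  rw [← lintegral_const_mul _ hf.lintegral_prod_right]
  exact lintegral_mono fun u => lintegral_le_mul_of_le_smul hμ' _

end

section InfoDensity

variable {X Y : Type*} [MeasurableSpace X] [MeasurableSpace Y] {μ μ' : Measure X} {Q : Measure Y}
  {W : X → Measure Y} {ι : X → Y → ℝ} {c : ENNReal}

theorem IsInfoDensity.measurable_comp (h : IsInfoDensity μ Q W ι) {α : Type*} [MeasurableSpace α]
    {u : α → X} {w : α → Y} (hu : Measurable u) (hw : Measurable w) :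
    Measurable fun a => ι (u a) (w a) := h.measurable.comp (hu.prodMk hw)

/-- Markov's inequality for `exp (ι v)`, a probability density relative to `Q`. -/
theorem IsInfoDensity.measure_lt_le (h : IsInfoDensity μ Q W ι) (θ : ℝ) (v : X) :
    Q {y | θ < ι v y} ≤ ENNReal.ofReal (Real.exp (-θ)) := by
  have := h.isProbabilityMeasure v
  have hm : Measurable (ι v) := h.measurable_comp measurable_const measurable_id
  have hS : MeasurableSet {y | θ < ι v y} := measurableSet_lt measurable_const hm
  calc Q {y | θ < ι v y} = ∫⁻ y in {y | θ < ι v y}, 1 ∂Q := by simp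
    _ ≤ ∫⁻ y in {y | θ < ι v y}, ENNReal.ofReal (Real.exp (-θ)) *
          ENNReal.ofReal (Real.exp (ι v y)) ∂Q := by
        refine setLIntegral_mono (by fun_prop) fun y hy => ?_
        rw [← ENNReal.ofReal_mul (Real.exp_pos _).le, ← Real.exp_add, ← ENNReal.ofReal_one]
        refine ENNReal.ofReal_le_ofReal (Real.one_le_exp ?_)
        have : θ < ι v y := hy
        linarith
    _ = ENNReal.ofReal (Real.exp (-θ)) * W v {y | θ < ι v y} := by
        rw [lintegral_const_mul _ (by fun_prop), h.eq_withDensity v, withDensity_apply _ hS]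
    _ ≤ ENNReal.ofReal (Real.exp (-θ)) * 1 := by gcongr; exact prob_le_one
    _ = _ := mul_one _

theorem IsInfoDensity.measurable_measure_of_pair [SFinite Q] (h : IsInfoDensity μ Q W ι)
    {α : Type*} [MeasurableSpace α] {u : α → X} (hu : Measurable u) {S : α → Set Y}
    (hS : MeasurableSet {p : α × Y | p.2 ∈ S p.1}) : Measurable fun a => W (u a) (S a) := by
  have hSa : ∀ a, MeasurableSet (S a) := fun a => measurable_prodMk_left (x := a) hS
  have := h.measurable_lintegral hu (F := fun a y => (S a).indicator 1 y)
    (measurable_one.indicator hS)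
  simpa only [lintegral_indicator_one (hSa _)] using this

/-- For a wrong codeword the output is independent of it; averaging over the sent codeword turns the
output law into `Q`, under which exceeding `θ` has probability at most `exp (-θ)`. -/
theorem IsInfoDensity.lintegral_thresholdError_le [IsProbabilityMeasure μ]
    [IsProbabilityMeasure Q] [IsProbabilityMeasure μ'] (h : IsInfoDensity μ Q W ι)
    (hμ' : μ' ≤ c • μ) {I : Type*} [Fintype I] [DecidableEq I] (θ : ℝ) (k : I) :
    ∫⁻ x, thresholdError W ι θ x k ∂(Measure.pi fun _ : I => μ') ≤
      c * ∫⁻ u, W u {y | ι u y ≤ θ} ∂μ +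
        Fintype.card I * (c * (c * ENNReal.ofReal (Real.exp (-θ)))) := by
  have hle : Measurable fun u => W u {y | ι u y ≤ θ} :=
    h.measurable_measure_of_pair measurable_id
      (measurableSet_le (h.measurable_comp measurable_fst measurable_snd) measurable_const)
  have hgt : Measurable fun p : X × X => W p.1 {y | θ < ι p.2 y} :=
    h.measurable_measure_of_pair measurable_fst (measurableSet_lt measurable_const
      (h.measurable_comp (measurable_snd.comp measurable_fst) measurable_snd))
  have hswap : ∫⁻ u, ∫⁻ v, W u {y | θ < ι v y} ∂μ ∂μ ≤ ENNReal.ofReal (Real.exp (-θ)) := by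
    rw [lintegral_lintegral_swap hgt.aemeasurable]
    calc ∫⁻ v, ∫⁻ u, W u {y | θ < ι v y} ∂μ ∂μ = ∫⁻ v, Q {y | θ < ι v y} ∂μ := by
          refine lintegral_congr fun v => ?_
          have hS : MeasurableSet {y | θ < ι v y} :=
            measurableSet_lt measurable_const (h.measurable_comp measurable_const measurable_id)
          have := h.lintegral_output ({y | θ < ι v y}.indicator 1) (measurable_one.indicator hS)
          simpa only [lintegral_indicator_one hS] using this
      _ ≤ ∫⁻ _, ENNReal.ofReal (Real.exp (-θ)) ∂μ := lintegral_mono fun v => h.measure_lt_le θ v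
      _ = _ := by simp
  unfold thresholdError
  have hle' : Measurable fun x : I → X => W (x k) {y | ι (x k) y ≤ θ} :=
    hle.comp (f := fun x : I → X => x k) (measurable_pi_apply k)
  have hgt' : ∀ j, Measurable fun x : I → X => W (x k) {y | θ < ι (x j) y} := fun j =>
    hgt.comp (f := fun x : I → X => (x k, x j))
      ((measurable_pi_apply k).prodMk (measurable_pi_apply j))
  rw [lintegral_add_left hle', lintegral_finsetSum _ fun j _ => hgt' j]
  gcongr
  · exact lintegral_codebook_eval_le hμ' k hle
  · calc _ ≤ ∑ j ∈ Finset.univ.erase k, c * (c * ENNReal.ofReal (Real.exp (-θ))) := by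
          refine Finset.sum_le_sum fun j hj => ?_
          refine (lintegral_codebook_pair_le hμ' (Finset.ne_of_mem_erase hj).symm
            (f := fun u v => W u {y | θ < ι v y}) hgt).trans ?_
          gcongr
      _ ≤ ∑ j : I, c * (c * ENNReal.ofReal (Real.exp (-θ))) :=
          Finset.sum_le_sum_of_subset (Finset.erase_subset _ _)
      _ = _ := by simp

theorem log_one_add_add_le {u v : ℝ} (hu : 0 ≤ u) (hv : 0 ≤ v) :
    Real.log (1 + (u + v)) ≤ Real.log (1 + u) + v := by
  have h1 : Real.log (1 + (u + v)) ≤ Real.log ((1 + u) * (1 + v)) :=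
    Real.log_le_log (by linarith) (by nlinarith [mul_nonneg hu hv])
  rw [Real.log_mul (by linarith) (by linarith)] at h1
  have h2 := Real.log_le_sub_one_of_pos (show 0 < 1 + v by linarith)
  linarith

theorem IsInfoDensity.measurable_lintegral_exp [SFinite Q] (h : IsInfoDensity μ Q W ι) :
    Measurable fun p : X × X => ∫⁻ y, ENNReal.ofReal (Real.exp (ι p.2 y)) ∂W p.1 :=
  h.measurable_lintegral measurable_fst (F := fun p y => ENNReal.ofReal (Real.exp (ι p.2 y)))
    (h.measurable_comp (measurable_snd.comp measurable_fst) measurable_snd).exp.ennreal_ofReal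

/-- The average of `W u` over `u` is `Q`, against which `exp (ι v)` integrates to 1. -/
theorem IsInfoDensity.lintegral_lintegral_exp [IsProbabilityMeasure μ] [SFinite Q]
    (h : IsInfoDensity μ Q W ι) :
    ∫⁻ u, ∫⁻ v, ∫⁻ y, ENNReal.ofReal (Real.exp (ι v y)) ∂W u ∂μ ∂μ = 1 := by
  rw [lintegral_lintegral_swap h.measurable_lintegral_exp.aemeasurable]
  have : ∀ v, ∫⁻ u, ∫⁻ y, ENNReal.ofReal (Real.exp (ι v y)) ∂W u ∂μ = 1 := by
    intro v
    have := h.isProbabilityMeasure v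
    have hιm : Measurable (ι v) := h.measurable_comp measurable_const measurable_id
    rw [h.lintegral_output _ hιm.exp.ennreal_ofReal, ← setLIntegral_univ,
      ← withDensity_apply _ MeasurableSet.univ, ← h.eq_withDensity v, measure_univ]
  simp [this]

/-- The sent codeword is separated from the others by `log_one_add_add_le`. Its own term stays
inside the logarithm, its density being large; the others come out linearly, since their densities
have bounded mean. -/
theorem IsInfoDensity.lintegral_log_mean_le (h : IsInfoDensity μ Q W ι) {Λ : Type*} [Fintype Λ]
    [DecidableEq Λ] (x : Λ → X) (l : Λ) :
    ∫⁻ y, ENNReal.ofReal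
      (Real.log (1 + (Fintype.card Λ : ℝ)⁻¹ * ∑ l', Real.exp (ι (x l') y))) ∂W (x l) ≤
      ∫⁻ y, ENNReal.ofReal
        (Real.log (1 + (Fintype.card Λ : ℝ)⁻¹ * Real.exp (ι (x l) y))) ∂W (x l) +
        (Fintype.card Λ : ENNReal)⁻¹ * ∑ l' ∈ Finset.univ.erase l,
          ∫⁻ y, ENNReal.ofReal (Real.exp (ι (x l') y)) ∂W (x l) := by
  have hKpos : 0 < (Fintype.card Λ : ℝ) := by
    exact_mod_cast Fintype.card_pos_iff.2 ⟨l⟩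
  have hKinv : ENNReal.ofReal (Fintype.card Λ : ℝ)⁻¹ = (Fintype.card Λ : ENNReal)⁻¹ := by
    rw [ENNReal.ofReal_inv_of_pos hKpos, ENNReal.ofReal_natCast]
  have hιm : ∀ z, Measurable (ι z) := fun z => h.measurable_comp measurable_const measurable_id
  have hm := fun l' => (hιm (x l')).exp.ennreal_ofReal
  rw [← lintegral_finsetSum _ fun l' _ => hm l', ← lintegral_const_mul _
    (Finset.measurable_fun_sum _ fun l' _ => hm l'), ← lintegral_add_right _
    ((Finset.measurable_fun_sum _ fun l' _ => hm l').const_mul _)]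
  refine lintegral_mono fun y => ?_
  have h0 : 0 ≤ (Fintype.card Λ : ℝ)⁻¹ * Real.exp (ι (x l) y) := by positivity
  rw [← ENNReal.ofReal_sum_of_nonneg fun l' _ => (Real.exp_pos _).le, ← hKinv,
    ← ENNReal.ofReal_mul (inv_nonneg.2 hKpos.le), ← ENNReal.ofReal_add
    (Real.log_nonneg (le_add_of_nonneg_right h0)) (by positivity)]
  refine ENNReal.ofReal_le_ofReal ?_
  rw [← Finset.add_sum_erase _ _ (Finset.mem_univ l), mul_add]
  exact log_one_add_add_le h0 (by positivity)

theorem IsInfoDensity.measurable_lintegral_log_mean [SFinite Q] (h : IsInfoDensity μ Q W ι)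
    {I Λ : Type*} [Fintype Λ] (e : Λ → I) (l : Λ) (K : ℝ) :
    Measurable fun x : I → X => ∫⁻ y, ENNReal.ofReal (Real.log (1 + K * ∑ l',
      Real.exp (ι (x (e l')) y))) ∂W (x (e l)) := by
  have hι : ∀ l', Measurable fun p : (I → X) × Y => Real.exp (ι (p.1 (e l')) p.2) := fun l' =>
    (h.measurable_comp (u := fun p : (I → X) × Y => p.1 (e l'))
      ((measurable_pi_apply (e l')).comp measurable_fst) measurable_snd).exp
  have hF : Measurable fun p : (I → X) × Y => ENNReal.ofReal
      (Real.log (1 + K * ∑ l', Real.exp (ι (p.1 (e l')) p.2))) :=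
    (((Finset.measurable_fun_sum _ fun l' _ => hι l').const_mul K).const_add 1).log.ennreal_ofReal
  exact h.measurable_lintegral (u := fun x : I → X => x (e l)) (measurable_pi_apply (e l))
    (F := fun x y => ENNReal.ofReal (Real.log (1 + K * ∑ l', Real.exp (ι (x (e l')) y)))) hF

theorem IsInfoDensity.measurable_leakage [SFinite Q] (h : IsInfoDensity μ Q W ι)
    {I Λ : Type*} [Fintype Λ] (e : Λ → I) :
    Measurable fun x : I → X => leakage W ι (fun l => x (e l)) :=
  ((Finset.measurable_fun_sum _ fun l _ =>
    h.measurable_lintegral_log_mean e l _).const_mul _).const_add _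

theorem IsInfoDensity.lintegral_codebook_log_mean_le [IsProbabilityMeasure μ]
    [IsProbabilityMeasure Q] [IsProbabilityMeasure μ'] (h : IsInfoDensity μ Q W ι)
    (hμ' : μ' ≤ c • μ) {I Λ : Type*} [Fintype I] [Fintype Λ] {e : Λ → I}
    (he : Function.Injective e) (l : Λ) :
    ∫⁻ x, ∫⁻ y, ENNReal.ofReal (Real.log (1 + (Fintype.card Λ : ℝ)⁻¹ * ∑ l', Real.exp
      (ι (x (e l')) y))) ∂W (x (e l)) ∂(Measure.pi fun _ : I => μ') ≤
      c * ∫⁻ u, ∫⁻ y, ENNReal.ofReal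
        (Real.log (1 + (Fintype.card Λ : ℝ)⁻¹ * Real.exp (ι u y))) ∂W u ∂μ + c * c := by
  classical
  have hc1 : (Fintype.card Λ : ENNReal)⁻¹ * Fintype.card Λ = 1 :=
    ENNReal.inv_mul_cancel (by have : Nonempty Λ := ⟨l⟩; simp) (by simp)
  have hAm : Measurable fun u => ∫⁻ y, ENNReal.ofReal
      (Real.log (1 + (Fintype.card Λ : ℝ)⁻¹ * Real.exp (ι u y))) ∂W u :=
    h.measurable_lintegral measurable_id (F := fun u y => ENNReal.ofReal
      (Real.log (1 + (Fintype.card Λ : ℝ)⁻¹ * Real.exp (ι u y)))) (by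
        have := h.measurable
        unfold Function.uncurry at *
        fun_prop)
  have hBm := h.measurable_lintegral_exp
  have hBe : ∀ l', Measurable fun x : I → X =>
      ∫⁻ y, ENNReal.ofReal (Real.exp (ι (x (e l')) y)) ∂W (x (e l)) := fun l' =>
    hBm.comp (f := fun x : I → X => (x (e l), x (e l')))
      ((measurable_pi_apply (e l)).prodMk (measurable_pi_apply (e l')))
  have hAe : Measurable fun x : I → X => ∫⁻ y, ENNReal.ofReal
      (Real.log (1 + (Fintype.card Λ : ℝ)⁻¹ * Real.exp (ι (x (e l)) y))) ∂W (x (e l)) :=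
    hAm.comp (f := fun x : I → X => x (e l)) (measurable_pi_apply (e l))
  refine (lintegral_mono fun x : I → X => h.lintegral_log_mean_le (fun l => x (e l)) l).trans ?_
  rw [lintegral_add_left hAe, lintegral_const_mul _
    (Finset.measurable_fun_sum _ fun l' _ => hBe l'), lintegral_finsetSum _ fun l' _ => hBe l']
  refine add_le_add (lintegral_codebook_eval_le hμ' (e l) hAm) ?_
  calc _ ≤ (Fintype.card Λ : ENNReal)⁻¹ * ∑ l' ∈ Finset.univ.erase l, c * c := by
        refine mul_le_mul_right (Finset.sum_le_sum fun l' hl' => ?_) _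
        refine (lintegral_codebook_pair_le hμ' (he.ne (Finset.ne_of_mem_erase hl').symm)
          (f := fun u v => ∫⁻ y, ENNReal.ofReal (Real.exp (ι v y)) ∂W u) hBm).trans ?_
        rw [h.lintegral_lintegral_exp, mul_one]
    _ ≤ (Fintype.card Λ : ENNReal)⁻¹ * ∑ l' : Λ, c * c :=
        mul_le_mul_right (Finset.sum_le_sum_of_subset (Finset.erase_subset _ _)) _
    _ = c * c := by
        rw [Finset.sum_const, Finset.card_univ, nsmul_eq_mul, ← mul_assoc, hc1, one_mul]

theorem IsInfoDensity.lintegral_leakage_le [IsProbabilityMeasure μ]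
    [IsProbabilityMeasure Q] [IsProbabilityMeasure μ'] (h : IsInfoDensity μ Q W ι)
    (hμ' : μ' ≤ c • μ) {I Λ : Type*} [Fintype I] [Fintype Λ] [Nonempty Λ] {e : Λ → I}
    (he : Function.Injective e) :
    ∫⁻ x, leakage W ι (fun l => x (e l)) ∂(Measure.pi fun _ : I => μ') ≤
      1 + (c * ∫⁻ u, ∫⁻ y, ENNReal.ofReal
        (Real.log (1 + (Fintype.card Λ : ℝ)⁻¹ * Real.exp (ι u y))) ∂W u ∂μ + c * c) := by
  have hc1 : (Fintype.card Λ : ENNReal)⁻¹ * Fintype.card Λ = 1 :=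
    ENNReal.inv_mul_cancel (by simp) (by simp)
  have hTm := fun l => h.measurable_lintegral_log_mean (I := I) e l (Fintype.card Λ : ℝ)⁻¹
  unfold leakage
  rw [lintegral_add_left measurable_const, lintegral_const_mul _
    (Finset.measurable_fun_sum _ fun l _ => hTm l), lintegral_finsetSum _ fun l _ => hTm l]
  refine add_le_add (by simp) ?_
  refine (mul_le_mul_right (Finset.sum_le_sum fun l _ =>
    h.lintegral_codebook_log_mean_le hμ' he l) _).trans (le_of_eq ?_)
  rw [Finset.sum_const, Finset.card_univ, nsmul_eq_mul, ← mul_assoc, hc1, one_mul]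

end InfoDensity

/-! ### Second moment of the Gaussian information density. -/

theorem lintegral_sum_sq_pi {Ω : Type*} [MeasurableSpace Ω] (m : Measure Ω)
    [IsProbabilityMeasure m] {ξ : Ω → ℝ} (hξ : MemLp ξ 2 m) (h0 : ∫ w, ξ w ∂m = 0) (n : ℕ) :
    ∫⁻ w : Fin n → Ω, ENNReal.ofReal ((∑ i, ξ (w i)) ^ 2) ∂(Measure.pi fun _ => m) =
      ENNReal.ofReal (n * Var[ξ; m]) := by
  have hi : ∀ i : Fin n, MemLp (fun w : Fin n → Ω => ξ (w i)) 2 (Measure.pi fun _ => m) :=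
    fun i => hξ.comp_measurePreserving (measurePreserving_eval (fun _ : Fin n => m) i)
  have hS : MemLp (fun w : Fin n → Ω => ∑ i, ξ (w i)) 2 (Measure.pi fun _ => m) :=
    memLp_finsetSum _ fun i _ => hi i
  have hmean : ∫ w : Fin n → Ω, ∑ i, ξ (w i) ∂(Measure.pi fun _ => m) = 0 := by
    rw [integral_finsetSum _ fun i _ => (hi i).integrable one_le_two]
    refine Finset.sum_eq_zero fun i _ => ?_
    have hp := measurePreserving_eval (fun _ : Fin n => m) i
    have h := integral_map (μ := Measure.pi fun _ : Fin n => m) hp.measurable.aemeasurable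
      (f := ξ) (by rw [hp.map_eq]; exact hξ.1)
    rw [hp.map_eq, h0] at h
    exact h.symm
  have hvar := variance_sum_pi (ι := Fin n) (μ := fun _ => m) (X := fun _ => ξ) fun _ => hξ
  have e : (∑ i : Fin n, fun w : Fin n → Ω => ξ (w i)) = fun w => ∑ i, ξ (w i) := by
    ext w; simp
  rw [e, variance_eq_sub hS, hmean] at hvar
  simp only [Finset.sum_const, Finset.card_univ, Fintype.card_fin, nsmul_eq_mul] at hvar
  rw [← ofReal_integral_eq_lintegral_ofReal hS.integrable_sq (ae_of_all _ fun w => sq_nonneg _)]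
  congr 1
  simpa using hvar

theorem memLp_sq_of_memLp_four {Ω : Type*} [MeasurableSpace Ω] {m : Measure Ω} {f : Ω → ℝ}
    (hf : MemLp f 4 m) : MemLp (fun w => f w ^ 2) 2 m := by
  refine (memLp_two_iff_integrable_sq (hf.1.pow 2)).2 ?_
  have h := hf.integrable_norm_pow (p := 4) (by norm_num)
  refine h.congr (ae_of_all _ fun w => ?_)
  simp only [Real.norm_eq_abs, Pi.pow_apply, ← pow_mul]
  rw [Even.pow_abs (by decide)]

theorem integral_add_mul_sq_gaussianReal (u s : ℝ) :
    ∫ x, (u + s * x) ^ 2 ∂gaussianReal 0 1 = u ^ 2 + s ^ 2 := by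
  have hp := measurePreserving_eval (fun _ : Fin 1 => gaussianReal 0 1) 0
  have h := integral_map (μ := iidGaussian 1) hp.measurable.aemeasurable
    (f := fun x : ℝ => (u + s * x) ^ 2) (by fun_prop)
  rw [hp.map_eq] at h
  rw [h]
  exact integral_add_mul_eval_sq 0 u s

theorem memLp_linear_four (α s : ℝ) :
    MemLp (fun w : ℝ × ℝ => α * w.1 + s * w.2) 4 ((gaussianReal 0 1).prod (gaussianReal 0 1)) :=
  (((memLp_id_gaussianReal 4).comp_fst (gaussianReal 0 1)).const_mul α).add
    (((memLp_id_gaussianReal 4).comp_snd (gaussianReal 0 1)).const_mul s)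

theorem integral_linear_sq_gaussianReal (α s : ℝ) :
    ∫ w, (α * w.1 + s * w.2) ^ 2 ∂((gaussianReal 0 1).prod (gaussianReal 0 1)) =
      α ^ 2 + s ^ 2 := by
  rw [integral_prod _ ((memLp_linear_four α s).mono_exponent (by norm_num) |>.integrable_sq)]
  simp_rw [integral_add_mul_sq_gaussianReal]
  have h : Integrable (fun x : ℝ => (α * x) ^ 2) (gaussianReal 0 1) :=
    ((memLp_id_gaussianReal (μ := 0) (v := 1) 2).const_mul α).integrable_sq
  rw [integral_add h (integrable_const _)]
  have := integral_add_mul_sq_gaussianReal 0 α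
  simp only [zero_add] at this
  rw [this]
  simp

/-- The centred information density of one use of the Gaussian channel with gain `b` and input
`r * w.1`, noise `w.2`. -/
noncomputable def centredDensity (b r : ℝ) (w : ℝ × ℝ) : ℝ :=
  (√b * r * w.1 + 1 * w.2) ^ 2 / (2 * (1 + b * r ^ 2)) - (0 * w.1 + 1 * w.2) ^ 2 / 2

theorem memLp_centredDensity (b r : ℝ) :
    MemLp (centredDensity b r) 2 ((gaussianReal 0 1).prod (gaussianReal 0 1)) := by
  have h := ((memLp_sq_of_memLp_four (memLp_linear_four (√b * r) 1)).mul_const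
    (2 * (1 + b * r ^ 2))⁻¹).sub ((memLp_sq_of_memLp_four (memLp_linear_four 0 1)).mul_const 2⁻¹)
  exact h

theorem integral_centredDensity {b : ℝ} (hb : 0 ≤ b) (r : ℝ) :
    ∫ w, centredDensity b r w ∂((gaussianReal 0 1).prod (gaussianReal 0 1)) = 0 := by
  unfold centredDensity
  have h1 := fun α => (memLp_sq_of_memLp_four (memLp_linear_four α 1)).integrable one_le_two
  rw [integral_sub ((h1 _).div_const _) ((h1 _).div_const _), integral_div, integral_div,
    integral_linear_sq_gaussianReal, integral_linear_sq_gaussianReal, mul_pow, Real.sq_sqrt hb]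
  have : 0 < 1 + b * r ^ 2 := by positivity
  field_simp
  ring

/-- The channel with gain `b` as a family of output laws. -/
noncomputable def gaussianChannel (n : ℕ) (b : ℝ) (x : Fin n → ℝ) : Measure (Fin n → ℝ) :=
  gaussianBlock (fun i => √b * x i) 1

/-- The information density of the channel with gain `b` under Gaussian inputs of standard
deviation `r`. -/
noncomputable def infoDensity (n : ℕ) (b r : ℝ) (x y : Fin n → ℝ) : ℝ :=
  gaussianLogRatio (fun i => √b * x i) 1 0 (√(1 + b * r ^ 2)) y

theorem isInfoDensity_gaussian (n : ℕ) {b : ℝ} (hb : 0 ≤ b) (r : ℝ) :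
    IsInfoDensity (gaussianBlock (0 : Fin n → ℝ) r) (gaussianBlock 0 (√(1 + b * r ^ 2)))
      (gaussianChannel n b) (infoDensity n b r) := by
  have hτ : 0 < 1 + b * r ^ 2 := by positivity
  refine ⟨?_, fun x => by unfold gaussianChannel; infer_instance, fun x =>
    gaussianBlock_eq_withDensity _ _ one_pos (Real.sqrt_pos.2 hτ), fun f hf => ?_⟩
  · unfold Function.uncurry infoDensity
    exact measurable_gaussianLogRatio (by fun_prop) measurable_const measurable_snd _ _
  · have hmap := iidGaussian_prod_map_linear (n := n) (√b * r) 1 (√(1 + b * r ^ 2)) (by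
      rw [Real.sq_sqrt hτ.le, mul_pow, Real.sq_sqrt hb]; ring)
    have h1 : ∀ x, ∫⁻ y, f y ∂gaussianChannel n b x =
        ∫⁻ N, f (fun i => √b * x i + 1 * N i) ∂iidGaussian n := fun x => by
      rw [gaussianChannel, gaussianBlock, lintegral_map hf (by fun_prop)]
    simp_rw [h1]
    have hm : Measurable fun x : Fin n → ℝ =>
        ∫⁻ N, f (fun i => √b * x i + 1 * N i) ∂iidGaussian n :=
      Measurable.lintegral_prod_right' (f := fun p : (Fin n → ℝ) × (Fin n → ℝ) =>
        f (fun i => √b * p.1 i + 1 * p.2 i)) (hf.comp (by fun_prop))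
    rw [← hmap, lintegral_map hf (by fun_prop), lintegral_prod _ (by
      exact (hf.comp (by fun_prop : Measurable fun p : (Fin n → ℝ) × (Fin n → ℝ) =>
        fun i => √b * r * p.1 i + 1 * p.2 i)).aemeasurable), gaussianBlock,
      lintegral_map hm (by fun_prop)]
    simp [mul_assoc]

theorem lintegral_gaussianChannel_eq (n : ℕ) (b r : ℝ) {G : (Fin n → ℝ) → (Fin n → ℝ) → ENNReal}
    (hG : Measurable (Function.uncurry G)) :
    ∫⁻ u, ∫⁻ y, G u y ∂gaussianChannel n b u ∂(gaussianBlock (0 : Fin n → ℝ) r) =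
      ∫⁻ w : Fin n → ℝ × ℝ, G (fun i => r * (w i).1) (fun i => √b * (r * (w i).1) + (w i).2)
        ∂(Measure.pi fun _ => (gaussianReal 0 1).prod (gaussianReal 0 1)) := by
  have hGu : ∀ u, Measurable (G u) := fun u => hG.comp measurable_prodMk_left
  have h1 : ∀ x, ∫⁻ y, G x y ∂gaussianChannel n b x =
      ∫⁻ N, G x (fun i => √b * x i + N i) ∂iidGaussian n := fun x => by
    rw [gaussianChannel, gaussianBlock, lintegral_map (hGu x) (by fun_prop)]
    simp only [one_mul]
  simp_rw [h1]
  have hm1 : Measurable fun p : (Fin n → ℝ) × (Fin n → ℝ) =>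
      G p.1 (fun i => √b * p.1 i + p.2 i) :=
    hG.comp (f := fun p : (Fin n → ℝ) × (Fin n → ℝ) =>
      (p.1, fun i => √b * p.1 i + p.2 i)) (by fun_prop)
  have hm2 : Measurable fun p : (Fin n → ℝ) × (Fin n → ℝ) =>
      G (fun i => r * p.1 i) (fun i => √b * (r * p.1 i) + p.2 i) :=
    hG.comp (f := fun p : (Fin n → ℝ) × (Fin n → ℝ) => (fun i => r * p.1 i,
      fun i => √b * (r * p.1 i) + p.2 i)) (by fun_prop)
  have h2 : gaussianBlock (0 : Fin n → ℝ) r = (iidGaussian n).map fun N i => r * N i := by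
    simp [gaussianBlock]
  rw [h2, lintegral_map hm1.lintegral_prod_right' (by fun_prop),
    ← lintegral_prod (fun p : (Fin n → ℝ) × (Fin n → ℝ) =>
      G (fun i => r * p.1 i) (fun i => √b * (r * p.1 i) + p.2 i)) hm2.aemeasurable]
  have hp := measurePreserving_arrowProdEquivProdArrow ℝ ℝ (Fin n) (fun _ => gaussianReal 0 1)
    (fun _ => gaussianReal 0 1)
  rw [← hp.lintegral_comp hm2]
  rfl

/-- The information density concentrates at `n` capacities: its deviation is a sum of i.i.d. centred
terms, so its second moment grows only linearly in `n`. -/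
theorem infoDensity_eq_sum_centredDensity (n : ℕ) {b : ℝ} (hb : 0 ≤ b) (r : ℝ) (w : Fin n → ℝ × ℝ) :
    infoDensity n b r (fun i => r * (w i).1) (fun i => √b * (r * (w i).1) + (w i).2) -
      n * (1 / 2 * Real.log (1 + b * r ^ 2)) = ∑ i, centredDensity b r (w i) := by
  have hτ : 0 < 1 + b * r ^ 2 := by positivity
  have hlog : n * (1 / 2 * Real.log (1 + b * r ^ 2)) =
      ∑ _i : Fin n, Real.log (√(1 + b * r ^ 2) / 1) := by
    rw [Finset.sum_const, Finset.card_univ, Fintype.card_fin, nsmul_eq_mul, div_one,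
      Real.log_sqrt hτ.le]
    ring
  rw [hlog, infoDensity, gaussianLogRatio, ← Finset.sum_sub_distrib]
  refine Finset.sum_congr rfl fun i _ => ?_
  rw [Real.sq_sqrt hτ.le]
  simp only [centredDensity, Pi.zero_apply]
  ring

theorem measurable_infoDensity_sub_sq (n : ℕ) {b : ℝ} (hb : 0 ≤ b) (r C : ℝ) :
    Measurable (Function.uncurry fun u y => ENNReal.ofReal ((infoDensity n b r u y - C) ^ 2)) := by
  have hι : Measurable fun p : (Fin n → ℝ) × (Fin n → ℝ) => infoDensity n b r p.1 p.2 :=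
    (isInfoDensity_gaussian n hb r).measurable
  unfold Function.uncurry
  fun_prop

theorem lintegral_infoDensity_sq (n : ℕ) {b : ℝ} (hb : 0 ≤ b) (r : ℝ) :
    ∫⁻ u, ∫⁻ y, ENNReal.ofReal ((infoDensity n b r u y - n * (1 / 2 * Real.log (1 + b * r ^ 2))) ^ 2)
      ∂gaussianChannel n b u ∂(gaussianBlock (0 : Fin n → ℝ) r) =
      ENNReal.ofReal
        (n * Var[centredDensity b r; (gaussianReal 0 1).prod (gaussianReal 0 1)]) := by
  rw [lintegral_gaussianChannel_eq n b r (G := fun u y => ENNReal.ofReal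
    ((infoDensity n b r u y - n * (1 / 2 * Real.log (1 + b * r ^ 2))) ^ 2))
    (measurable_infoDensity_sub_sq n hb r _),
    ← lintegral_sum_sq_pi _ (memLp_centredDensity b r) (integral_centredDensity hb r) n]
  simp_rw [infoDensity_eq_sum_centredDensity n hb r]

/-- The variance of the information density of one channel use. -/
noncomputable def dispersion (b r : ℝ) : ℝ :=
  Var[centredDensity b r; (gaussianReal 0 1).prod (gaussianReal 0 1)]

theorem dispersion_nonneg (b r : ℝ) : 0 ≤ dispersion b r := variance_nonneg _ _

/-- The logarithm is at most 1 plus the positive part of `t - log K`, hence at most `1 + D + |t -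
C|`; the weighted inequality `|x| ≤ s / 2 + x² / (2s)` brings in the second moment. With `s = √n`
and variance of order `n` the cost is of order `√n`. -/
theorem log_one_add_inv_mul_exp_le {K D C t s : ℝ} (hK : 0 < K) (hD : 0 ≤ D)
    (hKD : C - Real.log K ≤ D) (hs : 0 < s) :
    Real.log (1 + K⁻¹ * Real.exp t) ≤ 1 + D + s / 2 + (2 * s)⁻¹ * (t - C) ^ 2 := by
  have habs : |t - C| ≤ s / 2 + (2 * s)⁻¹ * (t - C) ^ 2 := by
    have : s / 2 + (2 * s)⁻¹ * (t - C) ^ 2 - |t - C| = (s - |t - C|) ^ 2 / (2 * s) := by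
      rw [sub_sq s, sq_abs]
      field_simp
      ring
    have h0 : 0 ≤ (s - |t - C|) ^ 2 / (2 * s) := by positivity
    linarith
  have h1 : K⁻¹ * Real.exp t = Real.exp (t - Real.log K) := by
    rw [Real.exp_sub, Real.exp_log hK]; ring
  have h2 : t - Real.log K ≤ D + |t - C| := by linarith [le_abs_self (t - C)]
  have h3 : 1 + K⁻¹ * Real.exp t ≤ Real.exp (1 + (D + |t - C|)) := by
    have h4 : (1 : ℝ) ≤ Real.exp (D + |t - C|) := Real.one_le_exp (by positivity)
    have h5 := Real.exp_le_exp.2 h2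
    have h6 : (2 : ℝ) ≤ Real.exp 1 := by linarith [Real.add_one_le_exp (1 : ℝ)]
    rw [h1, Real.exp_add]
    nlinarith
  calc Real.log (1 + K⁻¹ * Real.exp t) ≤ Real.log (Real.exp (1 + (D + |t - C|))) :=
        Real.log_le_log (by positivity) h3
    _ = 1 + (D + |t - C|) := Real.log_exp _
    _ ≤ _ := by linarith

/-! ### From second moments to error, leakage and power bounds. -/

section InfoDensity

variable {X Y : Type*} [MeasurableSpace X] [MeasurableSpace Y] {μ : Measure X} {Q : Measure Y}
  {W : X → Measure Y} {ι : X → Y → ℝ}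

theorem IsInfoDensity.measurable_lintegral_sub_sq [SFinite Q] (h : IsInfoDensity μ Q W ι) (C : ℝ) :
    Measurable fun u => ∫⁻ y, ENNReal.ofReal ((ι u y - C) ^ 2) ∂W u :=
  h.measurable_lintegral measurable_id (F := fun u y => ENNReal.ofReal ((ι u y - C) ^ 2))
    (((h.measurable.sub_const C).pow_const 2).ennreal_ofReal)

/-- Chebyshev's inequality, averaged over the input. -/
theorem IsInfoDensity.lintegral_measure_le_le [SFinite Q] (h : IsInfoDensity μ Q W ι) {C V δ : ℝ}
    (hV : ∫⁻ u, ∫⁻ y, ENNReal.ofReal ((ι u y - C) ^ 2) ∂W u ∂μ ≤ ENNReal.ofReal V) (hδ : 0 < δ) :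
    ∫⁻ u, W u {y | ι u y ≤ C - δ} ∂μ ≤ ENNReal.ofReal (V / δ ^ 2) := by
  have hιu : ∀ u, Measurable (ι u) := fun u => h.measurable.comp measurable_prodMk_left
  have hpt : ∀ u, W u {y | ι u y ≤ C - δ} ≤
      ENNReal.ofReal (δ ^ 2)⁻¹ * ∫⁻ y, ENNReal.ofReal ((ι u y - C) ^ 2) ∂W u := by
    intro u
    have hS : MeasurableSet {y | ι u y ≤ C - δ} := measurableSet_le (hιu u) measurable_const
    have hm := hιu u
    rw [← lintegral_indicator_one hS, ← lintegral_const_mul _ (by fun_prop)]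
    refine lintegral_mono fun y => ?_
    by_cases hy : y ∈ {y | ι u y ≤ C - δ}
    · rw [Set.indicator_of_mem hy, ← ENNReal.ofReal_mul (by positivity), Pi.one_apply,
        ← ENNReal.ofReal_one]
      refine ENNReal.ofReal_le_ofReal ?_
      rw [← div_eq_inv_mul, one_le_div (by positivity)]
      have hy' : ι u y ≤ C - δ := hy
      nlinarith
    · rw [Set.indicator_of_notMem hy]
      exact zero_le
  refine (lintegral_mono hpt).trans ?_
  rw [lintegral_const_mul _ (h.measurable_lintegral_sub_sq C)]
  refine (mul_le_mul_right hV _).trans ?_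
  rw [← ENNReal.ofReal_mul (by positivity), div_eq_inv_mul]

theorem IsInfoDensity.lintegral_log_le [SFinite Q] [IsProbabilityMeasure μ]
    (h : IsInfoDensity μ Q W ι) {C V K D s : ℝ}
    (hV : ∫⁻ u, ∫⁻ y, ENNReal.ofReal ((ι u y - C) ^ 2) ∂W u ∂μ ≤ ENNReal.ofReal V) (hV0 : 0 ≤ V)
    (hK : 0 < K) (hD : 0 ≤ D) (hKD : C - Real.log K ≤ D) (hs : 0 < s) :
    ∫⁻ u, ∫⁻ y, ENNReal.ofReal (Real.log (1 + K⁻¹ * Real.exp (ι u y))) ∂W u ∂μ ≤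
      ENNReal.ofReal (1 + D + s / 2 + (2 * s)⁻¹ * V) := by
  have hW := h.isProbabilityMeasure
  have hpt : ∀ u, ∫⁻ y, ENNReal.ofReal (Real.log (1 + K⁻¹ * Real.exp (ι u y))) ∂W u ≤
      ENNReal.ofReal (1 + D + s / 2) + ENNReal.ofReal (2 * s)⁻¹ *
        ∫⁻ y, ENNReal.ofReal ((ι u y - C) ^ 2) ∂W u := by
    intro u
    have hιu : Measurable (ι u) := h.measurable.comp measurable_prodMk_left
    have hc : ENNReal.ofReal (1 + D + s / 2) =
        ∫⁻ _, ENNReal.ofReal (1 + D + s / 2) ∂W u := by simp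
    rw [← lintegral_const_mul _ (by fun_prop), hc, ← lintegral_add_left measurable_const]
    refine lintegral_mono fun y => ?_
    rw [← ENNReal.ofReal_mul (by positivity), ← ENNReal.ofReal_add (by positivity) (by positivity)]
    exact ENNReal.ofReal_le_ofReal (log_one_add_inv_mul_exp_le hK hD hKD hs)
  refine (lintegral_mono hpt).trans ?_
  rw [lintegral_add_left measurable_const,
    lintegral_const_mul _ (h.measurable_lintegral_sub_sq C), lintegral_const, measure_univ, mul_one]
  refine (add_le_add_right (mul_le_mul_right hV _) _).trans ?_
  rw [← ENNReal.ofReal_mul (by positivity), ← ENNReal.ofReal_add (by positivity) (by positivity)]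

end InfoDensity

/-- Gaussian inputs of variance below `P` violate the power constraint with vanishing
probability. -/
theorem gaussianBlock_power_compl_le {n : ℕ} (hn : 0 < n) {r P : ℝ} (hr : r ^ 2 < P) :
    gaussianBlock (0 : Fin n → ℝ) r {x | (1 / (n : ℝ)) * ∑ i, x i ^ 2 ≤ P}ᶜ ≤
      ENNReal.ofReal (Var[fun x : ℝ => (r * x) ^ 2 - r ^ 2; gaussianReal 0 1] /
        (n * (P - r ^ 2) ^ 2)) := by
  have hn' : (0 : ℝ) < n := by exact_mod_cast hn
  have hδ : 0 < P - r ^ 2 := by linarith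
  have hLp : MemLp (fun x : ℝ => (r * x) ^ 2 - r ^ 2) 2 (gaussianReal 0 1) :=
    (memLp_sq_of_memLp_four ((memLp_id_gaussianReal 4).const_mul r)).sub (memLp_const _)
  have hmean : ∫ x, ((r * x) ^ 2 - r ^ 2) ∂gaussianReal 0 1 = 0 := by
    have h := integral_add_mul_sq_gaussianReal 0 r
    simp only [zero_add] at h
    rw [integral_sub _ (integrable_const _), h]
    · simp
    · exact (memLp_sq_of_memLp_four ((memLp_id_gaussianReal 4).const_mul r)).integrable one_le_two
  have hS : MeasurableSet {x : Fin n → ℝ | (1 / (n : ℝ)) * ∑ i, x i ^ 2 ≤ P} :=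
    measurableSet_le (by fun_prop) measurable_const
  have hmoment := lintegral_sum_sq_pi (gaussianReal 0 1) hLp hmean n
  rw [gaussianBlock, Measure.map_apply (by fun_prop) hS.compl]
  set T := (fun (N : Fin n → ℝ) i => (0 : Fin n → ℝ) i + r * N i) ⁻¹'
    {x : Fin n → ℝ | (1 / (n : ℝ)) * ∑ i, x i ^ 2 ≤ P}ᶜ with hT
  have hTm : MeasurableSet T := hS.compl.preimage (by fun_prop)
  calc iidGaussian n T ≤ ENNReal.ofReal ((n * (P - r ^ 2)) ^ 2)⁻¹ *
        ∫⁻ N, ENNReal.ofReal ((∑ i, ((r * N i) ^ 2 - r ^ 2)) ^ 2) ∂iidGaussian n := by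
        rw [← lintegral_indicator_one hTm, ← lintegral_const_mul _ (by fun_prop)]
        refine lintegral_mono fun N => ?_
        by_cases hN : N ∈ T
        · rw [Set.indicator_of_mem hN, ← ENNReal.ofReal_mul (by positivity), Pi.one_apply,
            ← ENNReal.ofReal_one]
          refine ENNReal.ofReal_le_ofReal ?_
          rw [← div_eq_inv_mul, one_le_div (by positivity)]
          have hN' : P < (1 / (n : ℝ)) * ∑ i, ((0 : Fin n → ℝ) i + r * N i) ^ 2 := not_le.1 hN
          simp only [Pi.zero_apply, zero_add] at hN'
          rw [one_div, ← div_eq_inv_mul, lt_div_iff₀ hn'] at hN'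
          have : n * (P - r ^ 2) ≤ ∑ i, ((r * N i) ^ 2 - r ^ 2) := by
            rw [Finset.sum_sub_distrib, Finset.sum_const, Finset.card_univ, Fintype.card_fin,
              nsmul_eq_mul]
            linarith
          exact pow_le_pow_left₀ (by positivity) this 2
        · rw [Set.indicator_of_notMem hN]
          exact zero_le
    _ = _ := by
        rw [hmoment, ← ENNReal.ofReal_mul (by positivity)]
        congr 1
        field_simp

/-! ### Threshold decoding. -/

open Classical in
/-- The only index at which `S` holds, if there is exactly one. -/
noncomputable def uniqueIndex {I : Type*} [Nonempty I] (S : I → Prop) : I :=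
  if h : ∃! k, S k then h.choose else Classical.arbitrary I

theorem uniqueIndex_eq {I : Type*} [Nonempty I] {S : I → Prop} {k : I} (hk : S k)
    (hj : ∀ j, j ≠ k → ¬ S j) : uniqueIndex S = k := by
  have h : ∃! k, S k := ⟨k, hk, fun j hS => by_contra fun hne => hj j hne hS⟩
  rw [uniqueIndex, dif_pos h]
  by_contra hne
  exact hj _ hne h.choose_spec.1

/-- The decoder that looks for the only codeword with information density above `θ`. -/
noncomputable def thresholdDecoder {X Y I : Type*} [Nonempty I] (ι : X → Y → ℝ) (θ : ℝ) (x : I → X)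
    (y : Y) : I := uniqueIndex fun k => θ < ι (x k) y

section InfoDensity

variable {X Y : Type*} [MeasurableSpace X] [MeasurableSpace Y] {μ : Measure X} {Q : Measure Y}
  {W : X → Measure Y} {ι : X → Y → ℝ}

theorem IsInfoDensity.measurable_thresholdDecoder (h : IsInfoDensity μ Q W ι) {I : Type*}
    [Finite I] [Nonempty I] [MeasurableSpace I] (θ : ℝ) (x : I → X) :
    Measurable (thresholdDecoder ι θ x) := by
  have h1 : Measurable fun (y : Y) (k : I) => θ < ι (x k) y := by
    refine measurable_pi_iff.2 fun k => ?_
    have hk : Measurable (ι (x k)) := h.measurable.comp measurable_prodMk_left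
    exact measurableSet_setOfPred.1 (measurableSet_lt measurable_const hk)
  -- The decoder factors through the finite set of predicates on `I`, where every map is measurable.
  exact (measurable_of_finite (uniqueIndex (I := I))).comp h1

end InfoDensity

theorem measure_thresholdDecoder_ne_le {X Y I : Type*} [MeasurableSpace Y] [Fintype I]
    [DecidableEq I] [Nonempty I] {W : X → Measure Y} {ι : X → Y → ℝ} (θ : ℝ) (x : I → X) (k : I) :
    W (x k) {y | thresholdDecoder ι θ x y ≠ k} ≤ thresholdError W ι θ x k := by
  have hsub : {y | thresholdDecoder ι θ x y ≠ k} ⊆ {y | ι (x k) y ≤ θ} ∪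
      ⋃ j ∈ Finset.univ.erase k, {y | θ < ι (x j) y} := by
    intro y hy
    by_contra hcon
    simp only [Set.mem_union, Set.mem_iUnion, not_or, not_exists] at hcon
    obtain ⟨h1, h2⟩ := hcon
    exact hy (uniqueIndex_eq (not_le.1 h1) fun j hj => h2 j (Finset.mem_erase.2 ⟨hj, by simp⟩))
  refine (measure_mono hsub).trans ((measure_union_le _ _).trans ?_)
  exact add_le_add_right (measure_biUnion_finset_le _ _) _

/-! ### Codes built from codebooks. -/

section Codebook

variable {n : ℕ} {P : ℝ} {K₁ K₂ L : ℕ}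

/-- The encoder that sends a uniformly chosen codeword out of those assigned to the message pair. -/
noncomputable def codebookKernel (x : (Fin K₁ × Fin K₂) × Fin L → Fin n → ℝ) :
    Kernel (Fin K₁ × Fin K₂) (Fin n → ℝ) :=
  ⟨fun m => (uniformOn (Set.univ : Set (Fin L))).map fun l => x (m, l), measurable_of_finite _⟩

theorem isMarkovKernel_codebookKernel (hL : 0 < L) (x : (Fin K₁ × Fin K₂) × Fin L → Fin n → ℝ) :
    IsMarkovKernel (codebookKernel x) := ⟨fun m => by
  have : Nonempty (Fin L) := ⟨⟨0, hL⟩⟩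
  have : IsProbabilityMeasure (uniformOn (Set.univ : Set (Fin L))) :=
    isProbabilityMeasure_uniformOn Set.finite_univ Set.univ_nonempty
  exact Measure.isProbabilityMeasure_map (measurable_of_finite _).aemeasurable⟩

/-- The joint law of messages, codeword and noise. -/
noncomputable def codebookLaw (x : (Fin K₁ × Fin K₂) × Fin L → Fin n → ℝ) :
    Measure (((Fin K₁ × Fin K₂) × (Fin n → ℝ)) × (Fin n → ℝ)) :=
  (((uniformOn (Set.univ : Set (Fin K₁))).prod
      (uniformOn (Set.univ : Set (Fin K₂)))).compProd (codebookKernel x)).prod (iidGaussian n)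

theorem lintegral_codebookLaw (hL : 0 < L) (x : (Fin K₁ × Fin K₂) × Fin L → Fin n → ℝ)
    {F : ((Fin K₁ × Fin K₂) × (Fin n → ℝ)) × (Fin n → ℝ) → ENNReal} (hF : Measurable F) :
    ∫⁻ p, F p ∂codebookLaw x =
      (Fintype.card (Fin K₁ × Fin K₂) : ENNReal)⁻¹ * ∑ m, (Fintype.card (Fin L) : ENNReal)⁻¹ *
        ∑ l, ∫⁻ N, F ((m, x (m, l)), N) ∂iidGaussian n := by
  have := isMarkovKernel_codebookKernel hL x
  rw [codebookLaw, lintegral_prod _ hF.aemeasurable,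
    Measure.lintegral_compProd hF.lintegral_prod_right', uniformOn_univ_prod,
    lintegral_uniformOn_univ]
  congr 1
  refine Finset.sum_congr rfl fun m _ => ?_
  have hm : Measurable fun y => ∫⁻ N, F ((m, y), N) ∂iidGaussian n :=
    hF.lintegral_prod_right'.comp measurable_prodMk_left
  change ∫⁻ y, ∫⁻ N, F ((m, y), N) ∂iidGaussian n
    ∂((uniformOn (Set.univ : Set (Fin L))).map fun l => x (m, l)) = _
  rw [lintegral_map hm (measurable_of_finite _), lintegral_uniformOn_univ]

theorem isProbabilityMeasure_codebookLaw (hK₁ : 0 < K₁) (hK₂ : 0 < K₂) (hL : 0 < L)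
    (x : (Fin K₁ × Fin K₂) × Fin L → Fin n → ℝ) : IsProbabilityMeasure (codebookLaw x) := by
  have := isMarkovKernel_codebookKernel hL x
  have : Nonempty (Fin K₁) := ⟨⟨0, hK₁⟩⟩
  have : Nonempty (Fin K₂) := ⟨⟨0, hK₂⟩⟩
  have : IsProbabilityMeasure (uniformOn (Set.univ : Set (Fin K₁))) :=
    isProbabilityMeasure_uniformOn Set.finite_univ Set.univ_nonempty
  have : IsProbabilityMeasure (uniformOn (Set.univ : Set (Fin K₂))) :=
    isProbabilityMeasure_uniformOn Set.finite_univ Set.univ_nonempty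
  unfold codebookLaw
  infer_instance

theorem lintegral_codebookLaw_output (hL : 0 < L) (x : (Fin K₁ × Fin K₂) × Fin L → Fin n → ℝ)
    (b : ℝ) {F : Fin K₁ × Fin K₂ → (Fin n → ℝ) → ENNReal} (hF : ∀ m, Measurable (F m)) :
    ∫⁻ p, F p.1.1 (fun i => √b * p.1.2 i + p.2 i) ∂codebookLaw x =
      (Fintype.card (Fin K₁ × Fin K₂) : ENNReal)⁻¹ * ∑ m, (Fintype.card (Fin L) : ENNReal)⁻¹ *
        ∑ l, ∫⁻ y, F m y ∂gaussianChannel n b (x (m, l)) := by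
  have hF' : Measurable fun p : (Fin K₁ × Fin K₂) × (Fin n → ℝ) => F p.1 p.2 :=
    measurable_from_prod_countable_right hF
  have hm : Measurable fun p : ((Fin K₁ × Fin K₂) × (Fin n → ℝ)) × (Fin n → ℝ) =>
      F p.1.1 (fun i => √b * p.1.2 i + p.2 i) :=
    hF'.comp (f := fun p : ((Fin K₁ × Fin K₂) × (Fin n → ℝ)) × (Fin n → ℝ) =>
      (p.1.1, fun i => √b * p.1.2 i + p.2 i)) (by fun_prop)
  rw [lintegral_codebookLaw hL x hm]
  congr 1
  refine Finset.sum_congr rfl fun m _ => ?_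
  congr 1
  refine Finset.sum_congr rfl fun l _ => ?_
  rw [gaussianChannel, gaussianBlock, lintegral_map (hF m) (by fun_prop)]
  simp only [one_mul]

theorem mutualInfo_codebookLaw_messages_le (hK₁ : 0 < K₁) (hK₂ : 0 < K₂) (hL : 0 < L)
    (x : (Fin K₁ × Fin K₂) × Fin L → Fin n → ℝ) {b : ℝ} (hb : 0 ≤ b) (r : ℝ) :
    mutualInfo (codebookLaw x) (fun p => p.1.1) (fun p i => √b * p.1.2 i + p.2 i) ≤
      (Fintype.card (Fin K₁ × Fin K₂) : ENNReal)⁻¹ * ∑ m,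
        leakage (gaussianChannel n b) (infoDensity n b r) (fun l => x (m, l)) := by
  have : Nonempty (Fin K₁ × Fin K₂) := ⟨(⟨0, hK₁⟩, ⟨0, hK₂⟩)⟩
  have := isProbabilityMeasure_codebookLaw hK₁ hK₂ hL x
  exact (isInfoDensity_gaussian n hb r).mutualInfo_le (by fun_prop) (by fun_prop)
    (fun m l => x (m, l)) (fun F hF => lintegral_codebookLaw_output hL x b hF) ⟨⟨0, hL⟩⟩

/-- For the strong eavesdropper the low-security message is part of the randomization: conditionally
on `m₁`, the codeword is uniform over `K₂ * L` choices. -/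
theorem mutualInfo_codebookLaw_message₁_le (hK₁ : 0 < K₁) (hK₂ : 0 < K₂) (hL : 0 < L)
    (x : (Fin K₁ × Fin K₂) × Fin L → Fin n → ℝ) {b : ℝ} (hb : 0 ≤ b) (r : ℝ) :
    mutualInfo (codebookLaw x) (fun p => p.1.1.1) (fun p i => √b * p.1.2 i + p.2 i) ≤
      (Fintype.card (Fin K₁) : ENNReal)⁻¹ * ∑ m₁, leakage (gaussianChannel n b)
        (infoDensity n b r) (fun l : Fin K₂ × Fin L => x ((m₁, l.1), l.2)) := by
  have : Nonempty (Fin K₁) := ⟨⟨0, hK₁⟩⟩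
  have := isProbabilityMeasure_codebookLaw hK₁ hK₂ hL x
  refine (isInfoDensity_gaussian n hb r).mutualInfo_le (by fun_prop) (by fun_prop)
    (fun m₁ (l : Fin K₂ × Fin L) => x ((m₁, l.1), l.2)) (fun F hF => ?_) ⟨(⟨0, hK₂⟩, ⟨0, hL⟩)⟩
  rw [lintegral_codebookLaw_output hL x b (F := fun m => F m.1) fun m => hF m.1]
  simp only [Fintype.card_prod, Nat.cast_mul]
  rw [ENNReal.mul_inv (by simp) (by simp), ENNReal.mul_inv (by simp) (by simp),
    Fintype.sum_prod_type, mul_assoc, Finset.mul_sum]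
  congr 1
  refine Finset.sum_congr rfl fun m₁ _ => ?_
  rw [Fintype.sum_prod_type, ← Finset.mul_sum, mul_assoc]

theorem codebookLaw_error_le (hL : 0 < L) (x : (Fin K₁ × Fin K₂) × Fin L → Fin n → ℝ) (a r θ : ℝ)
    [Nonempty ((Fin K₁ × Fin K₂) × Fin L)] {dec : (Fin n → ℝ) → Fin K₁ × Fin K₂}
    (hdec : Measurable dec)
    (hdec' : dec = fun y => (thresholdDecoder (infoDensity n a r) θ x y).1) :
    codebookLaw x {p | dec (fun i => √a * p.1.2 i + p.2 i) ≠ p.1.1} ≤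
      (Fintype.card (Fin K₁ × Fin K₂) : ENNReal)⁻¹ * ∑ m, (Fintype.card (Fin L) : ENNReal)⁻¹ *
        ∑ l, thresholdError (gaussianChannel n a) (infoDensity n a r) θ x (m, l) := by
  have hD : ∀ m, MeasurableSet {y | dec y ≠ m} := fun m =>
    (hdec (measurableSet_singleton m)).compl
  have h := lintegral_codebookLaw_output hL x a
    (F := fun m => {y | dec y ≠ m}.indicator 1) fun m => measurable_one.indicator (hD m)
  have hS : MeasurableSet {p : ((Fin K₁ × Fin K₂) × (Fin n → ℝ)) × (Fin n → ℝ) |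
      dec (fun i => √a * p.1.2 i + p.2 i) ≠ p.1.1} :=
    (measurableSet_eq_fun (hdec.comp (by fun_prop)) (by fun_prop)).compl
  rw [← lintegral_indicator_one hS]
  refine h.le.trans ?_
  simp only [lintegral_indicator_one (hD _)]
  gcongr with m _ l _
  -- The threshold decoder also recovers the dummy index, so an error in the message pair is an
  -- error in the full index.
  refine le_trans (measure_mono fun y hy => ?_) (measure_thresholdDecoder_ne_le θ x (m, l))
  intro hy'
  apply hy
  rw [hdec']
  exact congrArg Prod.fst hy'

/-- The code given by a codebook and a decoder. -/
noncomputable def Code.ofCodebook (hK₁ : 0 < K₁) (hK₂ : 0 < K₂)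
    (hL : 0 < L) (x : (Fin K₁ × Fin K₂) × Fin L → Fin n → ℝ)
    (hx : ∀ k, (1 / (n : ℝ)) * ∑ i, (x k i) ^ 2 ≤ P) (dec : (Fin n → ℝ) → Fin K₁ × Fin K₂)
    (hdec : Measurable dec) : Code n P where
  card₁ := K₁
  card₂ := K₂
  card₁_pos := hK₁
  card₂_pos := hK₂
  enc := codebookKernel x
  isMarkov_enc := isMarkovKernel_codebookKernel hL x
  power_le m := by
    have hmeas : Measurable fun l => x (m, l) := measurable_of_finite _
    change ∀ᵐ y ∂((uniformOn (Set.univ : Set (Fin L))).map fun l => x (m, l)), _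
    rw [ae_map_iff hmeas.aemeasurable (measurableSet_le (by fun_prop) measurable_const)]
    exact ae_of_all _ fun l => hx (m, l)
  dec := dec
  measurable_dec := hdec

theorem exists_code_of_codebook (hK₁ : 0 < K₁) (hK₂ : 0 < K₂) (hL : 0 < L)
    (x : (Fin K₁ × Fin K₂) × Fin L → Fin n → ℝ) (hx : ∀ k, (1 / (n : ℝ)) * ∑ i, (x k i) ^ 2 ≤ P)
    {a b₁ b₂ : ℝ} (ha : 0 ≤ a) (hb₁ : 0 ≤ b₁) (hb₂ : 0 ≤ b₂) (r θ : ℝ) {ν : Measure (ℝ × ℝ × ℝ)}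
    (hν : IsUnitGaussianNoise ν) :
    ∃ c : Code n P, c.card₁ = K₁ ∧ c.card₂ = K₂ ∧
      c.errorProb a ν ≤ (Fintype.card (Fin K₁ × Fin K₂) : ENNReal)⁻¹ * ∑ m,
        (Fintype.card (Fin L) : ENNReal)⁻¹ *
          ∑ l, thresholdError (gaussianChannel n a) (infoDensity n a r) θ x (m, l) ∧
      mutualInfo (c.law ν) c.messages (c.outputZ₂ b₂) ≤
        (Fintype.card (Fin K₁ × Fin K₂) : ENNReal)⁻¹ * ∑ m,
          leakage (gaussianChannel n b₂) (infoDensity n b₂ r) (fun l => x (m, l)) ∧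
      mutualInfo (c.law ν) c.message₁ (c.outputZ₁ b₁) ≤
        (Fintype.card (Fin K₁) : ENNReal)⁻¹ * ∑ m₁, leakage (gaussianChannel n b₁)
          (infoDensity n b₁ r) (fun l : Fin K₂ × Fin L => x ((m₁, l.1), l.2)) := by
  have : Nonempty ((Fin K₁ × Fin K₂) × Fin L) := ⟨((⟨0, hK₁⟩, ⟨0, hK₂⟩), ⟨0, hL⟩)⟩
  have hdec : Measurable fun y => (thresholdDecoder (infoDensity n a r) θ x y).1 :=
    measurable_fst.comp ((isInfoDensity_gaussian n ha r).measurable_thresholdDecoder θ x)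
  refine ⟨Code.ofCodebook hK₁ hK₂ hL x hx _ hdec, rfl, rfl, ?_, ?_, ?_⟩
  · rw [Code.errorProb_eq _ hν]
    exact codebookLaw_error_le hL x a r θ hdec rfl
  · rw [Code.mutualInfo_messages_outputZ₂ _ hν]
    exact mutualInfo_codebookLaw_messages_le hK₁ hK₂ hL x hb₂ r
  · rw [Code.mutualInfo_message₁_outputZ₁ _ hν]
    exact mutualInfo_codebookLaw_message₁_le hK₁ hK₂ hL x hb₁ r

end Codebook

/-! ### Selection of a good codebook. -/

theorem IsInfoDensity.measurable_thresholdError {X Y : Type*} [MeasurableSpace X]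
    [MeasurableSpace Y] {μ : Measure X} {Q : Measure Y} {W : X → Measure Y} {ι : X → Y → ℝ}
    [SFinite Q] (h : IsInfoDensity μ Q W ι) {I : Type*} [Fintype I] [DecidableEq I] (θ : ℝ)
    (k : I) : Measurable fun x : I → X => thresholdError W ι θ x k := by
  have hι : ∀ j, Measurable fun p : (I → X) × Y => ι (p.1 j) p.2 := fun j =>
    h.measurable_comp (u := fun p : (I → X) × Y => p.1 j)
      ((measurable_pi_apply j).comp measurable_fst) measurable_snd
  refine Measurable.add ?_ (Finset.measurable_fun_sum _ fun j _ => ?_)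
  · exact h.measurable_measure_of_pair (u := fun x : I → X => x k) (measurable_pi_apply k)
      (measurableSet_le (hι k) measurable_const)
  · exact h.measurable_measure_of_pair (u := fun x : I → X => x k) (measurable_pi_apply k)
      (measurableSet_lt measurable_const (hι j))

/-- Conditioning on an event of probability at least one half at most doubles the measure. Codewords
can thus satisfy the power constraint surely while expectations are still computed under the
Gaussian law. -/
theorem cond_le_two_smul {X : Type*} [MeasurableSpace X] {μ : Measure X} [IsProbabilityMeasure μ]
    {A : Set X} (hA : MeasurableSet A) (h : μ Aᶜ ≤ 2⁻¹) :
    IsProbabilityMeasure (cond μ A) ∧ cond μ A ≤ (2 : ENNReal) • μ := by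
  have h1 : (2 : ENNReal)⁻¹ ≤ μ A := by
    rw [prob_compl_eq_one_sub hA, tsub_le_iff_right] at h
    have h2 : (2 : ENNReal)⁻¹ + 2⁻¹ ≤ 2⁻¹ + μ A := by rwa [ENNReal.inv_two_add_inv_two]
    exact (ENNReal.add_le_add_iff_left (by simp)).1 h2
  refine ⟨cond_isProbabilityMeasure fun h0 => by simp [h0] at h1, ?_⟩
  rw [ProbabilityTheory.cond]
  refine Measure.le_iff.2 fun s _ => ?_
  simp only [Measure.smul_apply, smul_eq_mul]
  gcongr
  · exact ENNReal.inv_le_iff_inv_le.1 h1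
  · exact Measure.restrict_le_self

theorem inv_card_mul_sum_le {I : Type*} [Fintype I] {f : I → ENNReal} {B : ENNReal}
    (h : ∀ i, f i ≤ B) : (Fintype.card I : ENNReal)⁻¹ * ∑ i, f i ≤ B := by
  calc (Fintype.card I : ENNReal)⁻¹ * ∑ i, f i ≤ (Fintype.card I : ENNReal)⁻¹ * ∑ _i : I, B := by
        gcongr with i; exact h i
    _ = (Fintype.card I : ENNReal)⁻¹ * Fintype.card I * B := by
        rw [Finset.sum_const, Finset.card_univ, nsmul_eq_mul, mul_assoc]
    _ ≤ 1 * B := by gcongr; rw [mul_comm]; exact ENNReal.mul_inv_le_one _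
    _ = B := one_mul B

theorem lintegral_inv_card_mul_sum_le {Ω I : Type*} [MeasurableSpace Ω] {m : Measure Ω} [Fintype I]
    {f : I → Ω → ENNReal} (hf : ∀ i, Measurable (f i)) {B : ENNReal}
    (h : ∀ i, ∫⁻ w, f i w ∂m ≤ B) :
    ∫⁻ w, (Fintype.card I : ENNReal)⁻¹ * ∑ i, f i w ∂m ≤ B := by
  rw [lintegral_const_mul _ (Finset.measurable_fun_sum _ fun i _ => hf i),
    lintegral_finsetSum _ fun i _ => hf i]
  exact inv_card_mul_sum_le h

theorem exists_add_le_lintegral {Ω : Type*} [MeasurableSpace Ω] {m : Measure Ω}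
    [IsProbabilityMeasure m] {f₁ f₂ f₃ : Ω → ENNReal} (w₁ w₂ : ENNReal) (h₁ : Measurable f₁)
    (h₂ : Measurable f₂) (h₃ : Measurable f₃) {p : Ω → Prop} (hp : ∀ᵐ x ∂m, p x) :
    ∃ x, p x ∧ f₁ x + w₂ * f₂ x + w₁ * f₃ x ≤
      ∫⁻ x, f₁ x ∂m + w₂ * ∫⁻ x, f₂ x ∂m + w₁ * ∫⁻ x, f₃ x ∂m := by
  have h₁₂ : Measurable fun x => f₁ x + w₂ * f₂ x := h₁.add (h₂.const_mul w₂)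
  have hf : Measurable fun x => f₁ x + w₂ * f₂ x + w₁ * f₃ x := h₁₂.add (h₃.const_mul w₁)
  obtain ⟨x, hx, hxle⟩ := exists_notMem_null_le_lintegral (μ := m) hf.aemeasurable hp
  rw [lintegral_add_left h₁₂, lintegral_add_left h₁, lintegral_const_mul _ h₂,
    lintegral_const_mul _ h₃] at hxle
  exact ⟨x, not_not.1 hx, hxle⟩

/-- One codebook must be good for three criteria at once, so a weighted sum of them is averaged. The
constants 2 are the domination constant of the conditioned input law. -/
theorem exists_codebook {n K₁ K₂ L : ℕ} (hK₂ : 0 < K₂) (hL : 0 < L)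
    {a b₁ b₂ P r : ℝ} (ha : 0 ≤ a) (hb₁ : 0 ≤ b₁) (hb₂ : 0 ≤ b₂) (θ : ℝ) (w₁ w₂ : ENNReal)
    (hP : gaussianBlock (0 : Fin n → ℝ) r {x | (1 / (n : ℝ)) * ∑ i, x i ^ 2 ≤ P}ᶜ ≤ 2⁻¹)
    {E A₁ A₂ : ENNReal}
    (hE : ∫⁻ u, gaussianChannel n a u {y | infoDensity n a r u y ≤ θ}
      ∂(gaussianBlock (0 : Fin n → ℝ) r) ≤ E)
    (hA₁ : ∫⁻ u, ∫⁻ y, ENNReal.ofReal (Real.log (1 + ((K₂ * L : ℕ) : ℝ)⁻¹ *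
      Real.exp (infoDensity n b₁ r u y))) ∂gaussianChannel n b₁ u
      ∂(gaussianBlock (0 : Fin n → ℝ) r) ≤ A₁)
    (hA₂ : ∫⁻ u, ∫⁻ y, ENNReal.ofReal (Real.log (1 + (L : ℝ)⁻¹ *
      Real.exp (infoDensity n b₂ r u y))) ∂gaussianChannel n b₂ u
      ∂(gaussianBlock (0 : Fin n → ℝ) r) ≤ A₂) :
    ∃ x : (Fin K₁ × Fin K₂) × Fin L → Fin n → ℝ, (∀ k, (1 / (n : ℝ)) * ∑ i, (x k i) ^ 2 ≤ P) ∧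
      (Fintype.card (Fin K₁ × Fin K₂) : ENNReal)⁻¹ * ∑ m, (Fintype.card (Fin L) : ENNReal)⁻¹ *
          ∑ l, thresholdError (gaussianChannel n a) (infoDensity n a r) θ x (m, l) +
      w₂ * ((Fintype.card (Fin K₁ × Fin K₂) : ENNReal)⁻¹ * ∑ m,
          leakage (gaussianChannel n b₂) (infoDensity n b₂ r) (fun l => x (m, l))) +
      w₁ * ((Fintype.card (Fin K₁) : ENNReal)⁻¹ * ∑ m₁, leakage (gaussianChannel n b₁)
          (infoDensity n b₁ r) (fun l : Fin K₂ × Fin L => x ((m₁, l.1), l.2))) ≤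
      (2 * E + (K₁ * K₂ * L : ℕ) * (2 * (2 * ENNReal.ofReal (Real.exp (-θ))))) +
        w₂ * (1 + (2 * A₂ + 2 * 2)) + w₁ * (1 + (2 * A₁ + 2 * 2)) := by
  have hS : MeasurableSet {x : Fin n → ℝ | (1 / (n : ℝ)) * ∑ i, x i ^ 2 ≤ P} :=
    measurableSet_le (by fun_prop) measurable_const
  obtain ⟨hprob, hle⟩ := cond_le_two_smul hS hP
  set μ' := cond (gaussianBlock (0 : Fin n → ℝ) r) {x | (1 / (n : ℝ)) * ∑ i, x i ^ 2 ≤ P}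
  have : Nonempty (Fin L) := ⟨⟨0, hL⟩⟩
  have : Nonempty (Fin K₂) := ⟨⟨0, hK₂⟩⟩
  have hia := isInfoDensity_gaussian n ha r
  have hi₁ := isInfoDensity_gaussian n hb₁ r
  have hi₂ := isInfoDensity_gaussian n hb₂ r
  set 𝒞 := Measure.pi fun _ : (Fin K₁ × Fin K₂) × Fin L => μ'
  have hTm := fun k => hia.measurable_thresholdError (I := (Fin K₁ × Fin K₂) × Fin L) θ k
  have hL₂m := fun m : Fin K₁ × Fin K₂ => hi₂.measurable_leakage
    (e := fun l : Fin L => (m, l))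
  have hL₁m := fun m₁ : Fin K₁ => hi₁.measurable_leakage
    (e := fun l : Fin K₂ × Fin L => ((m₁, l.1), l.2))
  have hT : ∀ k, ∫⁻ x, thresholdError (gaussianChannel n a) (infoDensity n a r) θ x k ∂𝒞 ≤
      2 * E + (K₁ * K₂ * L : ℕ) * (2 * (2 * ENNReal.ofReal (Real.exp (-θ)))) := fun k => by
    refine (hia.lintegral_thresholdError_le hle θ k).trans ?_
    simp only [Fintype.card_prod, Fintype.card_fin]
    gcongr
  have hL₂ : ∀ m : Fin K₁ × Fin K₂, ∫⁻ x, leakage (gaussianChannel n b₂) (infoDensity n b₂ r)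
      (fun l => x (m, l)) ∂𝒞 ≤ 1 + (2 * A₂ + 2 * 2) := fun m => by
    refine (hi₂.lintegral_leakage_le hle (e := fun l : Fin L => (m, l))
      fun l l' h => (Prod.mk.inj h).2).trans ?_
    simp only [Fintype.card_fin]
    gcongr
  have hL₁ : ∀ m₁ : Fin K₁, ∫⁻ x, leakage (gaussianChannel n b₁) (infoDensity n b₁ r)
      (fun l : Fin K₂ × Fin L => x ((m₁, l.1), l.2)) ∂𝒞 ≤ 1 + (2 * A₁ + 2 * 2) := fun m₁ => by
    refine (hi₁.lintegral_leakage_le hle (e := fun l : Fin K₂ × Fin L => ((m₁, l.1), l.2))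
      fun l l' h => ?_).trans ?_
    · simp only [Prod.mk.injEq, true_and] at h
      exact Prod.ext h.1 h.2
    · simp only [Fintype.card_prod, Fintype.card_fin]
      gcongr
  have hf1 : Measurable fun x : (Fin K₁ × Fin K₂) × Fin L → Fin n → ℝ =>
      (Fintype.card (Fin K₁ × Fin K₂) : ENNReal)⁻¹ * ∑ m, (Fintype.card (Fin L) : ENNReal)⁻¹ *
          ∑ l, thresholdError (gaussianChannel n a) (infoDensity n a r) θ x (m, l) :=
    (Finset.measurable_fun_sum _ fun m _ =>
      (Finset.measurable_fun_sum _ fun l _ => hTm (m, l)).const_mul _).const_mul _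
  have hf2 : Measurable fun x : (Fin K₁ × Fin K₂) × Fin L → Fin n → ℝ =>
      (Fintype.card (Fin K₁ × Fin K₂) : ENNReal)⁻¹ * ∑ m,
          leakage (gaussianChannel n b₂) (infoDensity n b₂ r) (fun l => x (m, l)) :=
    (Finset.measurable_fun_sum _ fun m _ => hL₂m m).const_mul _
  have hf3 : Measurable fun x : (Fin K₁ × Fin K₂) × Fin L → Fin n → ℝ =>
      (Fintype.card (Fin K₁) : ENNReal)⁻¹ * ∑ m₁, leakage (gaussianChannel n b₁)
          (infoDensity n b₁ r) (fun l : Fin K₂ × Fin L => x ((m₁, l.1), l.2)) :=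
    (Finset.measurable_fun_sum _ fun m _ => hL₁m m).const_mul _
  have hint1 := lintegral_inv_card_mul_sum_le (m := 𝒞) (fun m : Fin K₁ × Fin K₂ =>
    (Finset.measurable_fun_sum _ fun l _ => hTm (m, l)).const_mul
      (Fintype.card (Fin L) : ENNReal)⁻¹) fun m =>
      lintegral_inv_card_mul_sum_le (m := 𝒞) (fun l : Fin L => hTm (m, l)) fun l => hT (m, l)
  have hint2 := lintegral_inv_card_mul_sum_le (m := 𝒞) hL₂m hL₂
  have hint3 := lintegral_inv_card_mul_sum_le (m := 𝒞) hL₁m hL₁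
  have hae : ∀ᵐ x ∂𝒞, ∀ k, (1 / (n : ℝ)) * ∑ i, (x k i) ^ 2 ≤ P := by
    refine ae_all_iff.2 fun k => ?_
    have h0 : ∀ᵐ u ∂μ', (1 / (n : ℝ)) * ∑ i, (u i) ^ 2 ≤ P := ae_cond_mem hS
    exact (measurePreserving_eval (fun _ : (Fin K₁ × Fin K₂) × Fin L => μ') k).quasiMeasurePreserving.ae h0
  obtain ⟨x, hx, hxle⟩ := exists_add_le_lintegral w₁ w₂ hf1 hf2 hf3 hae
  refine ⟨x, hx, hxle.trans ?_⟩
  gcongr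

/-! ### Trivial message sets. -/

theorem mutualInfo_eq_zero_of_subsingleton {Ω α β : Type*} [MeasurableSpace Ω] [MeasurableSpace α]
    [MeasurableSpace β] [Subsingleton α] (μ : Measure Ω) [IsProbabilityMeasure μ] (U : Ω → α)
    {V : Ω → β} (hV : Measurable V) : mutualInfo μ U V = 0 := by
  obtain ⟨ω₀⟩ := nonempty_of_isProbabilityMeasure μ
  have hU : U = fun _ => U ω₀ := funext fun ω => Subsingleton.elim _ _
  have := Measure.isProbabilityMeasure_map (μ := μ) hV.aemeasurable
  have h : μ.map (fun ω => (U ω₀, V ω)) = (μ.map fun _ => U ω₀).prod (μ.map V) := by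
    rw [Measure.map_const, measure_univ, one_smul, Measure.dirac_prod,
      Measure.map_map measurable_prodMk_left hV]
    rfl
  rw [mutualInfo, hU, h]
  have := Measure.isProbabilityMeasure_map (μ := μ) (f := fun _ => U ω₀)
    measurable_const.aemeasurable
  exact InformationTheory.klDiv_self _

theorem Code.isProbabilityMeasure_law {n : ℕ} {P : ℝ} (c : Code n P) {ν : Measure (ℝ × ℝ × ℝ)}
    (hν : IsUnitGaussianNoise ν) : IsProbabilityMeasure (c.law ν) := by
  have := hν.isProbabilityMeasure
  have := c.isMarkov_enc
  have : Nonempty (Fin c.card₁) := ⟨⟨0, c.card₁_pos⟩⟩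
  have : Nonempty (Fin c.card₂) := ⟨⟨0, c.card₂_pos⟩⟩
  have : IsProbabilityMeasure (uniformOn (Set.univ : Set (Fin c.card₁))) :=
    isProbabilityMeasure_uniformOn Set.finite_univ Set.univ_nonempty
  have : IsProbabilityMeasure (uniformOn (Set.univ : Set (Fin c.card₂))) :=
    isProbabilityMeasure_uniformOn Set.finite_univ Set.univ_nonempty
  unfold Code.law
  infer_instance

theorem Code.mutualInfo_message₁_eq_zero {n : ℕ} {P : ℝ} (c : Code n P) (hc : c.card₁ = 1)
    {ν : Measure (ℝ × ℝ × ℝ)} (hν : IsUnitGaussianNoise ν) (b : ℝ) :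
    mutualInfo (c.law ν) c.message₁ (c.outputZ₁ b) = 0 := by
  have := c.isProbabilityMeasure_law hν
  have : Subsingleton (Fin c.card₁) := by rw [hc]; infer_instance
  exact mutualInfo_eq_zero_of_subsingleton _ _ (by unfold Code.outputZ₁; fun_prop)

theorem Code.mutualInfo_messages_eq_zero {n : ℕ} {P : ℝ} (c : Code n P) (hc₁ : c.card₁ = 1)
    (hc₂ : c.card₂ = 1) {ν : Measure (ℝ × ℝ × ℝ)} (hν : IsUnitGaussianNoise ν) (b : ℝ) :
    mutualInfo (c.law ν) c.messages (c.outputZ₂ b) = 0 := by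
  have := c.isProbabilityMeasure_law hν
  have : Subsingleton (Fin c.card₁) := by rw [hc₁]; infer_instance
  have : Subsingleton (Fin c.card₂) := by rw [hc₂]; infer_instance
  exact mutualInfo_eq_zero_of_subsingleton _ _ (by unfold Code.outputZ₂; fun_prop)

theorem Code.errorProb_eq_zero {n : ℕ} {P : ℝ} (c : Code n P) (hc₁ : c.card₁ = 1)
    (hc₂ : c.card₂ = 1) (ν : Measure (ℝ × ℝ × ℝ)) (a : ℝ) : c.errorProb a ν = 0 := by
  have : Subsingleton (Fin c.card₁) := by rw [hc₁]; infer_instance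
  have : Subsingleton (Fin c.card₂) := by rw [hc₂]; infer_instance
  rw [Code.errorProb]
  exact measure_mono_null (t := ∅) (fun ω h => h (Subsingleton.elim _ _)) measure_empty

/-- The code with one message pair that always sends the zero block. -/
noncomputable def Code.trivial (n : ℕ) {P : ℝ} (hP : 0 ≤ P) : Code n P :=
  Code.ofCodebook one_pos one_pos one_pos (fun _ _ => 0) (by simpa using hP) (fun _ => 0)
    measurable_const

/-! ### Asymptotics of the random coding bounds. -/

/-- The bound on the normalized expected leakage of a random codebook whose rate falls short of
the resolvability rate by `ε`. -/
noncomputable def leakageBound (n : ℕ) (ε v : ℝ) : ℝ :=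
  (n : ℝ)⁻¹ * (1 + (2 * (1 + (n * ε + 2) + √n / 2 + (2 * √n)⁻¹ * (n * v)) + 4))

theorem leakageBound_nonneg (n : ℕ) {ε v : ℝ} (hε : 0 ≤ ε) (hv : 0 ≤ v) :
    0 ≤ leakageBound n ε v := by
  unfold leakageBound; positivity

theorem tendsto_leakageBound (ε v : ℝ) :
    Tendsto (fun n : ℕ => leakageBound n ε v) atTop (𝓝 (2 * ε)) := by
  have h1 : Tendsto (fun n : ℕ => (n : ℝ)⁻¹) atTop (𝓝 0) := tendsto_inv_atTop_nhds_zero_nat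
  have h2 : Tendsto (fun n : ℕ => (√(n : ℝ))⁻¹) atTop (𝓝 0) :=
    tendsto_inv_atTop_zero.comp (Real.tendsto_sqrt_atTop.comp tendsto_natCast_atTop_atTop)
  have h3 : Tendsto (fun n : ℕ => 2 * ε + 11 * (n : ℝ)⁻¹ + (1 + v) * (√(n : ℝ))⁻¹) atTop
      (𝓝 (2 * ε + 11 * 0 + (1 + v) * 0)) :=
    (tendsto_const_nhds.add (h1.const_mul 11)).add (h2.const_mul (1 + v))
  rw [mul_zero, mul_zero, add_zero, add_zero] at h3
  refine h3.congr' ?_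
  filter_upwards [eventually_gt_atTop 0] with n hn
  have hn' : (0 : ℝ) < √n := Real.sqrt_pos.2 (by exact_mod_cast hn)
  have hsq : (n : ℝ) = √n ^ 2 := (Real.sq_sqrt (Nat.cast_nonneg n)).symm
  rw [leakageBound]
  generalize √(n : ℝ) = t at *
  rw [hsq]
  field_simp
  ring

/-- The bound on the error probability of a random codebook whose rate is `2δ` below capacity. -/
noncomputable def errorBound (n : ℕ) (δ v : ℝ) : ℝ :=
  2 * (n * v / (n * δ) ^ 2) + 4 * Real.exp (-(n * δ))

theorem errorBound_nonneg (n : ℕ) (δ : ℝ) {v : ℝ} (hv : 0 ≤ v) : 0 ≤ errorBound n δ v := by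
  unfold errorBound; positivity

theorem tendsto_errorBound {δ : ℝ} (hδ : 0 < δ) (v : ℝ) :
    Tendsto (fun n : ℕ => errorBound n δ v) atTop (𝓝 0) := by
  have h1 : Tendsto (fun n : ℕ => (n : ℝ)⁻¹) atTop (𝓝 0) := tendsto_inv_atTop_nhds_zero_nat
  have h2 : Tendsto (fun n : ℕ => Real.exp (-(n * δ))) atTop (𝓝 0) :=
    Real.tendsto_exp_neg_atTop_nhds_zero.comp (tendsto_natCast_atTop_atTop.atTop_mul_const hδ)
  have h3 := (h1.const_mul (2 * v / δ ^ 2)).add (h2.const_mul 4)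
  rw [mul_zero, mul_zero, add_zero] at h3
  refine h3.congr' ?_
  filter_upwards [eventually_gt_atTop 0] with n hn
  have hn' : (0 : ℝ) < n := by exact_mod_cast hn
  rw [errorBound]
  field_simp

theorem ofReal_leakageBound {n : ℕ} {ε v : ℝ} (hε : 0 ≤ ε) (hv : 0 ≤ v) :
    ENNReal.ofReal (n : ℝ)⁻¹ * (1 + (2 * ENNReal.ofReal
      (1 + (n * ε + 2) + √n / 2 + (2 * √n)⁻¹ * (n * v)) + 2 * 2)) =
      ENNReal.ofReal (leakageBound n ε v) := by
  have h : 0 ≤ 1 + (n * ε + 2) + √n / 2 + (2 * √n)⁻¹ * (n * v) := by positivity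
  rw [leakageBound]
  generalize 1 + (n * ε + 2) + √n / 2 + (2 * √n)⁻¹ * (n * v) = t at *
  rw [ENNReal.ofReal_mul (by positivity), ENNReal.ofReal_add zero_le_one
    (by positivity), ENNReal.ofReal_one, ENNReal.ofReal_add (by positivity) (by positivity),
    ENNReal.ofReal_mul zero_le_two, ENNReal.ofReal_ofNat, ENNReal.ofReal_ofNat]
  norm_num

theorem le_ofReal_errorBound {n K : ℕ} {C δ v : ℝ} (hv : 0 ≤ v)
    (hK : (K : ℝ) ≤ Real.exp (n * (C - 2 * δ))) :
    2 * ENNReal.ofReal (n * v / (n * δ) ^ 2) +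
      K * (2 * (2 * ENNReal.ofReal (Real.exp (-(n * C - n * δ))))) ≤
      ENNReal.ofReal (errorBound n δ v) := by
  rw [errorBound, ENNReal.ofReal_add (by positivity) (by positivity),
    ENNReal.ofReal_mul zero_le_two, ENNReal.ofReal_ofNat]
  gcongr
  rw [← ENNReal.ofReal_natCast, ← ENNReal.ofReal_ofNat 2, ← ENNReal.ofReal_mul zero_le_two,
    ← ENNReal.ofReal_mul zero_le_two, ← ENNReal.ofReal_mul (Nat.cast_nonneg K)]
  refine ENNReal.ofReal_le_ofReal ?_
  calc (K : ℝ) * (2 * (2 * Real.exp (-(n * C - n * δ))))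
      ≤ Real.exp (n * (C - 2 * δ)) * (2 * (2 * Real.exp (-(n * C - n * δ)))) := by gcongr
    _ = 4 * (Real.exp (n * (C - 2 * δ)) * Real.exp (-(n * C - n * δ))) := by ring
    _ = 4 * Real.exp (-(n * δ)) := by rw [← Real.exp_add]; ring_nf

theorem exists_code_le {n K₁ K₂ L : ℕ} (hn : 0 < n) (hK₁ : 0 < K₁) (hK₂ : 0 < K₂) (hL : 0 < L)
    {P a b₁ b₂ r δ ε : ℝ} (ha : 0 ≤ a) (hb₁ : 0 ≤ b₁) (hb₂ : 0 ≤ b₂) {ν : Measure (ℝ × ℝ × ℝ)}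
    (hν : IsUnitGaussianNoise ν) (hδ : 0 < δ) (hε : 0 ≤ ε)
    (hP : gaussianBlock (0 : Fin n → ℝ) r {x | (1 / (n : ℝ)) * ∑ i, x i ^ 2 ≤ P}ᶜ ≤ 2⁻¹)
    (hKa : ((K₁ * K₂ * L : ℕ) : ℝ) ≤ Real.exp (n * (1 / 2 * Real.log (1 + a * r ^ 2) - 2 * δ)))
    (hKb₂ : n * (1 / 2 * Real.log (1 + b₂ * r ^ 2)) - Real.log L ≤ n * ε + 2)
    (hKb₁ : K₁ = 1 ∨
      n * (1 / 2 * Real.log (1 + b₁ * r ^ 2)) - Real.log (K₂ * L : ℕ) ≤ n * ε + 2) :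
    ∃ c : Code n P, c.card₁ = K₁ ∧ c.card₂ = K₂ ∧
      c.errorProb a ν + mutualInfo (c.law ν) c.messages (c.outputZ₂ b₂) / (n : ENNReal) +
        mutualInfo (c.law ν) c.message₁ (c.outputZ₁ b₁) / (n : ENNReal) ≤
      ENNReal.ofReal (errorBound n δ (dispersion a r) + leakageBound n ε (dispersion b₂ r) +
        leakageBound n ε (dispersion b₁ r)) := by
  have hn' : (0 : ℝ) < n := by exact_mod_cast hn
  have hw : ENNReal.ofReal (n : ℝ)⁻¹ = (n : ENNReal)⁻¹ := by
    rw [ENNReal.ofReal_inv_of_pos hn', ENNReal.ofReal_natCast]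
  have hs : 0 < √(n : ℝ) := Real.sqrt_pos.2 hn'
  have hva := dispersion_nonneg a r
  have hv₁ := dispersion_nonneg b₁ r
  have hv₂ := dispersion_nonneg b₂ r
  have hE := (isInfoDensity_gaussian n ha r).lintegral_measure_le_le (δ := n * δ)
    (lintegral_infoDensity_sq n ha r).le (by positivity)
  have hA₂ := (isInfoDensity_gaussian n hb₂ r).lintegral_log_le (K := L)
    (lintegral_infoDensity_sq n hb₂ r).le (mul_nonneg hn'.le hv₂) (by exact_mod_cast hL)
    (by positivity) hKb₂ hs
  rw [ENNReal.ofReal_add (add_nonneg (errorBound_nonneg n δ hva) (leakageBound_nonneg n hε hv₂))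
      (leakageBound_nonneg n hε hv₁),
    ENNReal.ofReal_add (errorBound_nonneg n δ hva) (leakageBound_nonneg n hε hv₂),
    ← ofReal_leakageBound hε hv₁, ← ofReal_leakageBound hε hv₂]
  rcases hKb₁ with rfl | hKb₁
  -- With a single high-security message nothing can leak to `Z₁`, however strong that receiver is;
  -- its criterion gets weight 0 and the bound `⊤`.
  · obtain ⟨x, hx, hxle⟩ := exists_codebook (K₁ := 1) hK₂ hL ha hb₁ hb₂ _ 0
      (ENNReal.ofReal (n : ℝ)⁻¹) hP hE le_top hA₂
    obtain ⟨c, h₁, h₂, herr, hI₂, -⟩ := exists_code_of_codebook one_pos hK₂ hL x hx ha hb₁ hb₂ r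
      (n * (1 / 2 * Real.log (1 + a * r ^ 2)) - n * δ) hν
    refine ⟨c, h₁, h₂, ?_⟩
    rw [c.mutualInfo_message₁_eq_zero h₁ hν, ENNReal.zero_div, add_zero]
    rw [zero_mul, zero_mul, add_zero, add_zero] at hxle
    refine (add_le_add herr ?_).trans (hxle.trans ?_)
    · rw [ENNReal.div_eq_inv_mul, hw]
      gcongr
    · refine le_trans ?_ le_self_add
      exact add_le_add (le_ofReal_errorBound hva hKa) le_rfl
  · have hA₁ := (isInfoDensity_gaussian n hb₁ r).lintegral_log_le (K := (K₂ * L : ℕ))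
      (lintegral_infoDensity_sq n hb₁ r).le (mul_nonneg hn'.le hv₁)
      (by exact_mod_cast Nat.mul_pos hK₂ hL) (by positivity) hKb₁ hs
    obtain ⟨x, hx, hxle⟩ := exists_codebook (K₁ := K₁) hK₂ hL ha hb₁ hb₂ _
      (ENNReal.ofReal (n : ℝ)⁻¹) (ENNReal.ofReal (n : ℝ)⁻¹) hP hE hA₁ hA₂
    obtain ⟨c, h₁, h₂, herr, hI₂, hI₁⟩ := exists_code_of_codebook hK₁ hK₂ hL x hx ha hb₁ hb₂ r
      (n * (1 / 2 * Real.log (1 + a * r ^ 2)) - n * δ) hν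
    refine ⟨c, h₁, h₂, ?_⟩
    refine (add_le_add (add_le_add herr ?_) ?_).trans (hxle.trans ?_)
    · rw [ENNReal.div_eq_inv_mul, hw]
      gcongr
    · rw [ENNReal.div_eq_inv_mul, hw]
      gcongr
    · exact add_le_add (add_le_add (le_ofReal_errorBound hva hKa) le_rfl) le_rfl

theorem one_le_exp_floor {t : ℝ} (ht : 0 ≤ t) : 1 ≤ ⌊Real.exp t⌋₊ :=
  Nat.le_floor (by simpa using ht)

/-- Since the floor is at least 1, `exp t` is less than twice the floor, and `2 ≤ e`. Each rounding
costs at most one nat, so the slack 2 covers the product of two floors. -/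
theorem sub_one_le_log_floor_exp {t : ℝ} (ht : 0 ≤ t) : t - 1 ≤ Real.log ⌊Real.exp t⌋₊ := by
  have h1 : (1 : ℝ) ≤ ⌊Real.exp t⌋₊ := by exact_mod_cast one_le_exp_floor ht
  have h2 := Nat.lt_floor_add_one (Real.exp t)
  rw [Real.le_log_iff_exp_le (by linarith), Real.exp_sub, div_le_iff₀ (Real.exp_pos 1)]
  have h3 := Real.add_one_le_exp (1 : ℝ)
  nlinarith

theorem log_floor_exp_le {t : ℝ} (ht : 0 ≤ t) : Real.log ⌊Real.exp t⌋₊ ≤ t := by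
  have h1 : (1 : ℝ) ≤ ⌊Real.exp t⌋₊ := by exact_mod_cast one_le_exp_floor ht
  rw [Real.log_le_iff_le_exp (by linarith)]
  exact Nat.floor_le (Real.exp_pos t).le

theorem abs_logb_floor_exp_div_sub_le {n : ℕ} (hn : 0 < n) {R κ : ℝ} (hR : 0 ≤ R) (hκ : 0 ≤ κ)
    (hκ1 : κ ≤ 1) :
    |Real.logb 2 ⌊Real.exp (n * ((1 - κ) * (R * Real.log 2)))⌋₊ / n - R| ≤
      κ * R + (Real.log 2)⁻¹ * (n : ℝ)⁻¹ := by
  have hn' : (0 : ℝ) < n := by exact_mod_cast hn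
  have h2 : 0 < Real.log 2 := Real.log_pos one_lt_two
  have ht : 0 ≤ (n : ℝ) * ((1 - κ) * (R * Real.log 2)) := by
    have : 0 ≤ 1 - κ := by linarith
    positivity
  have hlo := sub_one_le_log_floor_exp ht
  have hup := log_floor_exp_le ht
  set K : ℝ := ((⌊Real.exp (n * ((1 - κ) * (R * Real.log 2)))⌋₊ : ℕ) : ℝ)
  have he : Real.logb 2 K / n - R =
      (Real.log K - n * ((1 - κ) * (R * Real.log 2))) * ((Real.log 2)⁻¹ * (n : ℝ)⁻¹) - κ * R := by
    rw [Real.logb]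
    field_simp
    ring
  have hc : 0 < (Real.log 2)⁻¹ * (n : ℝ)⁻¹ := by positivity
  have hκR : 0 ≤ κ * R := by positivity
  rw [he, abs_le]
  constructor
  · nlinarith
  · nlinarith

theorem eventually_power_compl_le {r P : ℝ} (hr : r ^ 2 < P) :
    ∀ᶠ n : ℕ in atTop, gaussianBlock (0 : Fin n → ℝ) r
      {x | (1 / (n : ℝ)) * ∑ i, x i ^ 2 ≤ P}ᶜ ≤ 2⁻¹ := by
  set v := Var[fun x : ℝ => (r * x) ^ 2 - r ^ 2; gaussianReal 0 1]
  have h : Tendsto (fun n : ℕ => v / (n * (P - r ^ 2) ^ 2)) atTop (𝓝 0) :=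
    tendsto_const_nhds.div_atTop (tendsto_natCast_atTop_atTop.atTop_mul_const
      (pow_pos (sub_pos.2 hr) 2))
  filter_upwards [h.eventually_le_const (show (0 : ℝ) < 2⁻¹ by norm_num),
    eventually_gt_atTop 0] with n hn hn0
  refine (gaussianBlock_power_compl_le hn0 hr).trans ((ENNReal.ofReal_le_ofReal hn).trans ?_)
  rw [ENNReal.ofReal_inv_of_pos two_pos, ENNReal.ofReal_ofNat]

/-- Random coding: `ρ₁`, `ρ₂` are the rates of the two messages and `ρ'` that of the randomization,
in nats. -/
theorem eventually_exists_code {P a b₁ b₂ r ρ₁ ρ₂ ρ' ε η : ℝ} (ha : 0 ≤ a) (hb₁ : 0 ≤ b₁)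
    (hb₂ : 0 ≤ b₂) {ν : Measure (ℝ × ℝ × ℝ)} (hν : IsUnitGaussianNoise ν) (hr : r ^ 2 < P)
    (hρ₁ : 0 ≤ ρ₁) (hρ₂ : 0 ≤ ρ₂) (hρ' : 0 ≤ ρ') (hε : 0 ≤ ε) (hη : 4 * ε < η)
    (hCa : ρ₁ + ρ₂ + ρ' < 1 / 2 * Real.log (1 + a * r ^ 2))
    (hCb₂ : 1 / 2 * Real.log (1 + b₂ * r ^ 2) ≤ ρ' + ε)
    (hCb₁ : ρ₁ = 0 ∨ 1 / 2 * Real.log (1 + b₁ * r ^ 2) ≤ ρ₂ + ρ' + ε) :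
    ∀ᶠ n : ℕ in atTop, ∃ c : Code n P, c.card₁ = ⌊Real.exp (n * ρ₁)⌋₊ ∧
      c.card₂ = ⌊Real.exp (n * ρ₂)⌋₊ ∧
      c.errorProb a ν + mutualInfo (c.law ν) c.messages (c.outputZ₂ b₂) / (n : ENNReal) +
        mutualInfo (c.law ν) c.message₁ (c.outputZ₁ b₁) / (n : ENNReal) ≤ ENNReal.ofReal η := by
  -- Half of the gap to capacity goes to the decoding threshold, the other half to the union bound.
  obtain ⟨δ, hδ, hδC⟩ : ∃ δ > 0, ρ₁ + ρ₂ + ρ' = 1 / 2 * Real.log (1 + a * r ^ 2) - 2 * δ :=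
    ⟨(1 / 2 * Real.log (1 + a * r ^ 2) - (ρ₁ + ρ₂ + ρ')) / 2, by linarith, by ring⟩
  have hlim := ((tendsto_errorBound hδ (dispersion a r)).add
    (tendsto_leakageBound ε (dispersion b₂ r))).add (tendsto_leakageBound ε (dispersion b₁ r))
  filter_upwards [hlim.eventually_le_const (show 0 + 2 * ε + 2 * ε < η by linarith),
    eventually_gt_atTop 0, eventually_power_compl_le hr] with n hle hn hpow
  have hn' : (0 : ℝ) < n := by exact_mod_cast hn
  have ht₁ : 0 ≤ n * ρ₁ := by positivity
  have ht₂ : 0 ≤ n * ρ₂ := by positivity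
  have ht' : 0 ≤ n * ρ' := by positivity
  have hl₂ := sub_one_le_log_floor_exp ht₂
  have hl' := sub_one_le_log_floor_exp ht'
  have hp₂ := one_le_exp_floor ht₂
  have hp' := one_le_exp_floor ht'
  have hKa : ((⌊Real.exp (n * ρ₁)⌋₊ * ⌊Real.exp (n * ρ₂)⌋₊ * ⌊Real.exp (n * ρ')⌋₊ : ℕ) : ℝ) ≤
      Real.exp (n * (1 / 2 * Real.log (1 + a * r ^ 2) - 2 * δ)) := by
    rw [← hδC, mul_add, mul_add, Real.exp_add, Real.exp_add]
    push_cast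
    gcongr <;> exact Nat.floor_le (Real.exp_pos _).le
  obtain ⟨c, h₁, h₂, hc⟩ := exists_code_le hn (one_le_exp_floor ht₁) hp₂ hp' ha hb₁ hb₂ hν
    hδ hε hpow hKa (by linarith [mul_le_mul_of_nonneg_left hCb₂ hn'.le])
    (hCb₁.imp (fun h => by simp [h]) fun h => by
      rw [Nat.cast_mul, Real.log_mul (by positivity) (by positivity)]
      linarith [mul_le_mul_of_nonneg_left h hn'.le])
  exact ⟨c, h₁, h₂, hc.trans (ENNReal.ofReal_le_ofReal hle)⟩

/-! ### From approximate codes to achievability. -/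

/-- How far a code is from serving the rate pair `R`. -/
noncomputable def Code.defect {n : ℕ} {P : ℝ} (c : Code n P) (a b₁ b₂ : ℝ)
    (ν : Measure (ℝ × ℝ × ℝ)) (R : ℝ × ℝ) : ENNReal :=
  ENNReal.ofReal |c.rate₁ - R.1| + ENNReal.ofReal |c.rate₂ - R.2| +
    (c.errorProb a ν + mutualInfo (c.law ν) c.messages (c.outputZ₂ b₂) / (n : ENNReal) +
      mutualInfo (c.law ν) c.message₁ (c.outputZ₁ b₁) / (n : ENNReal))

theorem tendsto_of_tendsto_ofReal_abs_sub {f : ℕ → ℝ} {x : ℝ}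
    (h : Tendsto (fun n => ENNReal.ofReal |f n - x|) atTop (𝓝 0)) : Tendsto f atTop (𝓝 x) := by
  rw [tendsto_iff_dist_tendsto_zero]
  have h' := (ENNReal.tendsto_toReal ENNReal.zero_ne_top).comp h
  simpa [Function.comp_def, ENNReal.toReal_ofReal, Real.dist_eq] using h'

/-- A single number controls all five limits, which avoids a diagonal argument: at each block length
a nearly optimal code is taken. The slack `1 / n` is there because the infimum need not be attained.
-/
theorem achievable_of_defect {P a b₁ b₂ : ℝ} (hP : 0 ≤ P) {ν : Measure (ℝ × ℝ × ℝ)} {R : ℝ × ℝ}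
    (h : ∀ η : ℝ, 0 < η → ∀ᶠ n : ℕ in atTop, ∃ c : Code n P,
      c.defect a b₁ b₂ ν R ≤ ENNReal.ofReal η) : Achievable P a b₁ b₂ ν R := by
  have hinf : Tendsto (fun n : ℕ => ⨅ c : Code n P, c.defect a b₁ b₂ ν R) atTop (𝓝 0) := by
    rw [ENNReal.tendsto_nhds_zero]
    intro ε hε
    obtain ⟨η, hη, hηε⟩ := ENNReal.lt_iff_exists_nnreal_btwn.1 hε
    filter_upwards [h η (by exact_mod_cast hη)] with n ⟨c, hc⟩
    rw [ENNReal.ofReal_coe_nnreal] at hc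
    exact (iInf_le _ c).trans (hc.trans hηε.le)
  have hex : ∀ n : ℕ, ∃ c : Code n P, c.defect a b₁ b₂ ν R ≤
      (⨅ c : Code n P, c.defect a b₁ b₂ ν R) + (n : ENNReal)⁻¹ := by
    intro n
    by_cases htop : (⨅ c : Code n P, c.defect a b₁ b₂ ν R) = ⊤
    · exact ⟨Code.trivial n hP, by rw [htop, top_add]; exact le_top⟩
    · obtain ⟨c, hc⟩ := iInf_lt_iff.1 (ENNReal.lt_add_right htop
        (ENNReal.inv_ne_zero.2 (ENNReal.natCast_ne_top n)))
      exact ⟨c, hc.le⟩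
  choose c hc using hex
  have hlim : Tendsto (fun n => (c n).defect a b₁ b₂ ν R) atTop (𝓝 0) := by
    have h0 := hinf.add ENNReal.tendsto_inv_nat_nhds_zero
    rw [add_zero] at h0
    exact tendsto_of_tendsto_of_tendsto_of_le_of_le tendsto_const_nhds h0
      (fun _ => zero_le) hc
  have hsq : ∀ {f : ℕ → ENNReal}, (∀ n, f n ≤ (c n).defect a b₁ b₂ ν R) →
      Tendsto f atTop (𝓝 0) := fun hf =>
    tendsto_of_tendsto_of_tendsto_of_le_of_le tendsto_const_nhds hlim (fun _ => zero_le) hf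
  exact ⟨c, tendsto_of_tendsto_ofReal_abs_sub (hsq fun n => le_self_add.trans le_self_add),
    tendsto_of_tendsto_ofReal_abs_sub (hsq fun n => le_add_self.trans le_self_add),
    hsq fun n => (le_self_add.trans le_self_add).trans le_add_self,
    hsq fun n => (le_add_self.trans le_self_add).trans le_add_self,
    hsq fun n => le_add_self.trans le_add_self⟩

theorem achievable_zero {P a b₁ b₂ : ℝ} (hP : 0 ≤ P) {ν : Measure (ℝ × ℝ × ℝ)}
    (hν : IsUnitGaussianNoise ν) : Achievable P a b₁ b₂ ν (0, 0) := by
  refine achievable_of_defect hP fun η _ => Eventually.of_forall fun n => ⟨Code.trivial n hP, ?_⟩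
  rw [Code.defect, Code.errorProb_eq_zero _ rfl rfl, Code.mutualInfo_messages_eq_zero _ rfl rfl hν,
    Code.mutualInfo_message₁_eq_zero _ rfl hν]
  simp [Code.rate₁, Code.rate₂, Code.trivial, Code.ofCodebook]

theorem exists_sq_lt_and_lt_log {P a κ : ℝ} (hP : 0 < P) (ha : 0 ≤ a) (hκ : 0 < κ)
    (hA : 0 < 1 / 2 * Real.log (1 + a * P)) :
    ∃ r : ℝ, r ^ 2 < P ∧ (1 - κ) * (1 / 2 * Real.log (1 + a * P)) <
      1 / 2 * Real.log (1 + a * r ^ 2) := by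
  have hc : ContinuousAt (fun r : ℝ => 1 / 2 * Real.log (1 + a * r ^ 2)) √P := by
    have : 1 + a * √P ^ 2 ≠ 0 := by positivity
    fun_prop (disch := assumption)
  have hlt : (1 - κ) * (1 / 2 * Real.log (1 + a * P)) < 1 / 2 * Real.log (1 + a * √P ^ 2) := by
    rw [Real.sq_sqrt hP.le]
    nlinarith
  have hs : 0 < √P := Real.sqrt_pos.2 hP
  obtain ⟨r, hr, hr0, hrP⟩ := (((hc.tendsto.eventually_const_lt hlt).filter_mono
    nhdsWithin_le_nhds).and (Ioo_mem_nhdsLT hs)).exists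
  exact ⟨r, (Real.lt_sqrt hr0.le).1 hrP, hr⟩

theorem achievable_of_mem_region {P a b₁ b₂ : ℝ} (hP : 0 ≤ P) (ha : 0 ≤ a) (hb₁ : 0 ≤ b₁)
    (hb₂ : 0 ≤ b₂) {ν : Measure (ℝ × ℝ × ℝ)} (hν : IsUnitGaussianNoise ν) {R : ℝ × ℝ}
    (hR₁ : 0 ≤ R.1) (hR₂ : 0 ≤ R.2) (h₁ : R.1 ≤ Cs P a b₁) (h₂ : R.1 + R.2 ≤ Cs P a b₂) :
    Achievable P a b₁ b₂ ν R := by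
  have hl2 : 0 < Real.log 2 := Real.log_pos one_lt_two
  -- The zero pair is settled by trivial codes. Otherwise a positive sum rate rules out the zero
  -- branch of the maximum in `Cs P a b₂`, and with it `P = 0`.
  by_cases h0 : R.1 + R.2 = 0
  · have : R = (0, 0) := Prod.ext (by simp only; linarith) (by simp only; linarith)
    rw [this]
    exact achievable_zero hP hν
  have hpos : 0 < R.1 + R.2 := lt_of_le_of_ne (by linarith) (Ne.symm h0)
  have hB₁ : 0 ≤ 1 / 2 * Real.log (1 + b₁ * P) :=
    mul_nonneg (by norm_num) (Real.log_nonneg (by nlinarith))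
  have hB₂ : 0 ≤ 1 / 2 * Real.log (1 + b₂ * P) :=
    mul_nonneg (by norm_num) (Real.log_nonneg (by nlinarith))
  -- The strong eavesdropper may beat the legitimate receiver; then only `R.1 = 0` is possible,
  -- whence the alternative.
  have hS₁ : R.1 = 0 ∨
      R.1 * Real.log 2 ≤ 1 / 2 * Real.log (1 + a * P) - 1 / 2 * Real.log (1 + b₁ * P) := by
    have h := mul_le_mul_of_nonneg_right h₁ hl2.le
    rw [← CsNat_eq, CsNat, le_max_iff] at h
    exact h.imp_left fun h => le_antisymm (nonpos_of_mul_nonpos_left h hl2) hR₁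
  have hS₂ : (R.1 + R.2) * Real.log 2 ≤
      1 / 2 * Real.log (1 + a * P) - 1 / 2 * Real.log (1 + b₂ * P) := by
    have h := mul_le_mul_of_nonneg_right h₂ hl2.le
    rw [← CsNat_eq, CsNat, le_max_iff] at h
    exact h.resolve_left fun h => absurd (mul_pos hpos hl2) (not_lt.2 h)
  have hSpos := mul_pos hpos hl2
  have hmono : ∀ {b r : ℝ}, 0 ≤ b → r ^ 2 < P →
      1 / 2 * Real.log (1 + b * r ^ 2) ≤ 1 / 2 * Real.log (1 + b * P) := fun hb hr => by
    gcongr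
  have hP' : 0 < P := hP.lt_of_ne fun h => by
    rw [← h] at hS₂
    simp only [mul_zero, add_zero, Real.log_one, sub_zero] at hS₂
    linarith
  refine achievable_of_defect hP fun η hη => ?_
  set A := 1 / 2 * Real.log (1 + a * P) with hA
  set B₁ := 1 / 2 * Real.log (1 + b₁ * P)
  set B₂ := 1 / 2 * Real.log (1 + b₂ * P)
  -- `κ * T` collects the two rate losses, four times the resolvability deficit `κ * (B₁ + B₂)`, and
  -- the strict margin `κ`. It uses half of `η`; rounding the message counts uses the other half.
  set T := R.1 + R.2 + 4 * (B₁ + B₂) + 1 with hT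
  have hTpos : 0 < T := by positivity
  obtain ⟨κ, hκ, hκ1, hκT⟩ : ∃ κ > 0, κ ≤ 1 ∧ κ * T ≤ η / 2 :=
    ⟨min 1 (η / 2 / T), lt_min one_pos (by positivity), min_le_left _ _,
      (le_div_iff₀ hTpos).1 (min_le_right _ _)⟩
  have hκ' : 0 ≤ 1 - κ := by linarith
  obtain ⟨r, hr, hrA⟩ := exists_sq_lt_and_lt_log hP' ha hκ (show 0 < A by linarith)
  rw [← hA] at hrA
  have hm₁ : 1 / 2 * Real.log (1 + b₁ * r ^ 2) ≤ B₁ := hmono hb₁ hr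
  have hm₂ : 1 / 2 * Real.log (1 + b₂ * r ^ 2) ≤ B₂ := hmono hb₂ hr
  have hκB₁ : 0 ≤ κ * B₁ := mul_nonneg hκ.le hB₁
  have hκB₂ : 0 ≤ κ * B₂ := mul_nonneg hκ.le hB₂
  have hlim : Tendsto (fun n : ℕ => 2 * ((Real.log 2)⁻¹ * (n : ℝ)⁻¹)) atTop (𝓝 0) := by
    simpa using (tendsto_inv_atTop_nhds_zero_nat.const_mul (Real.log 2)⁻¹).const_mul 2
  -- All rates are shrunk by `1 - κ` and the randomization fills the rest, so the total is `(1 - κ)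
  -- * A`, below the capacity at power `r²`. The deficit in randomization is at most `κ * B₁` or `κ
  -- * B₂`, hence the choice of `ε`.
  filter_upwards [eventually_exists_code ha hb₁ hb₂ hν hr
      (ρ₁ := (1 - κ) * (R.1 * Real.log 2)) (ρ₂ := (1 - κ) * (R.2 * Real.log 2))
      (ρ' := (1 - κ) * (A - (R.1 + R.2) * Real.log 2)) (ε := κ * (B₁ + B₂))
      (η := 4 * (κ * (B₁ + B₂)) + κ) (by positivity) (by positivity)
      (mul_nonneg hκ' (by linarith)) (by positivity) (by linarith) (by linarith)
      (by linarith [mul_le_mul_of_nonneg_left hS₂ hκ'])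
      (hS₁.imp (fun h => by simp [h]) fun h => by
        linarith [mul_le_mul_of_nonneg_left h hκ']),
    hlim.eventually_le_const (half_pos hη), eventually_gt_atTop 0] with n ⟨c, hc₁, hc₂, hc⟩ hle hn
  refine ⟨c, ?_⟩
  have hr₁ : |c.rate₁ - R.1| ≤ κ * R.1 + (Real.log 2)⁻¹ * (n : ℝ)⁻¹ := by
    rw [Code.rate₁, hc₁]
    exact abs_logb_floor_exp_div_sub_le hn hR₁ hκ.le hκ1
  have hr₂ : |c.rate₂ - R.2| ≤ κ * R.2 + (Real.log 2)⁻¹ * (n : ℝ)⁻¹ := by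
    rw [Code.rate₂, hc₂]
    exact abs_logb_floor_exp_div_sub_le hn hR₂ hκ.le hκ1
  rw [Code.defect]
  refine (add_le_add le_rfl hc).trans ?_
  rw [← ENNReal.ofReal_add (abs_nonneg _) (abs_nonneg _),
    ← ENNReal.ofReal_add (by positivity) (by positivity)]
  refine ENNReal.ofReal_le_ofReal ?_
  rw [hT] at hκT
  nlinarith

end TwoLevelWiretap

theorem theorem4 (P a b₁ b₂ : ℝ) (hP : 0 ≤ P) (ha : 0 ≤ a) (hb₂ : 0 ≤ b₂) (hb : b₂ ≤ b₁)
    (ν : Measure (ℝ × ℝ × ℝ)) (hν : TwoLevelWiretap.IsUnitGaussianNoise ν) :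
    TwoLevelWiretap.secrecyCapacityRegion P a b₁ b₂ ν =
      {R : ℝ × ℝ | 0 ≤ R.1 ∧ 0 ≤ R.2 ∧
        R.1 ≤ TwoLevelWiretap.Cs P a b₁ ∧
        R.1 + R.2 ≤ TwoLevelWiretap.Cs P a b₂} := by
  ext R
  exact ⟨fun h => TwoLevelWiretap.Achievable.mem_region hP ha (hb₂.trans hb) hb₂ hν h,
    fun ⟨hR₁, hR₂, h₁, h₂⟩ => TwoLevelWiretap.achievable_of_mem_region hP ha (hb₂.trans hb) hb₂ hν
      hR₁ hR₂ h₁ h₂⟩
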